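/- A *virtual diagram* is a generic smooth immersion in $\mathbb R^2$ of an oriented circle (finitely many multiple points, all of them transverse double points, called crossings), considered up to orientation-preserving reparametrization, together with a partition of its crossings into *real* and *virtual* crossings. Let $n\ge 1$ and let $D$ be a virtual diagram with $n$ real crossings. Removing a small open regular neighbourhood of the real crossings leaves $2n$ immersed arcs, the *semiarcs* of $D$; what is removed consists of $2n$ short oriented arcs, the *branches*, two through each real crossing. A branch is *left* (L) if, as one moves along it, the other branch at the same crossing passes from the left to the right, and *right* (R) if the other branch passes from the right to the left. A *labeling of real crossings* of $D$ is a bijection from the real crossings to $\{1,\dots,n\}$, and a *base semiarc* is a chosen semiarc. A *detour move* replaces one semiarc of a diagram by another immersed arc with the same ends so that the result is again a virtual diagram; it changes nothing else, the real crossings stay the same, and all crossings on the new arc are virtual. Virtual diagrams with a base semiarc and a labeling of real crossings are *strictly equivalent* if they are related by a finite sequence of detour moves and (ambient) isotopies of $\mathbb R^2$ that respect the base semiarcs and the labelings; if the base semiarc is itself detoured, the arc that replaces it is the new base semiarc. A *Gauss code* on $n$ letters is a sequence $x_1x_2\dots x_{2n}$ of elements of $J=\{1,\dots,n\}\times\{L,R\}$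 in which every element of $J$ appears. The *Gauss code* of a virtual diagram $D$ with $n$ real crossings, a base semiarc $a_0$ and a labeling of real crossings is the sequence $x_1x_2\dots x_{2n}$ where, if $b_1,\dots,b_{2n}$ are the branches at the real crossings in the order in which they are met moving along $D$ from $a_0$, $x_i=(j,L)$ or $x_i=(j,R)$, with $j$ the label of the real crossing on $b_i$ and $L$ or $R$ according as $b_i$ is a left or a right branch. **Proposition.** Let $n\ge 1$. Each virtual diagram with $n$ real crossings, equipped with a base semiarc and a labeling of real crossings, has exactly one Gauss code, this code depends only on the strict equivalence class, and assigning it to the class is a bijection from the set of strict equivalence classes of virtual diagrams with $n$ real crossings equipped with a base semiarc and a labeling of real crossings to the set of Gauss codes on $n$ letters. -/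

import Mathlib

open scoped ContDiff

namespace VirtualDoodle

/-- The plane `ℝ²`. -/
abbrev Plane : Type := EuclideanSpace ℝ (Fin 2)

/-- The determinant of two plane vectors; it is positive iff `v` points to the left of `u`. -/
def det2 (u v : Plane) : ℝ := u 0 * v 1 - u 1 * v 0

/-- The velocity of a closed plane curve, parametrized by `ℝ / ℤ`, at a real parameter. -/
noncomputable def velocity (γ : UnitAddCircle → Plane) (t : ℝ) : Plane :=
  deriv (fun s : ℝ => γ (s : UnitAddCircle)) t

/-- A virtual diagram: a generic smooth immersion of the oriented circle `ℝ / ℤ` in the plane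
(all multiple points are transverse double points), with a set of crossings declared real.
All the other crossings are virtual. -/
structure VirtualDiagram where
  curve : UnitAddCircle → Plane
  smooth : ContDiff ℝ ∞ (fun t : ℝ => curve (t : UnitAddCircle))
  immersed : ∀ t : ℝ, velocity curve t ≠ 0
  transverse : ∀ s t : ℝ, (s : UnitAddCircle) ≠ (t : UnitAddCircle) →
    curve s = curve t → det2 (velocity curve s) (velocity curve t) ≠ 0
  no_triple : ∀ r s t : UnitAddCircle, curve r = curve s → curve s = curve t →
    r = s ∨ s = t ∨ r = t
  realCrossings : Set Plane
  real_isCrossing : ∀ x ∈ realCrossings,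
    ∃ s t : UnitAddCircle, s ≠ t ∧ curve s = x ∧ curve t = x

/-- A semiarc, recorded by its parameters: a connected component of the circle with the preimages
of the real crossings removed. (Shrinking such an open arc slightly at both ends gives the closed
arc left after removal of an open regular neighbourhood of the real crossings.) -/
def VirtualDiagram.IsSemiarc (D : VirtualDiagram) (A : Set UnitAddCircle) : Prop :=
  ∃ t : UnitAddCircle, D.curve t ∉ D.realCrossings ∧
    A = connectedComponentIn {s | D.curve s ∉ D.realCrossings} t

/-- The branch through parameter `t` is a left branch: the other branch of the crossing passes
from the left to the right. -/
def VirtualDiagram.IsLeftBranch (D : VirtualDiagram) (t : ℝ) : Prop :=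
  ∃ s : ℝ, (s : UnitAddCircle) ≠ (t : UnitAddCircle) ∧ D.curve s = D.curve t ∧
    det2 (velocity D.curve t) (velocity D.curve s) < 0

/-- The branch through parameter `t` is a right branch: the other branch of the crossing passes
from the right to the left. -/
def VirtualDiagram.IsRightBranch (D : VirtualDiagram) (t : ℝ) : Prop :=
  ∃ s : ℝ, (s : UnitAddCircle) ≠ (t : UnitAddCircle) ∧ D.curve s = D.curve t ∧
    0 < det2 (velocity D.curve t) (velocity D.curve s)

/-- A virtual diagram with `n` real crossings, equipped with a base semiarc and a labeling of the
real crossings. The `n` labels are the elements of `Fin n`. -/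
structure MarkedDiagram (n : ℕ) extends VirtualDiagram where
  label : realCrossings ≃ Fin n
  base : Set UnitAddCircle
  base_isSemiarc : toVirtualDiagram.IsSemiarc base

/-- The second components of the letters of a Gauss code. -/
inductive Side
  | L
  | R

/-- Gauss codes on `n` letters: sequences of length `2n` in `J = {1, …, n} × {L, R}` in which all
elements of `J` appear. -/
def GaussCode (n : ℕ) : Type :=
  {w : Fin (2 * n) → Fin n × Side // Function.Surjective w}

/-- The branch through parameter `t` is a branch at a real crossing, with `J`-label `x`. -/
def MarkedDiagram.HasJLabel {n : ℕ} (D : MarkedDiagram n) (t : ℝ) (x : Fin n × Side) : Prop :=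
  (∃ h : D.curve t ∈ D.realCrossings, D.label ⟨D.curve t, h⟩ = x.1) ∧
    match x.2 with
    | Side.L => D.toVirtualDiagram.IsLeftBranch t
    | Side.R => D.toVirtualDiagram.IsRightBranch t

/-- `w` is the Gauss code of `D`: moving once along `D` from a point of the base semiarc one meets
`2n` branches at real crossings, and `w` is the sequence of their `J`-labels. -/
def MarkedDiagram.HasGaussCode {n : ℕ} (D : MarkedDiagram n) (w : GaussCode n) : Prop :=
  ∃ t₀ : ℝ, (t₀ : UnitAddCircle) ∈ D.base ∧
    ∃ t : Fin (2 * n) → ℝ, StrictMono t ∧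
      (∀ i, t₀ < t i ∧ t i < t₀ + 1) ∧ ∀ i, D.HasJLabel (t i) (w.1 i)

/-- `D` and `D'` are parametrizations of the same marked oriented diagram: they differ by an
orientation-preserving diffeomorphism of the circle, given by its lift `h` to the line. -/
def SameDiagram {n : ℕ} (D D' : MarkedDiagram n) : Prop :=
  ∃ h : ℝ → ℝ, ContDiff ℝ ∞ h ∧ (∀ t, 0 < deriv h t) ∧ (∀ t, h (t + 1) = h t + 1) ∧
    (∀ t : ℝ, D'.curve (t : UnitAddCircle) = D.curve (h t : UnitAddCircle)) ∧
    D'.realCrossings = D.realCrossings ∧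
    (∀ (x : Plane) (hx : x ∈ D.realCrossings) (hx' : x ∈ D'.realCrossings),
      D'.label ⟨x, hx'⟩ = D.label ⟨x, hx⟩) ∧
    ∀ t : ℝ, (t : UnitAddCircle) ∈ D'.base ↔ (h t : UnitAddCircle) ∈ D.base

/-- A (smooth, ambient) isotopy of the plane: a smooth family of diffeomorphisms that starts at the
identity. Time is allowed to run over `ℝ`; the isotopy ends at time `1`. -/
structure IsIsotopy (φ : ℝ → Plane → Plane) : Prop where
  smooth : ContDiff ℝ ∞ (fun p : ℝ × Plane => φ p.1 p.2)
  diffeo : ∀ t, ∃ ψ : Plane → Plane, ContDiff ℝ ∞ ψ ∧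
    Function.LeftInverse ψ (φ t) ∧ Function.RightInverse ψ (φ t)
  zero : ∀ x, φ 0 x = x

/-- `D'` is the image of `D` at the end of an isotopy of the plane, which carries real crossings,
labels and base semiarc along. -/
def IsotopyMove {n : ℕ} (D D' : MarkedDiagram n) : Prop :=
  ∃ φ : ℝ → Plane → Plane, IsIsotopy φ ∧
    (∀ t : UnitAddCircle, D'.curve t = φ 1 (D.curve t)) ∧
    D'.realCrossings = φ 1 '' D.realCrossings ∧
    (∀ (x : Plane) (hx : x ∈ D.realCrossings) (hx' : φ 1 x ∈ D'.realCrossings),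
      D'.label ⟨φ 1 x, hx'⟩ = D.label ⟨x, hx⟩) ∧
    D'.base = D.base

/-- A detour move: `D` and `D'` are identical, with the same real crossings, except for one semiarc
`A`. As semiarcs stay away from a neighbourhood of the real crossings, the two curves agree
outside a compact part `K` of `A`. Labels and base semiarc are kept (if `A` is the base semiarc
of `D`, the arc that replaces it is the base semiarc of `D'`). -/
def DetourMove {n : ℕ} (D D' : MarkedDiagram n) : Prop :=
  ∃ A : Set UnitAddCircle,
    D.toVirtualDiagram.IsSemiarc A ∧ D'.toVirtualDiagram.IsSemiarc A ∧
    (∃ K : Set UnitAddCircle, IsCompact K ∧ K ⊆ A ∧ ∀ t, t ∉ K → D'.curve t = D.curve t) ∧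
    D'.realCrossings = D.realCrossings ∧
    (∀ (x : Plane) (hx : x ∈ D.realCrossings) (hx' : x ∈ D'.realCrossings),
      D'.label ⟨x, hx'⟩ = D.label ⟨x, hx⟩) ∧
    D'.base = D.base

/-- Strict equivalence: the equivalence relation generated by detour moves and isotopies of the
plane (and reparametrizations, which do not change the diagram), with respect to the base semiarc
and the labeling of real crossings. -/
def strictSetoid (n : ℕ) : Setoid (MarkedDiagram n) :=
  Relation.EqvGen.setoid
    (fun D D' => SameDiagram D D' ∨ IsotopyMove D D' ∨ DetourMove D D')

/-- The set of strict equivalence classes of virtual diagrams with `n` real crossings equipped with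
a base semiarc and a labeling of real crossings. -/
def StrictClass (n : ℕ) : Type := Quotient (strictSetoid n)

end VirtualDoodle

/-! The code exists because each of the 2n letters labels exactly one parameter in a period: the two
branches at a real crossing see each other with opposite signs of `det2`. Listing these parameters
in increasing order from a base point gives the code, and another base point of the same semiarc
gives the same list up to an integer shift. The moves preserve the letters: a reparametrization
rescales velocities by positive factors, an isotopy multiplies `det2` by a positive Jacobian
(`IsIsotopy.detMap_pos`), and a detour changes nothing near the real crossings.

For injectivity, a diagram is brought to a standard form dictated by its code alone. The `i`-th
branch, counted from 0, is met at time i/(2n), crossing `j` sits at (j, 0), and near it the right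
branch is horizontal, the left branch vertical, both straight and of unit speed. A circle
diffeomorphism adjusts the times (`exists_circle_lift`), an isotopy moves the crossings together
with their tangent frames (`exists_movesFrames`), and another one straightens the branches
(`exists_isotopicToId_germs`).

Two standard diagrams `c`, `c'` with the same code agree near the real crossings, so they differ by
replacing the 2n arcs one at a time. Each replacement is a detour move if the intermediate curves
are generic. A mixture of arcs of `c` and `c'` need not be, so the arcs of `c` are perturbed one by
one, and the perturbed arcs are exchanged for those of `c'`. Almost every perturbation makes all
these curves generic at once (`IsStd.strict`).

The general position result `ae_isGeneric` is parametric transversality: every degeneracy is a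
linear system in the coefficients of the perturbation with more equations than free parameters, so
it occurs on a null set only (`ae_forall_ne_of_finrank_lt`). It also gives surjectivity: any smooth
closed curve containing the standard segments of a code becomes generic after a perturbation away
from the crossings. -/

namespace VirtualDoodle

open Set Filter Topology MeasureTheory Module
open scoped NNReal

/-! ### Parametric transversality by a dimension count. -/

/-- A linear family of equations with surjective left hand sides, indexed by fewer parameters than
there are equations, has solutions for almost no vector. -/
theorem ae_forall_ne_of_finrank_lt {ι E Q : Type*} [Fintype ι]
    [NormedAddCommGroup E] [NormedSpace ℝ E] [FiniteDimensional ℝ E]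
    [NormedAddCommGroup Q] [NormedSpace ℝ Q] [FiniteDimensional ℝ Q]
    (hEQ : finrank ℝ E < finrank ℝ Q) {L : E → ((ι → ℝ) →L[ℝ] Q)} {c : E → Q}
    (hL : ContDiff ℝ 1 L) (hc : ContDiff ℝ 1 c) (O : Set E)
    (hO : ∀ θ ∈ O, Function.Surjective (L θ)) :
    ∀ᵐ p : ι → ℝ, ∀ θ ∈ O, L θ p ≠ c θ := by
  have local_null : ∀ θ₀ ∈ O, ∃ V ∈ 𝓝 θ₀,
      volume {p : ι → ℝ | ∃ θ ∈ V, L θ p = c θ} = 0 := by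
    intro θ₀ h₀
    obtain ⟨R₀, hR₀⟩ := (L θ₀).toLinearMap.exists_rightInverse_of_surjective
      (LinearMap.range_eq_top.2 (hO θ₀ h₀))
    let R : Q →L[ℝ] (ι → ℝ) := LinearMap.toContinuousLinearMap R₀
    have hR : ∀ q, L θ₀ (R q) = q := fun q => LinearMap.congr_fun hR₀ q
    let K : Submodule ℝ (ι → ℝ) := LinearMap.ker (L θ₀).toLinearMap
    -- A right inverse of `L θ₀` is almost one of `L θ` for nearby `θ`; the error `A θ` is near the
    -- identity, hence invertible.
    let A : E → (Q →L[ℝ] Q) := fun θ => (L θ).comp R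
    have hA : ContDiff ℝ 1 A := hL.clm_comp contDiff_const
    have hA₀ : A θ₀ = ContinuousLinearMap.id ℝ Q := by
      ext q; simp [A, hR]
    have hunit : ∀ᶠ θ in 𝓝 θ₀, IsUnit (A θ) := by
      apply (hA.continuous.continuousAt (x := θ₀)).eventually
      rw [hA₀]
      exact Units.isOpen.mem_nhds isUnit_one
    obtain ⟨r, r0, hr⟩ := Metric.eventually_nhds_iff_ball.1 hunit
    -- Near `θ₀` all solutions are parametrized by `θ` and a kernel vector `k` of `L θ₀`: the
    -- summand in the image of `R` is then forced.
    let F : E × K → (ι → ℝ) := fun x =>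
      (x.2 : ι → ℝ) + R (Ring.inverse (A x.1) (c x.1 - L x.1 (x.2 : ι → ℝ)))
    have hF : ContDiffOn ℝ 1 F (Metric.ball θ₀ r ×ˢ univ) := by
      intro x hx
      apply ContDiffAt.contDiffWithinAt
      have h2 : ContDiff ℝ 1 (fun x : E × K => (x.2 : ι → ℝ)) :=
        (K.subtypeL.contDiff).comp contDiff_snd
      obtain ⟨u, hu⟩ := hr x.1 hx.1
      have hinv : ContDiffAt ℝ 1 (fun x : E × K => Ring.inverse (A x.1)) x := by
        have : ContDiffAt ℝ 1 Ring.inverse (A x.1) := by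
          rw [← hu]; exact contDiffAt_ringInverse ℝ u
        exact ContDiffAt.comp x this (hA.comp contDiff_fst).contDiffAt
      refine h2.contDiffAt.add (R.contDiff.contDiffAt.comp x (hinv.clm_apply ?_))
      exact ((hc.comp contDiff_fst).sub ((hL.comp contDiff_fst).clm_apply h2)).contDiffAt
    -- A `C^1` map does not raise Hausdorff dimension, and dim E + dim ker < dim Q + dim ker = card
    -- ι.
    have hdim : dimH (F '' (Metric.ball θ₀ r ×ˢ univ)) < (Fintype.card ι : NNReal) := by
      calc dimH (F '' (Metric.ball θ₀ r ×ˢ univ))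
          ≤ dimH (Metric.ball θ₀ r ×ˢ (univ : Set K)) :=
            hF.dimH_image_le ((convex_ball _ _).prod convex_univ) subset_rfl
        _ ≤ dimH (univ : Set (E × K)) := dimH_mono (subset_univ _)
        _ = (finrank ℝ (E × K) : ℕ) := Real.dimH_univ_eq_finrank _
        _ < (Fintype.card ι : NNReal) := by
            have h1 := (L θ₀).toLinearMap.finrank_range_add_finrank_ker
            rw [LinearMap.range_eq_top.2 (hO θ₀ h₀), finrank_top,
              Module.finrank_fintype_fun_eq_card] at h1
            have : finrank ℝ (E × K) < Fintype.card ι := by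
              rw [Module.finrank_prod]
              change _ + finrank ℝ (LinearMap.ker (L θ₀).toLinearMap) < _
              omega
            exact_mod_cast this
    refine ⟨_, Metric.ball_mem_nhds θ₀ r0, ?_⟩
    have h0 := hausdorffMeasure_of_dimH_lt hdim
    have h1 : volume (F '' (Metric.ball θ₀ r ×ˢ univ)) = 0 := by
      rw [← hausdorffMeasure_pi_real]; exact_mod_cast h0
    refine measure_mono_null ?_ h1
    rintro p ⟨θ, hθ, hp⟩
    have hk : p - R (L θ₀ p) ∈ K := by
      change L θ₀ (p - R (L θ₀ p)) = 0
      rw [map_sub, hR, sub_self]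
    refine ⟨(θ, ⟨_, hk⟩), ⟨hθ, mem_univ _⟩, ?_⟩
    have h3 : c θ - L θ (p - R (L θ₀ p)) = A θ (L θ₀ p) := by
      rw [map_sub, ← hp]; simp [A]
    have h4 : Ring.inverse (A θ) (A θ (L θ₀ p)) = L θ₀ p := by
      have := Ring.inverse_mul_cancel _ (hr θ hθ)
      exact DFunLike.congr_fun this (L θ₀ p)
    simp only [F, h3, h4]
    abel
  choose! V hV hV0 using local_null
  obtain ⟨t, htO, htc, hcov⟩ := TopologicalSpace.countable_cover_nhdsWithin
    (f := V) (s := O) (fun θ hθ => mem_nhdsWithin_of_mem_nhds (hV θ hθ))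
  have : ∀ᵐ p : ι → ℝ, ∀ θ₀ ∈ t, ¬ ∃ θ ∈ V θ₀, L θ p = c θ := by
    rw [ae_ball_iff htc]
    intro θ₀ h
    rw [ae_iff]
    simpa using hV0 θ₀ (htO h)
  filter_upwards [this] with p hp θ hθ he
  obtain ⟨θ₀, h₀, h⟩ := mem_iUnion₂.1 (hcov hθ)
  exact hp θ₀ h₀ ⟨θ, h, he⟩

/-! ### Generic curves and their general position. -/

theorem coe_circle_eq_iff {s t : ℝ} : (s : UnitAddCircle) = t ↔ ∃ n : ℤ, s = t + n := by
  rw [← sub_eq_zero, ← AddCircle.coe_sub, AddCircle.coe_eq_zero_iff]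
  constructor
  · rintro ⟨n, hn⟩; exact ⟨n, by simp at hn; linarith⟩
  · rintro ⟨n, hn⟩; exact ⟨n, by simp; linarith⟩

theorem one_sub_cos_ne_zero {s t : ℝ} (h : (s : UnitAddCircle) ≠ t) :
    1 - Real.cos (2 * Real.pi * (s - t)) ≠ 0 := by
  intro h0
  have h1 : Real.cos (2 * Real.pi * (s - t)) = 1 := by linarith
  obtain ⟨n, hn⟩ := (Real.cos_eq_one_iff _).1 h1
  apply h
  rw [coe_circle_eq_iff]
  refine ⟨n, ?_⟩
  have hpi : (2 * Real.pi) ≠ 0 := by positivity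
  have : (2 * Real.pi) * n = (2 * Real.pi) * (s - t) := by linarith
  have := mul_left_cancel₀ hpi this
  linarith

/-- A generic closed plane curve, given by a periodic function on the line. -/
structure IsGeneric (c : ℝ → Plane) : Prop where
  smooth : ContDiff ℝ ∞ c
  periodic : Function.Periodic c 1
  immersed : ∀ t, deriv c t ≠ 0
  transverse : ∀ s t : ℝ, (s : UnitAddCircle) ≠ t → c s = c t → det2 (deriv c s) (deriv c t) ≠ 0
  no_triple : ∀ r s t : ℝ, c r = c s → c s = c t →
    (r : UnitAddCircle) = s ∨ (s : UnitAddCircle) = t ∨ (r : UnitAddCircle) = t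

/-- The restriction of a curve to a set of parameters is generic. -/
structure IsGenericOn (c : ℝ → Plane) (S : Set ℝ) : Prop where
  immersed : ∀ t ∈ S, deriv c t ≠ 0
  transverse : ∀ s ∈ S, ∀ t ∈ S, (s : UnitAddCircle) ≠ t → c s = c t →
    det2 (deriv c s) (deriv c t) ≠ 0
  no_triple : ∀ r ∈ S, ∀ s ∈ S, ∀ t ∈ S, c r = c s → c s = c t →
    (r : UnitAddCircle) = s ∨ (s : UnitAddCircle) = t ∨ (r : UnitAddCircle) = t

theorem det2_swap (u v : Plane) : det2 u v = -det2 v u := by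
  simp [det2]; ring

theorem det2_smul_left (a : ℝ) (u v : Plane) : det2 (a • u) v = a * det2 u v := by
  simp [det2]; ring

theorem det2_smul_right (a : ℝ) (u v : Plane) : det2 u (a • v) = a * det2 u v := by
  simp [det2]; ring

theorem det2_self (u : Plane) : det2 u u = 0 := by
  simp [det2]; ring

theorem plane_ext {u v : Plane} (h0 : u 0 = v 0) (h1 : u 1 = v 1) : u = v := by
  ext i; fin_cases i <;> assumption

theorem det2_eq_zero_iff {u v : Plane} (hv : v ≠ 0) : det2 u v = 0 ↔ ∃ l : ℝ, u = l • v := by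
  constructor
  · intro h
    simp only [det2] at h
    by_cases h0 : v 0 = 0
    · have h1 : v 1 ≠ 0 := fun h1 => hv (plane_ext h0 h1)
      refine ⟨u 1 / v 1, plane_ext ?_ ?_⟩
      · have : u 0 * v 1 = 0 := by rw [h0] at h; linarith
        have := (mul_eq_zero.1 this).resolve_right h1
        simp [h0, this]
      · simp; field_simp
    · refine ⟨u 0 / v 0, plane_ext ?_ ?_⟩
      · simp; field_simp
      · simp; field_simp; linarith
  · rintro ⟨l, rfl⟩
    rw [det2_smul_left, det2_self, mul_zero]

/-- The double points of a curve that is generic on a set form a countable set. -/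
theorem IsGenericOn.countable_crossings {c : ℝ → Plane} {S : Set ℝ} (h : IsGenericOn c S)
    (hc : ContDiff ℝ 1 c) :
    {x | ∃ s ∈ S, ∃ t ∈ S, (s : UnitAddCircle) ≠ t ∧ c s = x ∧ c t = x}.Countable := by
  let Z : Set (ℝ × ℝ) := {z | z.1 ∈ S ∧ z.2 ∈ S ∧ (z.1 : UnitAddCircle) ≠ z.2 ∧ c z.1 = c z.2}
  have hZ : Z.Countable := by
    -- Transversality makes the derivative of (s, t) ↦ c s - c t invertible at a double point, so
    -- double points are isolated by the inverse function theorem. A set of isolated points is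
    -- countable by the Lindelöf property.
    have key : ∀ z ∈ Z, ∃ V ∈ 𝓝 z, ∀ y ∈ V, c y.1 = c y.2 → y = z := by
      intro z hz
      obtain ⟨h1, h2, h12, he⟩ := hz
      let f' : ℝ × ℝ →L[ℝ] Plane :=
        (ContinuousLinearMap.fst ℝ ℝ ℝ).smulRight (deriv c z.1) -
          (ContinuousLinearMap.snd ℝ ℝ ℝ).smulRight (deriv c z.2)
      have hd : ∀ t, HasStrictDerivAt c (deriv c t) t := fun t =>
        hc.contDiffAt.hasStrictDerivAt (by simp)
      have hf : HasStrictFDerivAt (fun y : ℝ × ℝ => c y.1 - c y.2) f' z := by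
        have e1 := (hd z.1).hasStrictFDerivAt.comp z (hasStrictFDerivAt_fst (𝕜 := ℝ))
        have e2 := (hd z.2).hasStrictFDerivAt.comp z (hasStrictFDerivAt_snd (𝕜 := ℝ))
        refine (e1.sub e2).congr_fderiv ?_
        ext <;> simp [f']
      have hdet := h.transverse _ h1 _ h2 h12 he
      have hker : f'.toLinearMap.ker = ⊥ := by
        rw [LinearMap.ker_eq_bot']
        rintro ⟨a, b⟩ hab
        have hab' : a • deriv c z.1 = b • deriv c z.2 := by
          have : a • deriv c z.1 - b • deriv c z.2 = 0 := hab
          exact sub_eq_zero.1 this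
        have ha : a = 0 := by
          have := congrArg (fun u => det2 u (deriv c z.2)) hab'
          simp only [det2_smul_left, det2_self, mul_zero] at this
          exact (mul_eq_zero.1 this).resolve_right hdet
        have hb : b = 0 := by
          have := congrArg (fun u => det2 (deriv c z.1) u) hab'
          simp only [det2_smul_right, det2_self, mul_zero] at this
          exact (mul_eq_zero.1 this.symm).resolve_right hdet
        simp [ha, hb]
      have hinj : Function.Injective f'.toLinearMap := LinearMap.ker_eq_bot.1 hker
      have hfin : finrank ℝ (ℝ × ℝ) = finrank ℝ Plane := by simp
      let e : (ℝ × ℝ) ≃ₗ[ℝ] Plane := LinearEquiv.ofInjectiveOfFinrankEq f'.toLinearMap hinj hfin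
      let e' : (ℝ × ℝ) ≃L[ℝ] Plane := e.toContinuousLinearEquiv
      have hee : (e' : ℝ × ℝ →L[ℝ] Plane) = f' := by
        ext x <;> rfl
      rw [← hee] at hf
      refine ⟨(hf.toOpenPartialHomeomorph _).source,
        (hf.toOpenPartialHomeomorph _).open_source.mem_nhds hf.mem_toOpenPartialHomeomorph_source, ?_⟩
      intro y hy hcy
      apply (hf.toOpenPartialHomeomorph _).injOn hy hf.mem_toOpenPartialHomeomorph_source
      simp [he, hcy]
    choose! V hV hVu using key
    obtain ⟨t, htZ, htc, hcov⟩ := TopologicalSpace.countable_cover_nhdsWithin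
      (f := V) (s := Z) (fun θ hθ => mem_nhdsWithin_of_mem_nhds (hV θ hθ))
    refine htc.mono fun z hz => ?_
    obtain ⟨z₀, h₀, hm⟩ := mem_iUnion₂.1 (hcov hz)
    rwa [hVu z₀ (htZ h₀) z hm hz.2.2.2]
  refine (hZ.image (fun z => c z.1)).mono ?_
  rintro x ⟨s, hs, t, ht, hst, h1, h2⟩
  exact ⟨(s, t), ⟨hs, ht, hst, h1.trans h2.symm⟩, h1⟩

theorem contDiff_clm_prod {E P F G : Type*} [NormedAddCommGroup E] [NormedSpace ℝ E]
    [NormedAddCommGroup P] [NormedSpace ℝ P] [NormedAddCommGroup F] [NormedSpace ℝ F]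
    [NormedAddCommGroup G] [NormedSpace ℝ G] {n : WithTop ℕ∞} {f : E → (P →L[ℝ] F)}
    {g : E → (P →L[ℝ] G)} (hf : ContDiff ℝ n f) (hg : ContDiff ℝ n g) :
    ContDiff ℝ n (fun x => (f x).prod (g x)) :=
  (ContinuousLinearMap.prodₗᵢ ℝ (E := P) (F := F) (G := G) (𝕜 := ℝ)).contDiff.comp (hf.prodMk hg)

/-- General position for a linear family of perturbations `c + ev · p` that is rich enough on `Sᶜ`
and trivial on `S`. -/
theorem ae_isGeneric_of_rich {ι : Type*} [Fintype ι] {c : ℝ → Plane} {S : Set ℝ}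
    (hc : ContDiff ℝ ∞ c) (hper : Function.Periodic c 1) (hS : IsGenericOn c S)
    {ev : ℝ → ((ι → ℝ) →L[ℝ] Plane)} (hev : ContDiff ℝ ∞ ev) (hevper : Function.Periodic ev 1)
    (h0 : ∀ t ∈ S, ev t = 0) (h0' : ∀ t ∈ S, deriv ev t = 0)
    (hrich : ∀ s t : ℝ, s ∉ S → (s : UnitAddCircle) ≠ t → ∀ y z, ∃ p,
      ev s p = y ∧ deriv ev s p = z ∧ ev t p = 0 ∧ deriv ev t p = 0)
    (hrich' : ∀ r s t : ℝ, r ∉ S → s ∉ S → (r : UnitAddCircle) ≠ s → (r : UnitAddCircle) ≠ t →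
      (s : UnitAddCircle) ≠ t → ∀ y z, ∃ p, ev r p = y ∧ ev s p = z ∧ ev t p = 0) :
    ∀ᵐ p : ι → ℝ, IsGeneric (fun t => c t + ev t p) := by
  have hev1 : ContDiff ℝ 1 ev := hev.of_le (by simp)
  have hc1 : ContDiff ℝ 1 c := hc.of_le (by simp)
  have hev' : ContDiff ℝ 1 (deriv ev) := (contDiff_infty_iff_deriv.1 hev).2.of_le (by simp)
  have hc' : ContDiff ℝ 1 (deriv c) := (contDiff_infty_iff_deriv.1 hc).2.of_le (by simp)
  have hsurj : ∀ s, s ∉ S → ∀ y z, ∃ p, ev s p = y ∧ deriv ev s p = z := by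
    intro s hs y z
    -- Any second point of the circle would do here; the antipodal one is convenient.
    have hne : (s : UnitAddCircle) ≠ ((s + 1 / 2 : ℝ) : UnitAddCircle) := by
      rw [Ne, coe_circle_eq_iff]
      rintro ⟨n, hn⟩
      have : (n : ℝ) = -1 / 2 := by linarith
      have h2 : ((2 * n + 1 : ℤ) : ℝ) = 0 := by push_cast; linarith
      have h3 : 2 * n + 1 = 0 := by exact_mod_cast h2
      omega
    obtain ⟨p, h1, h2, -⟩ := hrich s _ hs hne y z
    exact ⟨p, h1, h2⟩
  -- Vanishing velocity: one parameter, two equations.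
  have imm := ae_forall_ne_of_finrank_lt (ι := ι) (E := ℝ) (Q := Plane) (by simp)
    hev' hc'.neg Sᶜ (fun s hs z => by
      obtain ⟨p, -, h⟩ := hsurj s hs 0 z
      exact ⟨p, h⟩)
  -- Tangential double points: the parameters are `s`, `t` and the ratio `l` of the parallel
  -- velocities, against four equations.
  have tan := ae_forall_ne_of_finrank_lt (ι := ι) (E := ℝ × ℝ × ℝ) (Q := Plane × Plane)
    (by simp)
    (L := fun θ => (ev θ.1 - ev θ.2.1).prod (deriv ev θ.1 - θ.2.2 • deriv ev θ.2.1))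
    (c := fun θ => (c θ.2.1 - c θ.1, θ.2.2 • deriv c θ.2.1 - deriv c θ.1))
    (by
      have a1 : ContDiff ℝ 1 (fun θ : ℝ × ℝ × ℝ => ev θ.1) := hev1.comp contDiff_fst
      have a2 : ContDiff ℝ 1 (fun θ : ℝ × ℝ × ℝ => ev θ.2.1) := hev1.comp (contDiff_fst.comp contDiff_snd)
      have a3 : ContDiff ℝ 1 (fun θ : ℝ × ℝ × ℝ => deriv ev θ.1) := hev'.comp contDiff_fst
      have a4 : ContDiff ℝ 1 (fun θ : ℝ × ℝ × ℝ => deriv ev θ.2.1) :=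
        hev'.comp (contDiff_fst.comp contDiff_snd)
      have a5 : ContDiff ℝ 1 (fun θ : ℝ × ℝ × ℝ => θ.2.2) := contDiff_snd.comp contDiff_snd
      exact contDiff_clm_prod (a1.sub a2) (a3.sub (a5.smul a4)))
    (by
      have a1 : ContDiff ℝ 1 (fun θ : ℝ × ℝ × ℝ => c θ.1) := hc1.comp contDiff_fst
      have a2 : ContDiff ℝ 1 (fun θ : ℝ × ℝ × ℝ => c θ.2.1) := hc1.comp (contDiff_fst.comp contDiff_snd)
      have a3 : ContDiff ℝ 1 (fun θ : ℝ × ℝ × ℝ => deriv c θ.1) := hc'.comp contDiff_fst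
      have a4 : ContDiff ℝ 1 (fun θ : ℝ × ℝ × ℝ => deriv c θ.2.1) :=
        hc'.comp (contDiff_fst.comp contDiff_snd)
      have a5 : ContDiff ℝ 1 (fun θ : ℝ × ℝ × ℝ => θ.2.2) := contDiff_snd.comp contDiff_snd
      exact (a2.sub a1).prodMk ((a5.smul a4).sub a3))
    {θ | θ.1 ∉ S ∧ (θ.1 : UnitAddCircle) ≠ θ.2.1}
    (by
      rintro ⟨s, t, l⟩ ⟨hs, hst⟩ ⟨y, z⟩
      obtain ⟨p, h1, h2, h3, h4⟩ := hrich s t hs hst y z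
      exact ⟨p, by simp [h1, h2, h3, h4]⟩)
  -- Triple points with at least two of the three parameters outside `S`: three parameters, four
  -- equations.
  have tri := ae_forall_ne_of_finrank_lt (ι := ι) (E := ℝ × ℝ × ℝ) (Q := Plane × Plane)
    (by simp)
    (L := fun θ => (ev θ.1 - ev θ.2.2).prod (ev θ.2.1 - ev θ.2.2))
    (c := fun θ => (c θ.2.2 - c θ.1, c θ.2.2 - c θ.2.1))
    (by
      have a1 : ContDiff ℝ 1 (fun θ : ℝ × ℝ × ℝ => ev θ.1) := hev1.comp contDiff_fst
      have a2 : ContDiff ℝ 1 (fun θ : ℝ × ℝ × ℝ => ev θ.2.1) := hev1.comp (contDiff_fst.comp contDiff_snd)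
      have a3 : ContDiff ℝ 1 (fun θ : ℝ × ℝ × ℝ => ev θ.2.2) := hev1.comp (contDiff_snd.comp contDiff_snd)
      exact contDiff_clm_prod (a1.sub a3) (a2.sub a3))
    (by
      have a1 : ContDiff ℝ 1 (fun θ : ℝ × ℝ × ℝ => c θ.1) := hc1.comp contDiff_fst
      have a2 : ContDiff ℝ 1 (fun θ : ℝ × ℝ × ℝ => c θ.2.1) := hc1.comp (contDiff_fst.comp contDiff_snd)
      have a3 : ContDiff ℝ 1 (fun θ : ℝ × ℝ × ℝ => c θ.2.2) := hc1.comp (contDiff_snd.comp contDiff_snd)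
      exact (a3.sub a1).prodMk (a3.sub a2))
    {θ | θ.1 ∉ S ∧ θ.2.1 ∉ S ∧ (θ.1 : UnitAddCircle) ≠ θ.2.1 ∧ (θ.1 : UnitAddCircle) ≠ θ.2.2 ∧
      (θ.2.1 : UnitAddCircle) ≠ θ.2.2}
    (by
      rintro ⟨r, s, t⟩ ⟨hr, hs, hrs, hrt, hst⟩ ⟨y, z⟩
      obtain ⟨p, h1, h2, h3⟩ := hrich' r s t hr hs hrs hrt hst y z
      exact ⟨p, by simp [h1, h2, h3]⟩)
  -- Triple points with only one parameter outside `S`: the other two form a double point of the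
  -- fixed part. There are countably many of these, and a moving branch misses each one almost
  -- surely.
  have stat := (ae_ball_iff (μ := (volume : Measure (ι → ℝ)))
    (p := fun p x _ => ∀ s ∈ Sᶜ, ev s p ≠ x - c s)
    (hS.countable_crossings hc1)).2 (fun x _ =>
      ae_forall_ne_of_finrank_lt (ι := ι) (E := ℝ) (Q := Plane) (by simp)
      hev1 (contDiff_const.sub hc1) Sᶜ (fun s hs y => by
        obtain ⟨p, h, -⟩ := hsurj s hs y 0
        exact ⟨p, h⟩))
  filter_upwards [imm, tan, tri, stat] with p imm tan tri stat
  have hd : ∀ t, deriv (fun t => c t + ev t p) t = deriv c t + deriv ev t p := by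
    intro t
    have e1 := ((hc1.differentiable (by simp)) t).hasDerivAt
    have e2 := ((hev1.differentiable (by simp)) t).hasDerivAt
    exact (e1.add (e2.clm_apply (hasDerivAt_const t p) |>.congr_deriv (by simp))).deriv
  have himm : ∀ t, deriv (fun t => c t + ev t p) t ≠ 0 := by
    intro t h
    rw [hd] at h
    by_cases ht : t ∈ S
    · rw [h0' t ht] at h
      exact hS.immersed t ht (by simpa using h)
    · exact imm t ht (eq_neg_of_add_eq_zero_right h)
  have htr : ∀ s t : ℝ, s ∉ S → (s : UnitAddCircle) ≠ t → c s + ev s p = c t + ev t p →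
      det2 (deriv (fun t => c t + ev t p) s) (deriv (fun t => c t + ev t p) t) ≠ 0 := by
    intro s t hs hst he h
    obtain ⟨l, hl⟩ := (det2_eq_zero_iff (himm t)).1 h
    rw [hd, hd] at hl
    refine tan (s, t, l) ⟨hs, hst⟩ (Prod.ext ?_ ?_)
    · change ev s p - ev t p = c t - c s
      rw [sub_eq_sub_iff_add_eq_add, add_comm, he]
    · change deriv ev s p - l • deriv ev t p = l • deriv c t - deriv c s
      rw [sub_eq_sub_iff_add_eq_add, add_comm, hl, smul_add]
  have hst : ∀ r s t : ℝ, r ∉ S → s ∈ S → t ∈ S → (s : UnitAddCircle) ≠ t →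
      c r + ev r p = c s + ev s p → c s + ev s p = c t + ev t p → False := by
    intro r s t hr hs ht hne h1 h2
    rw [h0 s hs, h0 t ht] at h2
    simp only [zero_apply, add_zero] at h2
    refine stat (c s) ⟨s, hs, t, ht, hne, rfl, h2.symm⟩ r hr ?_
    rw [h0 s hs] at h1
    simp only [zero_apply, add_zero] at h1
    rw [← h1]; abel
  have hmv : ∀ r s t : ℝ, r ∉ S → s ∉ S → (r : UnitAddCircle) ≠ s → (r : UnitAddCircle) ≠ t →
      (s : UnitAddCircle) ≠ t →
      c r + ev r p = c s + ev s p → c s + ev s p = c t + ev t p → False := by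
    intro r s t hr hs hrs hrt hst h1 h2
    refine tri (r, s, t) ⟨hr, hs, hrs, hrt, hst⟩ (Prod.ext ?_ ?_)
    · change ev r p - ev t p = c t - c r
      rw [sub_eq_sub_iff_add_eq_add, add_comm, h1, h2]
    · change ev s p - ev t p = c t - c s
      rw [sub_eq_sub_iff_add_eq_add, add_comm, h2]
  refine ⟨hc.add (hev.clm_apply contDiff_const), ?_, himm, ?_, ?_⟩
  · intro t
    simp only [hper t, hevper t]
  · intro s t hne he
    by_cases hs : s ∈ S
    · by_cases ht : t ∈ S
      · rw [hd, hd, h0' s hs, h0' t ht]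
        simp only [zero_apply, add_zero]
        refine hS.transverse s hs t ht hne ?_
        simpa [h0 s hs, h0 t ht] using he
      · rw [det2_swap, neg_ne_zero]
        exact htr t s ht hne.symm he.symm
    · exact htr s t hs hne he
  · intro r s t h1 h2
    by_contra! hne
    obtain ⟨hrs, hst', hrt⟩ := hne
    -- Only the number of parameters in `S` matters: three contradict `hS`, two `hst`, at most one
    -- `hmv`.
    by_cases hr : r ∈ S <;> by_cases hs : s ∈ S <;> by_cases ht : t ∈ S
    · rcases hS.no_triple r hr s hs t ht (by simpa [h0 s hs, h0 r hr] using h1)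
        (by simpa [h0 s hs, h0 t ht] using h2) with h | h | h
      exacts [hrs h, hst' h, hrt h]
    · exact hst t s r ht hs hr hrs.symm h2.symm h1.symm
    · exact hst s r t hs hr ht hrt h1.symm (h1.trans h2)
    · exact hmv s t r hs ht hst' hrs.symm hrt.symm h2 (h1.trans h2).symm
    · exact hst r s t hr hs ht hst' h1 h2
    · exact hmv r t s hr ht hrt hrs hst'.symm (h1.trans h2) h2.symm
    · exact hmv r s t hr hs hrs hrt hst' h1 h2
    · exact hmv r s t hr hs hrs hrt hst' h1 h2

/-! ### Trigonometric perturbations. -/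

/-- The trigonometric functions `1`, `cos 2πt`, `sin 2πt`. -/
noncomputable def trigBasis (i : Fin 3) (t : ℝ) : ℝ :=
  ![1, Real.cos (2 * Real.pi * t), Real.sin (2 * Real.pi * t)] i

theorem contDiff_trigBasis (i : Fin 3) : ContDiff ℝ ∞ (trigBasis i) := by
  fin_cases i
  · exact contDiff_const
  · exact Real.contDiff_cos.comp (contDiff_const.mul contDiff_id)
  · exact Real.contDiff_sin.comp (contDiff_const.mul contDiff_id)

theorem periodic_trigBasis (i : Fin 3) : Function.Periodic (trigBasis i) 1 := by
  intro t
  fin_cases i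
  · rfl
  · simp [trigBasis, mul_add]
  · simp [trigBasis, mul_add]

/-- The plane vectors whose components are trigonometric polynomials in `t` of degree at most two,
as linear functions of the coefficients. -/
noncomputable def trigCurve (t : ℝ) : (Fin 3 × Fin 3 × Fin 2 → ℝ) →L[ℝ] Plane :=
  ∑ i, ∑ j, ∑ k, (trigBasis i t * trigBasis j t) •
    (ContinuousLinearMap.proj (R := ℝ) (φ := fun _ : Fin 3 × Fin 3 × Fin 2 => ℝ)
      (i, j, k)).smulRight (EuclideanSpace.single k (1 : ℝ) : Plane)

theorem contDiff_trigCurve : ContDiff ℝ ∞ trigCurve := by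
  unfold trigCurve
  refine ContDiff.sum fun i _ => ContDiff.sum fun j _ => ContDiff.sum fun k _ => ?_
  exact ((contDiff_trigBasis i).mul (contDiff_trigBasis j)).smul contDiff_const

theorem periodic_trigCurve : Function.Periodic trigCurve 1 := by
  intro t
  simp only [trigCurve, periodic_trigBasis _ t]

/-- Trigonometric polynomials of degree at most one. -/
def IsTrig (f : ℝ → ℝ) : Prop := ∃ u : Fin 3 → ℝ, ∀ t, f t = ∑ i, u i * trigBasis i t

theorem isTrig_one : IsTrig fun _ => 1 :=
  ⟨![1, 0, 0], fun t => by simp [Fin.sum_univ_three, trigBasis]⟩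

theorem isTrig_sin (s : ℝ) : IsTrig fun t => Real.sin (2 * Real.pi * (t - s)) :=
  ⟨![0, -Real.sin (2 * Real.pi * s), Real.cos (2 * Real.pi * s)], fun t => by
    simp [Fin.sum_univ_three, trigBasis, mul_sub, Real.sin_sub]; ring⟩

/-- This factor has a double zero at `s` and no other zero on the circle, so multiplying by it kills
value and derivative at a prescribed point. -/
theorem isTrig_one_sub_cos (s : ℝ) : IsTrig fun t => 1 - Real.cos (2 * Real.pi * (t - s)) :=
  ⟨![1, -Real.cos (2 * Real.pi * s), -Real.sin (2 * Real.pi * s)], fun t => by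
    simp [Fin.sum_univ_three, trigBasis, mul_sub, Real.cos_sub]; ring⟩

/-- Degree two leaves room for two factors of degree one, enough to prescribe all the data that
general position needs. The coefficients are the products of those of `f`, `g` and `w`. -/
theorem exists_trigCurve_eq {f g : ℝ → ℝ} (hf : IsTrig f) (hg : IsTrig g) (w : Plane) :
    ∃ p, ∀ t, trigCurve t p = (f t * g t) • w := by
  obtain ⟨u, hu⟩ := hf
  obtain ⟨v, hv⟩ := hg
  refine ⟨fun x => u x.1 * v x.2.1 * w x.2.2, fun t => ?_⟩
  have hw : w = ∑ k, w k • (EuclideanSpace.single k (1 : ℝ) : Plane) := by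
    apply plane_ext <;> simp
  conv_rhs => rw [hw, hu, hv, Finset.sum_mul_sum]
  simp only [trigCurve, sum_apply, Finset.sum_smul]
  refine Finset.sum_congr rfl fun i _ => Finset.sum_congr rfl fun j _ => ?_
  rw [Finset.smul_sum]
  refine Finset.sum_congr rfl fun k _ => ?_
  simp only [smul_apply, ContinuousLinearMap.smulRight_apply,
    ContinuousLinearMap.proj_apply, smul_smul]
  congr 1
  ring

/-- Almost every perturbation, by a trigonometric polynomial cut off by `b`, of a curve that is
generic where `b` vanishes is generic. -/
theorem ae_isGeneric {c : ℝ → Plane} {b : ℝ → ℝ} (hc : ContDiff ℝ ∞ c)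
    (hper : Function.Periodic c 1) (hb : ContDiff ℝ ∞ b) (hbper : Function.Periodic b 1)
    (hb0 : ∀ t, b t = 0 → deriv b t = 0) (hS : IsGenericOn c {t | b t = 0}) :
    ∀ᵐ p, IsGeneric (fun t => c t + b t • trigCurve t p) := by
  have hq := contDiff_trigCurve
  have hbd : Differentiable ℝ b := hb.differentiable (by simp)
  have hqd : Differentiable ℝ trigCurve := hq.differentiable (by simp)
  have hder : ∀ t p, deriv (fun t => b t • trigCurve t) t p =
      deriv (fun t => b t • trigCurve t p) t := by
    intro t p
    have e1 := ((hbd t).hasDerivAt.fun_smul (hqd t).hasDerivAt).differentiableAt.hasDerivAt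
    have := (e1.clm_apply (hasDerivAt_const t p)).deriv
    simp only [map_zero, add_zero] at this
    rw [← this]
    rfl
  refine ae_isGeneric_of_rich (ev := fun t => b t • trigCurve t) hc hper hS (hb.smul hq)
    ?_ ?_ ?_ ?_ ?_
  · intro t; simp only [hbper t, periodic_trigCurve t]
  · intro t ht
    simp only [mem_ofPred_eq] at ht
    rw [ht]
    exact zero_smul ℝ (trigCurve t)
  · intro t ht
    simp only [mem_ofPred_eq] at ht
    have := ((hbd t).hasDerivAt.fun_smul (hqd t).hasDerivAt).deriv
    rw [hb0 t ht, ht] at this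
    refine this.trans ?_
    rw [zero_smul ℝ (deriv trigCurve t), zero_smul ℝ (trigCurve t), add_zero]
  · intro s t hs hst y z
    simp only [mem_ofPred_eq] at hs
    set κ : ℝ → ℝ := fun x => 1 - Real.cos (2 * Real.pi * (x - t)) with hκ
    have hκs : κ s ≠ 0 := one_sub_cos_ne_zero hst
    have hκt : κ t = 0 := by simp [hκ]
    have hκd : ∀ x, HasDerivAt κ (2 * Real.pi * Real.sin (2 * Real.pi * (x - t))) x := by
      intro x
      have h1 : HasDerivAt (fun x => 2 * Real.pi * (x - t)) (2 * Real.pi) x := by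
        simpa using ((hasDerivAt_id x).sub_const t).const_mul (2 * Real.pi)
      have := (h1.cos).const_sub 1
      refine this.congr_deriv ?_
      ring
    have hκdt : HasDerivAt κ 0 t := by simpa using hκd t
    set d := deriv (fun x => b x * κ x) s with hd
    have hbκ : HasDerivAt (fun x => b x * κ x) d s :=
      ((hbd s).mul (hκd s).differentiableAt).hasDerivAt
    have hbκt : HasDerivAt (fun x => b x * κ x) 0 t := by
      simpa [hκt] using (hbd t).hasDerivAt.fun_mul hκdt
    have hsd : HasDerivAt (fun x => Real.sin (2 * Real.pi * (x - s))) (2 * Real.pi) s := by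
      have h1 : HasDerivAt (fun x => 2 * Real.pi * (x - s)) (2 * Real.pi) s := by
        simpa using ((hasDerivAt_id s).sub_const s).const_mul (2 * Real.pi)
      simpa using h1.sin
    have hsdt : DifferentiableAt ℝ (fun x => Real.sin (2 * Real.pi * (x - s))) t := by
      fun_prop
    have hB : b s * κ s ≠ 0 := mul_ne_zero hs hκs
    have hpi : (2 * Real.pi) ≠ 0 := by positivity
    -- `p₁` produces the value `y` at `s`, with derivative d (b s κ s)⁻¹ y as a by-product. `p₂` has
    -- the extra factor sin 2π(x - s), so it leaves the value alone and corrects the derivative to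
    -- `z`. Both carry `κ` and are invisible to first order at `t`.
    obtain ⟨p₁, hp₁⟩ := exists_trigCurve_eq (isTrig_one_sub_cos t) isTrig_one
      ((b s * κ s)⁻¹ • y)
    obtain ⟨p₂, hp₂⟩ := exists_trigCurve_eq (isTrig_one_sub_cos t) (isTrig_sin s)
      ((b s * κ s * (2 * Real.pi))⁻¹ • (z - (d * (b s * κ s)⁻¹) • y))
    have f₁ : (fun x => b x • trigCurve x p₁) =
        fun x => (b x * κ x) • ((b s * κ s)⁻¹ • y) := by
      ext1 x; rw [hp₁, smul_smul, mul_one]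
    have f₂ : (fun x => b x • trigCurve x p₂) = fun x => (b x * κ x *
        Real.sin (2 * Real.pi * (x - s))) • ((b s * κ s * (2 * Real.pi))⁻¹ •
          (z - (d * (b s * κ s)⁻¹) • y)) := by
      ext1 x; rw [hp₂, smul_smul, mul_assoc (b x)]
    have d₁ : deriv (fun x => b x • trigCurve x p₁) s = (d * (b s * κ s)⁻¹) • y := by
      rw [f₁, (hbκ.smul_const _).deriv, smul_smul]
    have d₁t : deriv (fun x => b x • trigCurve x p₁) t = 0 := by
      rw [f₁, (hbκt.smul_const _).deriv, zero_smul]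
    have d₂ : deriv (fun x => b x • trigCurve x p₂) s = z - (d * (b s * κ s)⁻¹) • y := by
      rw [f₂, ((hbκ.fun_mul hsd).smul_const _).deriv]
      simp only [sub_self, mul_zero, Real.sin_zero, zero_add, smul_smul]
      rw [mul_inv_cancel₀ (mul_ne_zero hB hpi), one_smul]
    have d₂t : deriv (fun x => b x • trigCurve x p₂) t = 0 := by
      rw [f₂, ((hbκt.fun_mul hsdt.hasDerivAt).smul_const _).deriv]
      simp [hκt]
    have v₁ := congrFun f₁ s
    have v₂ := congrFun f₂ s
    have v₁t := congrFun f₁ t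
    have v₂t := congrFun f₂ t
    refine ⟨p₁ + p₂, ?_, ?_, ?_, ?_⟩
    · simp only [map_add, smul_apply]
      rw [v₁, v₂, smul_smul, mul_inv_cancel₀ hB]; simp
    · simp only [map_add]
      rw [hder, hder, d₁, d₂]; abel
    · simp only [map_add, smul_apply]
      rw [v₁t, v₂t, hκt]; simp
    · simp only [map_add]
      rw [hder, hder, d₁t, d₂t]; simp
  · intro r s t hr hs hrs hrt hst y z
    simp only [mem_ofPred_eq] at hr hs
    have k1 := one_sub_cos_ne_zero hrs
    have k2 := one_sub_cos_ne_zero hrt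
    have k3 := one_sub_cos_ne_zero hst
    have k4 := one_sub_cos_ne_zero hrs.symm
    -- Lagrange interpolation: each of the two polynomials vanishes at `t` and at one of `r`, `s`.
    obtain ⟨p₁, hp₁⟩ := exists_trigCurve_eq (isTrig_one_sub_cos t) (isTrig_one_sub_cos s)
      ((b r * ((1 - Real.cos (2 * Real.pi * (r - t))) *
        (1 - Real.cos (2 * Real.pi * (r - s)))))⁻¹ • y)
    obtain ⟨p₂, hp₂⟩ := exists_trigCurve_eq (isTrig_one_sub_cos t) (isTrig_one_sub_cos r)
      ((b s * ((1 - Real.cos (2 * Real.pi * (s - t))) *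
        (1 - Real.cos (2 * Real.pi * (s - r)))))⁻¹ • z)
    refine ⟨p₁ + p₂, ?_, ?_, ?_⟩
    · simp only [map_add, smul_apply, hp₁, hp₂]
      rw [smul_smul, smul_smul, mul_inv_cancel₀ (mul_ne_zero hr (mul_ne_zero k2 k1))]
      simp
    · simp only [map_add, smul_apply, hp₁, hp₂]
      rw [smul_smul (b s) _ (_ • z), smul_smul _ _ z,
        mul_inv_cancel₀ (mul_ne_zero hs (mul_ne_zero k3 k4))]
      simp
    · simp only [map_add, smul_apply, hp₁, hp₂]
      simp

/-! ### Arcs and components on the circle. -/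

/-- The images of (a, b) and (b, a + 1) are disjoint, open and cover the circle outside the classes
of `a` and `b`, so a connected set avoiding both classes stays on one side. -/
theorem subset_arc_of_isPreconnected {C : Set UnitAddCircle} (hC : IsPreconnected C) {a b t : ℝ}
    (ha : (a : UnitAddCircle) ∉ C) (hb : (b : UnitAddCircle) ∉ C)
    (ht : t ∈ Ioo a b) (htC : (t : UnitAddCircle) ∈ C) :
    C ⊆ ((↑) : ℝ → UnitAddCircle) '' Ioo a b := by
  have hopen : IsOpenMap ((↑) : ℝ → UnitAddCircle) := QuotientAddGroup.isOpenMap_coe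
  refine hC.subset_left_of_subset_union (hopen _ isOpen_Ioo)
    (hopen _ (isOpen_Ioo (a := b) (b := a + 1))) ?_ ?_ ⟨t, htC, t, ht, rfl⟩
  · rw [Set.disjoint_left]
    rintro _ ⟨x, hx, rfl⟩ ⟨y, hy, hxy⟩
    obtain ⟨n, hn⟩ := coe_circle_eq_iff.1 hxy
    have h1 : (0 : ℝ) < n := by linarith [hx.2, hy.1]
    have h2 : (n : ℝ) < 1 := by linarith [hx.1, hy.2]
    have h1' : (0 : ℤ) < n := by exact_mod_cast h1
    have h2' : n < (1 : ℤ) := by exact_mod_cast h2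
    omega
  · intro x hx
    obtain ⟨y, rfl⟩ := QuotientAddGroup.mk_surjective x
    change ((y : ℝ) : UnitAddCircle) ∈ C at hx
    have hz : (y : UnitAddCircle) = (toIcoMod one_pos a y : ℝ) := by
      rw [coe_circle_eq_iff]
      exact ⟨toIcoDiv one_pos a y, by have := toIcoMod_add_toIcoDiv_zsmul one_pos a y; simp at this; linarith⟩
    have hm := toIcoMod_mem_Ico one_pos a y
    change ((y : ℝ) : UnitAddCircle) ∈ _
    rw [hz] at hx ⊢
    set z := toIcoMod one_pos a y
    have hza : z ≠ a := fun h => ha (h ▸ hx)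
    have hzb : z ≠ b := fun h => hb (h ▸ hx)
    rcases lt_or_gt_of_ne hzb with h | h
    · exact Or.inl ⟨z, ⟨lt_of_le_of_ne hm.1 hza.symm, h⟩, rfl⟩
    · exact Or.inr ⟨z, ⟨h, hm.2⟩, rfl⟩

/-- Two points lie in one component of a subset of the circle iff an arc joins them in it. -/
theorem mem_connectedComponentIn_circle_iff {X : Set UnitAddCircle} {t s : ℝ}
    (ht : (t : UnitAddCircle) ∈ X) :
    (s : UnitAddCircle) ∈ connectedComponentIn X t ↔
      ∃ m : ℤ, ∀ x ∈ uIcc t (s + m), (x : UnitAddCircle) ∈ X := by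
  constructor
  · intro hs
    have hsX := connectedComponentIn_subset _ _ hs
    obtain ⟨m, hm1, hm2⟩ : ∃ m : ℤ, t ≤ s + m ∧ s + m < t + 1 := by
      refine ⟨-toIcoDiv one_pos t s, ?_⟩
      have h1 := toIcoMod_mem_Ico one_pos t s
      have h2 := toIcoMod_add_toIcoDiv_zsmul one_pos t s
      simp at h2
      push_cast
      constructor <;> linarith [h1.1, h1.2]
    have hsm : ((s + m : ℝ) : UnitAddCircle) = s := coe_circle_eq_iff.2 ⟨m, rfl⟩
    -- Two arcs join `t` to `s`, ending at the lifts `s + m` and `s + (m - 1)`. If they leave `X` at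
    -- `a` and `b`, the component of `t` is confined to (b, a), which contains no lift of `s`.
    by_contra! hcon
    obtain ⟨a, ha, haX⟩ := hcon m
    obtain ⟨b, hb, hbX⟩ := hcon (m - 1)
    rw [uIcc_of_le hm1] at ha
    have hle : s + (m - 1 : ℤ) ≤ t := by push_cast; linarith
    rw [uIcc_of_ge hle] at hb
    push_cast at hb
    have hat : a ≠ t := fun h => haX (h ▸ ht)
    have has : a ≠ s + m := fun h => haX (by rw [h, hsm]; exact hsX)
    have hbt : b ≠ t := fun h => hbX (h ▸ ht)
    have hbs : b ≠ s + (m - 1) := by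
      intro h
      apply hbX
      have : (b : UnitAddCircle) = s := coe_circle_eq_iff.2 ⟨m - 1, by push_cast; exact h⟩
      rw [this]; exact hsX
    have ha1 : t < a := lt_of_le_of_ne ha.1 hat.symm
    have ha2 : a < s + m := lt_of_le_of_ne ha.2 has
    have hb1 : s + (m - 1) < b := lt_of_le_of_ne hb.1 hbs.symm
    have hb2 : b < t := lt_of_le_of_ne hb.2 hbt
    have hsub := subset_arc_of_isPreconnected (isPreconnected_connectedComponentIn)
      (fun h => hbX (connectedComponentIn_subset X t h))
      (fun h => haX (connectedComponentIn_subset X t h)) ⟨hb2, ha1⟩ (mem_connectedComponentIn ht)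
    obtain ⟨x, hx, hxs⟩ := hsub hs
    obtain ⟨k, hk⟩ := coe_circle_eq_iff.1 hxs
    have h1 : ((m - 1 : ℤ) : ℝ) < k := by push_cast; linarith [hx.1]
    have h2 : (k : ℝ) < m := by linarith [hx.2]
    have h1' : m - 1 < k := by exact_mod_cast h1
    have h2' : k < m := by exact_mod_cast h2
    omega
  · rintro ⟨m, hm⟩
    have hsm : ((s + m : ℝ) : UnitAddCircle) = s := coe_circle_eq_iff.2 ⟨m, rfl⟩
    rw [← hsm]
    have hconn : IsPreconnected (((↑) : ℝ → UnitAddCircle) '' uIcc t (s + m)) :=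
      isPreconnected_uIcc.image _ (AddCircle.continuous_mk' _ |>.continuousOn)
    refine hconn.subset_connectedComponentIn ⟨t, left_mem_uIcc, rfl⟩ ?_ ⟨_, right_mem_uIcc, rfl⟩
    rintro _ ⟨x, hx, rfl⟩
    exact hm x hx

/-! ### Letters of branches; existence and uniqueness of the Gauss code. -/

theorem velocity_eq_of_coe_eq (γ : UnitAddCircle → Plane) {s t : ℝ}
    (h : (s : UnitAddCircle) = t) : velocity γ s = velocity γ t := by
  obtain ⟨n, rfl⟩ := coe_circle_eq_iff.1 h
  unfold velocity
  rw [← deriv_comp_add_const]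
  congr 1
  ext1 x
  congr 1
  exact coe_circle_eq_iff.2 ⟨n, rfl⟩

variable {n : ℕ}

theorem MarkedDiagram.hasJLabel_congr (D : MarkedDiagram n) {s t : ℝ}
    (h : (s : UnitAddCircle) = t) (x : Fin n × Side) : D.HasJLabel s x ↔ D.HasJLabel t x := by
  unfold HasJLabel VirtualDiagram.IsLeftBranch VirtualDiagram.IsRightBranch
  simp only [h, velocity_eq_of_coe_eq D.curve h]

theorem MarkedDiagram.exists_hasJLabel (D : MarkedDiagram n) {t : ℝ}
    (ht : D.curve t ∈ D.realCrossings) : ∃ x, D.HasJLabel t x := by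
  obtain ⟨a, b, hab, ha, hb⟩ := D.real_isCrossing _ ht
  obtain ⟨s, hst, hs⟩ : ∃ s : ℝ, (s : UnitAddCircle) ≠ t ∧ D.curve s = D.curve t := by
    obtain ⟨a, rfl⟩ := QuotientAddGroup.mk_surjective a
    obtain ⟨b, rfl⟩ := QuotientAddGroup.mk_surjective b
    by_cases h : ((a : ℝ) : UnitAddCircle) = t
    · exact ⟨b, fun h' => hab (h.trans h'.symm), hb⟩
    · exact ⟨a, h, ha⟩
  have := D.transverse t s hst.symm hs.symm
  rcases lt_or_gt_of_ne this with h | h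
  · exact ⟨(D.label ⟨_, ht⟩, Side.L), ⟨ht, rfl⟩, s, hst, hs, h⟩
  · exact ⟨(D.label ⟨_, ht⟩, Side.R), ⟨ht, rfl⟩, s, hst, hs, h⟩

theorem MarkedDiagram.HasJLabel.mem {D : MarkedDiagram n} {t : ℝ} {x : Fin n × Side}
    (h : D.HasJLabel t x) : D.curve t ∈ D.realCrossings := h.1.1

theorem MarkedDiagram.not_isLeftBranch_and_isRightBranch (D : MarkedDiagram n) {t : ℝ}
    (hl : D.IsLeftBranch t) (hr : D.IsRightBranch t) : False := by
  obtain ⟨s, hst, hs, hd⟩ := hl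
  obtain ⟨s', hst', hs', hd'⟩ := hr
  rcases D.no_triple s t s' hs hs'.symm with h | h | h
  · exact hst h
  · exact hst' h.symm
  · rw [velocity_eq_of_coe_eq _ h] at hd
    exact lt_asymm hd hd'

theorem MarkedDiagram.HasJLabel.eq {D : MarkedDiagram n} {t : ℝ} {x y : Fin n × Side}
    (hx : D.HasJLabel t x) (hy : D.HasJLabel t y) : x = y := by
  obtain ⟨⟨h, hx1⟩, hx2⟩ := hx
  obtain ⟨⟨h', hy1⟩, hy2⟩ := hy
  refine Prod.ext (hx1.symm.trans hy1) ?_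
  rcases hxs : x.2 with _ | _ <;> rcases hys : y.2 with _ | _ <;> rw [hxs] at hx2 <;>
    rw [hys] at hy2
  · exact (D.not_isLeftBranch_and_isRightBranch hx2 hy2).elim
  · exact (D.not_isLeftBranch_and_isRightBranch hy2 hx2).elim

/-- Two different branches at one crossing are each other's only partner, since there are no triple
points. As `det2` is antisymmetric, one is left and the other right. -/
theorem MarkedDiagram.HasJLabel.coe_eq {D : MarkedDiagram n} {s t : ℝ} {x : Fin n × Side}
    (hs : D.HasJLabel s x) (ht : D.HasJLabel t x) : (s : UnitAddCircle) = t := by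
  by_contra hne
  have hc : D.curve s = D.curve t := by
    have := D.label.injective (hs.1.2.trans ht.1.2.symm)
    exact congrArg Subtype.val this
  have h0 := D.transverse s t hne hc
  have hs2 := hs.2
  have ht2 := ht.2
  have key : ∀ r : ℝ, (r : UnitAddCircle) ≠ s → D.curve r = D.curve s → (r : UnitAddCircle) = t := by
    intro r hrs hr
    rcases D.no_triple r s t hr hc with h | h | h
    exacts [(hrs h).elim, (hne h).elim, h]
  have key' : ∀ r : ℝ, (r : UnitAddCircle) ≠ t → D.curve r = D.curve t → (r : UnitAddCircle) = s := by
    intro r hrs hr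
    rcases D.no_triple r t s hr hc.symm with h | h | h
    exacts [(hrs h).elim, (hne h.symm).elim, h]
  rcases hxs : x.2 with _ | _ <;> rw [hxs] at hs2 ht2
  · obtain ⟨r, h1, h2, h3⟩ := hs2
    obtain ⟨r', h1', h2', h3'⟩ := ht2
    rw [velocity_eq_of_coe_eq _ (key r h1 h2)] at h3
    rw [velocity_eq_of_coe_eq _ (key' r' h1' h2'), det2_swap] at h3'
    linarith
  · obtain ⟨r, h1, h2, h3⟩ := hs2
    obtain ⟨r', h1', h2', h3'⟩ := ht2
    rw [velocity_eq_of_coe_eq _ (key r h1 h2)] at h3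
    rw [velocity_eq_of_coe_eq _ (key' r' h1' h2'), det2_swap] at h3'
    linarith

theorem MarkedDiagram.exists_param (D : MarkedDiagram n) (x : Fin n × Side) :
    ∃ t, D.HasJLabel t x := by
  obtain ⟨j, e⟩ := x
  set p := D.label.symm j with hp
  obtain ⟨a, b, hab, ha, hb⟩ := D.real_isCrossing _ p.2
  obtain ⟨a, rfl⟩ := QuotientAddGroup.mk_surjective a
  obtain ⟨b, rfl⟩ := QuotientAddGroup.mk_surjective b
  change D.curve (a : UnitAddCircle) = _ at ha
  change D.curve (b : UnitAddCircle) = _ at hb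
  have hl : ∀ t : ℝ, D.curve (t : UnitAddCircle) = (p : Plane) →
      ∃ h : D.curve t ∈ D.realCrossings, D.label ⟨D.curve t, h⟩ = j := by
    intro t ht
    refine ⟨ht ▸ p.2, ?_⟩
    rw [← D.label.apply_symm_apply j]
    congr 1
    exact Subtype.ext ht
  have hab' := D.transverse a b hab (ha.trans hb.symm)
  have hba : det2 (velocity D.curve b) (velocity D.curve a) =
    -det2 (velocity D.curve a) (velocity D.curve b) := det2_swap _ _
  rcases lt_or_gt_of_ne hab' with h | h <;> cases e
  · exact ⟨a, hl a ha, b, Ne.symm hab, hb.trans ha.symm, h⟩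
  · exact ⟨b, hl b hb, a, hab, ha.trans hb.symm, by linarith⟩
  · exact ⟨b, hl b hb, a, hab, ha.trans hb.symm, by linarith⟩
  · exact ⟨a, hl a ha, b, Ne.symm hab, hb.trans ha.symm, h⟩

/-- The parameters of real crossings in the period that starts at `t₀`. -/
def MarkedDiagram.params (D : MarkedDiagram n) (t₀ : ℝ) : Set ℝ :=
  {t | t ∈ Ioo t₀ (t₀ + 1) ∧ D.curve t ∈ D.realCrossings}

/-- The two sides, as the two truth values. -/
def boolEquivSide : Bool ≃ Side where
  toFun b := match b with
    | true => Side.L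
    | false => Side.R
  invFun e := match e with
    | Side.L => true
    | Side.R => false
  left_inv b := by cases b <;> rfl
  right_inv e := by cases e <;> rfl

instance : Fintype Side := Fintype.ofEquiv Bool boolEquivSide

theorem card_jLabels : Fintype.card (Fin n × Side) = 2 * n := by
  rw [Fintype.card_prod, Fintype.card_fin, show Fintype.card Side = 2 from Fintype.ofEquiv_card boolEquivSide, mul_comm]

theorem coe_injOn_Ioo {t₀ s t : ℝ} (hs : s ∈ Ioo t₀ (t₀ + 1)) (ht : t ∈ Ioo t₀ (t₀ + 1))
    (h : (s : UnitAddCircle) = t) : s = t := by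
  obtain ⟨k, rfl⟩ := coe_circle_eq_iff.1 h
  have h1 : (k : ℝ) < 1 := by linarith [hs.2, ht.1]
  have h2 : (-1 : ℝ) < k := by linarith [hs.1, ht.2]
  have h1' : k < (1 : ℤ) := by exact_mod_cast h1
  have h2' : (-1 : ℤ) < k := by exact_mod_cast h2
  have : k = 0 := by omega
  simp [this]

theorem exists_lift_mem_Ioo {t₀ t : ℝ} (h : (t : UnitAddCircle) ≠ t₀) :
    ∃ s ∈ Ioo t₀ (t₀ + 1), (s : UnitAddCircle) = t := by
  have hz : (t : UnitAddCircle) = (toIcoMod one_pos t₀ t : ℝ) := by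
    rw [coe_circle_eq_iff]
    exact ⟨toIcoDiv one_pos t₀ t, by
      have := toIcoMod_add_toIcoDiv_zsmul one_pos t₀ t; simp at this; linarith⟩
  have hm := toIcoMod_mem_Ico one_pos t₀ t
  refine ⟨_, ⟨lt_of_le_of_ne hm.1 fun he => h ?_, hm.2⟩, hz.symm⟩
  rw [hz, ← he]

/-- Sending a letter to the unique parameter in the period that carries it is a bijection onto
`D.params t₀`. -/
theorem MarkedDiagram.ncard_params (D : MarkedDiagram n) {t₀ : ℝ}
    (h₀ : D.curve t₀ ∉ D.realCrossings) :
    (D.params t₀).Finite ∧ (D.params t₀).ncard = 2 * n := by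
  have key : ∀ x : Fin n × Side, ∃ t ∈ Ioo t₀ (t₀ + 1), D.HasJLabel t x := by
    intro x
    obtain ⟨t, ht⟩ := D.exists_param x
    obtain ⟨s, hs, hst⟩ := exists_lift_mem_Ioo (t₀ := t₀) (t := t) (fun h => h₀ (h ▸ ht.mem))
    exact ⟨s, hs, (D.hasJLabel_congr hst x).2 ht⟩
  choose f hf hfx using key
  have hr : D.params t₀ = range f := by
    ext t
    constructor
    · rintro ⟨ht, hr⟩
      obtain ⟨x, hx⟩ := D.exists_hasJLabel hr
      exact ⟨x, coe_injOn_Ioo (hf x) ht ((hfx x).coe_eq hx)⟩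
    · rintro ⟨x, rfl⟩
      exact ⟨hf x, (hfx x).mem⟩
  have hinj : Function.Injective f := fun x y h => (hfx x).eq (h ▸ hfx y)
  refine ⟨hr ▸ finite_range f, ?_⟩
  rw [hr, ← image_univ, ncard_image_of_injective _ hinj, ncard_univ, Nat.card_eq_fintype_card,
    card_jLabels]

theorem MarkedDiagram.base_subset (D : MarkedDiagram n) {t : UnitAddCircle} (h : t ∈ D.base) :
    D.curve t ∉ D.realCrossings := by
  obtain ⟨s, -, hA⟩ := D.base_isSemiarc
  rw [hA] at h
  exact connectedComponentIn_subset _ _ h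

theorem MarkedDiagram.base_eq (D : MarkedDiagram n) {t : UnitAddCircle} (h : t ∈ D.base) :
    D.base = connectedComponentIn {s | D.curve s ∉ D.realCrossings} t := by
  obtain ⟨s, -, hA⟩ := D.base_isSemiarc
  rw [hA] at h ⊢
  exact connectedComponentIn_eq h

theorem MarkedDiagram.mem_base_iff (D : MarkedDiagram n) {t s : ℝ} (h : (t : UnitAddCircle) ∈ D.base) :
    (s : UnitAddCircle) ∈ D.base ↔
      ∃ m : ℤ, ∀ x ∈ uIcc t (s + m), D.curve (x : ℝ) ∉ D.realCrossings := by
  rw [D.base_eq h, mem_connectedComponentIn_circle_iff (D.base_subset h)]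
  rfl

theorem MarkedDiagram.exists_mem_base (D : MarkedDiagram n) : ∃ t₀ : ℝ, (t₀ : UnitAddCircle) ∈ D.base := by
  obtain ⟨s, hs, hA⟩ := D.base_isSemiarc
  obtain ⟨t, rfl⟩ := QuotientAddGroup.mk_surjective s
  refine ⟨t, ?_⟩
  rw [hA]
  exact mem_connectedComponentIn hs

theorem MarkedDiagram.exists_hasGaussCode (D : MarkedDiagram n) : ∃ w, D.HasGaussCode w := by
  obtain ⟨t₀, h₀⟩ := D.exists_mem_base
  obtain ⟨hfin, hcard⟩ := D.ncard_params (D.base_subset h₀)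
  have hc : hfin.toFinset.card = 2 * n := by rw [← hcard, ncard_eq_toFinset_card _ hfin]
  let t := hfin.toFinset.orderEmbOfFin hc
  have ht : ∀ i, t i ∈ D.params t₀ := fun i =>
    hfin.mem_toFinset.1 (Finset.orderEmbOfFin_mem _ hc i)
  choose w hw using fun i => D.exists_hasJLabel (ht i).2
  refine ⟨⟨w, fun x => ?_⟩, t₀, h₀, t, t.strictMono, fun i => (ht i).1, hw⟩
  obtain ⟨s, hs⟩ := D.exists_param x
  obtain ⟨s', hs', hss⟩ := exists_lift_mem_Ioo (t₀ := t₀) (t := s)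
    (fun h => D.base_subset h₀ (h ▸ hs.mem))
  have hx' := (D.hasJLabel_congr hss x).2 hs
  have : s' ∈ range t := by
    rw [Finset.range_orderEmbOfFin]
    exact hfin.mem_toFinset.2 ⟨hs', hx'.mem⟩
  obtain ⟨i, rfl⟩ := this
  exact ⟨i, (hw i).eq hx'⟩

/-- Base points on one semiarc are joined, after an integer shift `m`, by an arc free of real
crossings. Both lists of times, the second shifted by `m`, are then the increasing enumeration of
the same finite set. -/
theorem MarkedDiagram.hasGaussCode_unique (D : MarkedDiagram n) {w w' : GaussCode n}
    (h : D.HasGaussCode w) (h' : D.HasGaussCode w') : w = w' := by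
  obtain ⟨t₀, h₀, t, htm, ht, hw⟩ := h
  obtain ⟨t₀', h₀', t', htm', ht', hw'⟩ := h'
  obtain ⟨m, hm⟩ := (D.mem_base_iff h₀).1 h₀'
  obtain ⟨hfin, hcard⟩ := D.ncard_params (D.base_subset h₀)
  have hc : hfin.toFinset.card = 2 * n := by rw [← hcard, ncard_eq_toFinset_card _ hfin]
  have hshift : ∀ s : ℝ, ∀ k : ℤ, ((s + k : ℝ) : UnitAddCircle) = s := fun s k =>
    coe_circle_eq_iff.2 ⟨k, rfl⟩
  have h1 : t = hfin.toFinset.orderEmbOfFin hc :=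
    Finset.orderEmbOfFin_unique hc (fun i => hfin.mem_toFinset.2 ⟨ht i, (hw i).mem⟩) htm
  have h2 : (fun i => t' i + m) = hfin.toFinset.orderEmbOfFin hc := by
    refine Finset.orderEmbOfFin_unique hc (fun i => hfin.mem_toFinset.2 ?_)
      (fun i j hij => add_lt_add_left (htm' hij) _)
    have hr : D.curve ((t' i + m : ℝ) : UnitAddCircle) ∈ D.realCrossings := by
      rw [hshift]; exact (hw' i).mem
    have hr1 : D.curve ((t' i + m - 1 : ℝ) : UnitAddCircle) ∈ D.realCrossings := by
      have := hshift (t' i) (m - 1)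
      push_cast at this
      rw [add_sub_assoc, this]; exact (hw' i).mem
    have hr2 : D.curve ((t' i + m + 1 : ℝ) : UnitAddCircle) ∈ D.realCrossings := by
      have := hshift (t' i) (m + 1)
      push_cast at this
      rw [add_assoc, this]; exact (hw' i).mem
    refine ⟨⟨?_, ?_⟩, hr⟩
    -- A shifted time outside the period of `t₀` would give a real crossing on the arc from `t₀` to
    -- `t₀' + m`, directly on this side and after subtracting 1 on the other.
    · by_contra! hle
      exact hm (t' i + m) (by rw [uIcc_of_ge (by linarith [(ht' i).1])]; exact ⟨by linarith [(ht' i).1], hle⟩) hr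
    · by_contra! hle
      exact hm (t' i + m - 1) (by
        rw [uIcc_of_le (by linarith [(ht' i).2])]
        exact ⟨by linarith, by linarith [(ht' i).2]⟩) hr1
  apply Subtype.ext
  funext i
  have h3 : t i = t' i + m := by rw [h1]; exact (congrFun h2 i).symm
  refine (hw i).eq ?_
  rw [h3, D.hasJLabel_congr (hshift _ _)]
  exact hw' i

/-! ### Invariance of the code under the moves. -/

theorem VirtualDiagram.hasDerivAt (D : VirtualDiagram) (t : ℝ) :
    HasDerivAt (fun s : ℝ => D.curve s) (velocity D.curve t) t :=
  ((D.smooth.differentiable (by simp)) t).hasDerivAt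

theorem lift_add_int {h : ℝ → ℝ} (hp : ∀ t, h (t + 1) = h t + 1) (t : ℝ) (k : ℤ) :
    h (t + k) = h t + k := by
  have hnat : ∀ (m : ℕ) (t : ℝ), h (t + m) = h t + m := by
    intro m
    induction m with
    | zero => simp
    | succ m ih => intro t; push_cast; rw [← add_assoc, hp, ih, add_assoc]
  obtain ⟨m, rfl | rfl⟩ := k.eq_nat_or_neg
  · exact_mod_cast hnat m t
  · have := hnat m (t + ((-m : ℤ) : ℝ))
    push_cast at this ⊢
    rw [neg_add_cancel_right] at this
    linarith

theorem lift_coe_eq_iff {h : ℝ → ℝ} (hm : StrictMono h) (hp : ∀ t, h (t + 1) = h t + 1) {s t : ℝ} :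
    (h s : UnitAddCircle) = h t ↔ (s : UnitAddCircle) = t := by
  rw [coe_circle_eq_iff, coe_circle_eq_iff]
  refine exists_congr fun k => ?_
  rw [← lift_add_int hp, hm.injective.eq_iff]

theorem SameDiagram.hasJLabel {D D' : MarkedDiagram n} {h : ℝ → ℝ} (hs : ContDiff ℝ ∞ h)
    (hd : ∀ t, 0 < deriv h t) (hp : ∀ t, h (t + 1) = h t + 1)
    (hc : ∀ t : ℝ, D'.curve (t : UnitAddCircle) = D.curve (h t : UnitAddCircle))
    (hr : D'.realCrossings = D.realCrossings)
    (hl : ∀ (x : Plane) (hx : x ∈ D.realCrossings) (hx' : x ∈ D'.realCrossings),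
      D'.label ⟨x, hx'⟩ = D.label ⟨x, hx⟩) {t : ℝ} {x : Fin n × Side} (ht : D'.HasJLabel t x) :
    D.HasJLabel (h t) x := by
  have hm : StrictMono h := strictMono_of_deriv_pos hd
  have hv : ∀ t, velocity D'.curve t = deriv h t • velocity D.curve (h t) := by
    intro t
    have h1 := (D.hasDerivAt (h t)).scomp t ((hs.differentiable (by simp)) t).hasDerivAt
    have h2 : (fun s : ℝ => D'.curve s) = (fun s : ℝ => D.curve s) ∘ h := funext hc
    unfold velocity
    rw [h2]
    exact h1.deriv
  obtain ⟨⟨hmem, hlab⟩, hside⟩ := ht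
  have hmem' : D.curve (h t : UnitAddCircle) ∈ D.realCrossings := by rw [← hc, ← hr]; exact hmem
  refine ⟨⟨hmem', ?_⟩, ?_⟩
  · rw [← hlab, ← hl _ hmem' (by rwa [← hc])]
    congr 1
    exact Subtype.ext (hc t).symm
  · have hpos : ∀ s, det2 (velocity D'.curve t) (velocity D'.curve s) =
        (deriv h t * deriv h s) * det2 (velocity D.curve (h t)) (velocity D.curve (h s)) := by
      intro s
      rw [hv, hv, det2_smul_left, det2_smul_right]; ring
    rcases hxs : x.2 with _ | _ <;> rw [hxs] at hside
    · obtain ⟨s, h1, h2, h3⟩ := hside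
      refine ⟨h s, fun he => h1 ((lift_coe_eq_iff hm hp).1 he), by rw [← hc, ← hc, h2], ?_⟩
      rw [hpos] at h3
      exact (pos_iff_neg_of_mul_neg h3).1 (mul_pos (hd t) (hd s))
    · obtain ⟨s, h1, h2, h3⟩ := hside
      refine ⟨h s, fun he => h1 ((lift_coe_eq_iff hm hp).1 he), by rw [← hc, ← hc, h2], ?_⟩
      rw [hpos] at h3
      exact (pos_iff_pos_of_mul_pos h3).1 (mul_pos (hd t) (hd s))

theorem SameDiagram.hasGaussCode {D D' : MarkedDiagram n} (h : SameDiagram D D')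
    {w : GaussCode n} (hw : D'.HasGaussCode w) : D.HasGaussCode w := by
  obtain ⟨h, hs, hd, hp, hc, hr, hl, hb⟩ := h
  have hm : StrictMono h := strictMono_of_deriv_pos hd
  obtain ⟨t₀, h₀, t, htm, ht, hw⟩ := hw
  refine ⟨h t₀, (hb t₀).1 h₀, h ∘ t, hm.comp htm, fun i => ⟨hm (ht i).1, ?_⟩, fun i =>
    hasJLabel hs hd hp hc hr hl (hw i)⟩
  rw [← hp]
  exact hm (ht i).2

/-- The determinant of a linear map of the plane. -/
noncomputable def detMap (A : Plane →L[ℝ] Plane) : ℝ :=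
  det2 (A (EuclideanSpace.single 0 1)) (A (EuclideanSpace.single 1 1))

theorem det2_map (A : Plane →L[ℝ] Plane) (u v : Plane) :
    det2 (A u) (A v) = detMap A * det2 u v := by
  have h : ∀ w : Plane, w = w 0 • (EuclideanSpace.single 0 1 : Plane) +
      w 1 • (EuclideanSpace.single 1 1 : Plane) := by
    intro w; apply plane_ext <;> simp
  rw [detMap]
  conv_lhs => rw [h u, h v]
  simp only [map_add, map_smul, det2, PiLp.add_apply, PiLp.smul_apply, smul_eq_mul]
  ring

theorem det2_single : det2 (EuclideanSpace.single 0 1) (EuclideanSpace.single 1 1) = 1 := by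
  simp [det2]

theorem detMap_ne_zero_of_comp {A B : Plane →L[ℝ] Plane}
    (h : B.comp A = ContinuousLinearMap.id ℝ Plane) : detMap A ≠ 0 := by
  intro h0
  have h1 := det2_map B (A (EuclideanSpace.single 0 1)) (A (EuclideanSpace.single 1 1))
  have h2 : ∀ x, B (A x) = x := fun x => DFunLike.congr_fun h x
  rw [h2, h2, det2_single, det2_map, h0] at h1
  simp at h1

/-- The end of a smooth isotopy of the plane. -/
def IsotopicToId (f : Plane → Plane) : Prop := ∃ φ, IsIsotopy φ ∧ φ 1 = f

theorem IsIsotopy.contDiff {φ : ℝ → Plane → Plane} (hφ : IsIsotopy φ) (t : ℝ) :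
    ContDiff ℝ ∞ (φ t) :=
  hφ.smooth.comp (contDiff_const.prodMk contDiff_id)

/-- The Jacobian determinant at `x` depends continuously on time, never vanishes, and is 1 at time
0. -/
theorem IsIsotopy.detMap_pos {φ : ℝ → Plane → Plane} (hφ : IsIsotopy φ) (x : Plane) :
    0 < detMap (fderiv ℝ (φ 1) x) := by
  have hcont : Continuous (fun t => detMap (fderiv ℝ (φ t) x)) := by
    have h1 : ContDiff ℝ ∞ (fun t => fderiv ℝ (φ t) x) :=
      ContDiff.fderiv (f := φ) hφ.smooth contDiff_const (by simp)
    have h2 := h1.continuous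
    unfold detMap det2
    fun_prop
  have hne : ∀ t, detMap (fderiv ℝ (φ t) x) ≠ 0 := by
    intro t
    obtain ⟨ψ, hψ, hl, -⟩ := hφ.diffeo t
    apply detMap_ne_zero_of_comp (B := fderiv ℝ ψ (φ t x))
    rw [← fderiv_comp x ((hψ.differentiable (by simp)) _)
      (((hφ.contDiff t).differentiable (by simp)) _), hl.comp_eq_id, fderiv_id]
  have h0 : detMap (fderiv ℝ (φ 0) x) = 1 := by
    have : φ 0 = id := funext hφ.zero
    rw [this, fderiv_id]
    exact det2_single
  by_contra! hle
  obtain ⟨t, -, ht⟩ := intermediate_value_Icc' (zero_le_one) hcont.continuousOn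
    (show (0 : ℝ) ∈ Icc _ _ from ⟨hle, by rw [h0]; norm_num⟩)
  exact hne t ht

theorem IsotopyMove.hasJLabel {D D' : MarkedDiagram n} {φ : ℝ → Plane → Plane} (hφ : IsIsotopy φ)
    (hc : ∀ t : UnitAddCircle, D'.curve t = φ 1 (D.curve t))
    (hr : D'.realCrossings = φ 1 '' D.realCrossings)
    (hl : ∀ (x : Plane) (hx : x ∈ D.realCrossings) (hx' : φ 1 x ∈ D'.realCrossings),
      D'.label ⟨φ 1 x, hx'⟩ = D.label ⟨x, hx⟩) {t : ℝ} {x : Fin n × Side} (ht : D.HasJLabel t x) :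
    D'.HasJLabel t x := by
  have hv : ∀ t, velocity D'.curve t = fderiv ℝ (φ 1) (D.curve t) (velocity D.curve t) := by
    intro t
    have h1 := (((hφ.contDiff 1).differentiable (by simp)) (D.curve t)).hasFDerivAt.comp_hasDerivAt
      t (D.hasDerivAt t)
    have h2 : (fun s : ℝ => D'.curve s) = φ 1 ∘ (fun s : ℝ => D.curve s) := funext fun s => hc s
    unfold velocity
    rw [h2]
    exact h1.deriv
  obtain ⟨⟨hmem, hlab⟩, hside⟩ := ht
  have hmem' : φ 1 (D.curve t) ∈ D'.realCrossings := by rw [hr]; exact mem_image_of_mem _ hmem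
  refine ⟨⟨by rwa [hc], ?_⟩, ?_⟩
  · rw [← hlab, ← hl _ hmem hmem']
    congr 1
    exact Subtype.ext (hc t)
  · have hpos : ∀ s : ℝ, D.curve s = D.curve t → det2 (velocity D'.curve t) (velocity D'.curve s) =
        detMap (fderiv ℝ (φ 1) (D.curve t)) * det2 (velocity D.curve t) (velocity D.curve s) := by
      intro s hs
      rw [hv, hv, hs, det2_map]
    have hdet := hφ.detMap_pos (D.curve t)
    rcases hxs : x.2 with _ | _ <;> rw [hxs] at hside
    · obtain ⟨s, h1, h2, h3⟩ := hside
      refine ⟨s, h1, by rw [hc, hc, h2], ?_⟩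
      rw [hpos s h2]
      exact mul_neg_of_pos_of_neg hdet h3
    · obtain ⟨s, h1, h2, h3⟩ := hside
      refine ⟨s, h1, by rw [hc, hc, h2], ?_⟩
      rw [hpos s h2]
      exact mul_pos hdet h3

theorem IsotopyMove.hasGaussCode {D D' : MarkedDiagram n} (h : IsotopyMove D D')
    {w : GaussCode n} (hw : D.HasGaussCode w) : D'.HasGaussCode w := by
  obtain ⟨φ, hφ, hc, hr, hl, hb⟩ := h
  obtain ⟨t₀, h₀, t, htm, ht, hw⟩ := hw
  exact ⟨t₀, hb ▸ h₀, t, htm, ht, fun i => hasJLabel hφ hc hr hl (hw i)⟩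

theorem VirtualDiagram.IsSemiarc.subset {D : VirtualDiagram} {A : Set UnitAddCircle}
    (hA : D.IsSemiarc A) {t : UnitAddCircle} (ht : t ∈ A) : D.curve t ∉ D.realCrossings := by
  obtain ⟨s, -, rfl⟩ := hA
  exact connectedComponentIn_subset _ _ ht

/-- Parameters of real crossings lie outside the closed set `K`, so the two curves have the same
germs there, in particular the same velocities. -/
theorem DetourMove.hasJLabel {D D' : MarkedDiagram n} {A K : Set UnitAddCircle}
    (hA : D.IsSemiarc A) (hK : IsCompact K) (hKA : K ⊆ A)
    (hc : ∀ t, t ∉ K → D'.curve t = D.curve t) (hr : D'.realCrossings = D.realCrossings)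
    (hl : ∀ (x : Plane) (hx : x ∈ D.realCrossings) (hx' : x ∈ D'.realCrossings),
      D'.label ⟨x, hx'⟩ = D.label ⟨x, hx⟩) {t : ℝ} {x : Fin n × Side} (ht : D.HasJLabel t x) :
    D'.HasJLabel t x := by
  have hcr : ∀ t : ℝ, D.curve t ∈ D.realCrossings →
      D'.curve t = D.curve t ∧ velocity D'.curve t = velocity D.curve t := by
    intro t ht
    have htK : (t : UnitAddCircle) ∉ K := fun h => hA.subset (hKA h) ht
    refine ⟨hc _ htK, Filter.EventuallyEq.deriv_eq ?_⟩
    have : ∀ᶠ s : ℝ in 𝓝 t, (s : UnitAddCircle) ∈ Kᶜ :=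
      (AddCircle.continuous_mk' (1 : ℝ)).continuousAt.eventually (hK.isClosed.isOpen_compl.mem_nhds htK)
    filter_upwards [this] with s hs
    exact hc _ hs
  obtain ⟨⟨hmem, hlab⟩, hside⟩ := ht
  obtain ⟨e1, e2⟩ := hcr t hmem
  refine ⟨⟨by rwa [e1, hr], ?_⟩, ?_⟩
  · rw [← hlab, ← hl _ hmem (by rwa [hr])]
    congr 1
    exact Subtype.ext e1
  · rcases hxs : x.2 with _ | _ <;> rw [hxs] at hside
    · obtain ⟨s, h1, h2, h3⟩ := hside
      obtain ⟨e3, e4⟩ := hcr s (by rwa [h2])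
      exact ⟨s, h1, by rw [e1, e3, h2], by rwa [e2, e4]⟩
    · obtain ⟨s, h1, h2, h3⟩ := hside
      obtain ⟨e3, e4⟩ := hcr s (by rwa [h2])
      exact ⟨s, h1, by rw [e1, e3, h2], by rwa [e2, e4]⟩

theorem DetourMove.hasGaussCode {D D' : MarkedDiagram n} (h : DetourMove D D')
    {w : GaussCode n} (hw : D.HasGaussCode w) : D'.HasGaussCode w := by
  obtain ⟨A, hA, -, ⟨K, hK, hKA, hc⟩, hr, hl, hb⟩ := h
  obtain ⟨t₀, h₀, t, htm, ht, hw⟩ := hw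
  exact ⟨t₀, hb ▸ h₀, t, htm, ht, fun i => hasJLabel hA hK hKA hc hr hl (hw i)⟩

theorem hasGaussCode_iff_of_equiv {D D' : MarkedDiagram n} (h : (strictSetoid n).r D D')
    (w : GaussCode n) : D.HasGaussCode w ↔ D'.HasGaussCode w := by
  -- By uniqueness one common code suffices, so each move needs to be checked in one direction only.
  have step : ∀ {D D' : MarkedDiagram n}, (∃ w, D.HasGaussCode w ∧ D'.HasGaussCode w) →
      ∀ w, D.HasGaussCode w ↔ D'.HasGaussCode w := by
    rintro D D' ⟨v, h1, h2⟩ w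
    constructor
    · intro h; rwa [D.hasGaussCode_unique h h1]
    · intro h; rwa [D'.hasGaussCode_unique h h2]
  induction h with
  | rel D D' h =>
    apply step
    rcases h with h | h | h
    · obtain ⟨w, hw⟩ := D'.exists_hasGaussCode
      exact ⟨w, h.hasGaussCode hw, hw⟩
    · obtain ⟨w, hw⟩ := D.exists_hasGaussCode
      exact ⟨w, hw, h.hasGaussCode hw⟩
    · obtain ⟨w, hw⟩ := D.exists_hasGaussCode
      exact ⟨w, hw, h.hasGaussCode hw⟩
  | refl => rfl
  | symm _ _ _ ih => exact ih.symm
  | trans _ _ _ _ _ ih1 ih2 => exact ih1.trans ih2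

/-! ### Construction of isotopies of the plane. -/

theorem IsotopicToId.comp {f g : Plane → Plane} (hf : IsotopicToId f) (hg : IsotopicToId g) :
    IsotopicToId (f ∘ g) := by
  obtain ⟨φ, hφ, rfl⟩ := hf
  obtain ⟨ψ, hψ, rfl⟩ := hg
  refine ⟨fun t x => φ t (ψ t x), ⟨?_, ?_, ?_⟩, rfl⟩
  · exact hφ.smooth.comp (contDiff_fst.prodMk hψ.smooth)
  · intro t
    obtain ⟨f', h1, h2, h3⟩ := hφ.diffeo t
    obtain ⟨g', k1, k2, k3⟩ := hψ.diffeo t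
    exact ⟨g' ∘ f', k1.comp h1, h2.comp k2, h3.comp k3⟩
  · intro x
    rw [hψ.zero, hφ.zero]

/-- A contraction added to the identity gives a homeomorphism; its derivative 1 + Du is invertible
by the Neumann series, so the inverse is smooth. -/
theorem exists_inverse_id_add {u : Plane → Plane} (hu : ContDiff ℝ ∞ u) {K : ℝ≥0}
    (hK : LipschitzWith K u) (hK1 : K < 1) :
    ∃ ψ : Plane → Plane, ContDiff ℝ ∞ ψ ∧ Function.LeftInverse ψ (fun x => x + u x) ∧
      Function.RightInverse ψ (fun x => x + u x) := by
  set f : Plane → Plane := fun x => x + u x with hf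
  have happ : ApproximatesLinearOn f
      ((ContinuousLinearEquiv.refl ℝ Plane : Plane ≃L[ℝ] Plane) : Plane →L[ℝ] Plane) univ K := by
    rw [ApproximatesLinearOn.approximatesLinearOn_iff_lipschitzOnWith, lipschitzOnWith_univ]
    have : (f - ⇑((ContinuousLinearEquiv.refl ℝ Plane : Plane ≃L[ℝ] Plane) : Plane →L[ℝ] Plane)) = u := by
      ext1 x; simp [hf]
    rw [this]; exact hK
  have hK2 : Subsingleton Plane ∨
      K < ‖((ContinuousLinearEquiv.refl ℝ Plane).symm : Plane →L[ℝ] Plane)‖₊⁻¹ := by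
    right
    have : ‖((ContinuousLinearEquiv.refl ℝ Plane).symm : Plane →L[ℝ] Plane)‖₊ = 1 := by
      ext; exact ContinuousLinearMap.norm_id
    rw [this, inv_one]; exact hK1
  let H := happ.toHomeomorph f hK2
  have hH : ∀ x, H x = f x := fun _ => rfl
  have hfs : ContDiff ℝ ∞ f := contDiff_id.add hu
  have hder : ∀ x, ∃ A : Plane ≃L[ℝ] Plane, HasFDerivAt f (A : Plane →L[ℝ] Plane) x := by
    intro x
    have hn : ‖-fderiv ℝ u x‖ < 1 := by
      rw [norm_neg]
      exact (norm_fderiv_le_of_lipschitz ℝ hK).trans_lt (by exact_mod_cast hK1)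
    refine ⟨ContinuousLinearEquiv.unitsEquiv ℝ Plane (Units.oneSub _ hn), ?_⟩
    have h1 := (hasFDerivAt_id (𝕜 := ℝ) x).add ((hu.differentiable (by simp)) x).hasFDerivAt
    refine h1.congr_fderiv ?_
    ext1 y
    simp [Units.val_oneSub]
  choose A hA using hder
  refine ⟨H.symm, H.contDiff_symm (f₀' := A) hA hfs, fun x => H.symm_apply_apply x,
    fun x => H.apply_symm_apply x⟩

theorem isotopicToId_id_add {u : Plane → Plane} (hu : ContDiff ℝ ∞ u) {K : ℝ≥0}
    (hK : LipschitzWith K u) (hK1 : K < 1) : IsotopicToId (fun x => x + u x) := by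
  -- Time runs over the whole line, so the factor must stay in [0, 1] for every `t`; `t • u x` would
  -- leave the range where the stages are diffeomorphisms.
  refine ⟨fun t x => x + Real.smoothTransition t • u x, ⟨?_, ?_, ?_⟩, ?_⟩
  · exact contDiff_snd.add
      ((Real.smoothTransition.contDiff.comp contDiff_fst).smul (hu.comp contDiff_snd))
  · intro t
    refine exists_inverse_id_add (contDiff_const.fun_smul hu) (K := K) ?_ hK1
    refine LipschitzWith.of_dist_le_mul fun x y => ?_
    rw [dist_smul₀]
    have h1 : ‖Real.smoothTransition t‖ ≤ 1 := by
      rw [Real.norm_of_nonneg (Real.smoothTransition.nonneg t)]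
      exact Real.smoothTransition.le_one t
    calc _ ≤ 1 * dist (u x) (u y) := by gcongr
      _ ≤ _ := by rw [one_mul]; exact hK.dist_le_mul x y
  · intro x; simp
  · ext1 x; simp

theorem isotopicToId_add_const (a : Plane) : IsotopicToId (fun x => x + a) :=
  isotopicToId_id_add (u := fun _ => a) contDiff_const (LipschitzWith.const a) one_pos

theorem IsotopicToId.contDiff {f : Plane → Plane} (hf : IsotopicToId f) : ContDiff ℝ ∞ f := by
  obtain ⟨φ, hφ, rfl⟩ := hf
  exact hφ.contDiff 1

/-- For fixed `v` the admissible `w` form a half-plane, which contains the quarter turn `J v`. Thus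
every frame is joined to the section v ↦ (v, J v) over the connected punctured plane. -/
theorem isPreconnected_positive_frames :
    IsPreconnected {x : Plane × Plane | 0 < det2 x.1 x.2} := by
  let J : Plane → Plane := fun v => !₂[-v 1, v 0]
  have hJ : Continuous J := by
    refine (PiLp.continuous_toLp 2 _).comp ?_
    refine continuous_pi fun i => ?_
    fin_cases i <;> simp <;> fun_prop
  have hdet : ∀ v : Plane, v ≠ 0 → 0 < det2 v (J v) := by
    intro v hv
    simp only [det2, J]
    have : v 0 ≠ 0 ∨ v 1 ≠ 0 := by
      by_contra! h
      exact hv (plane_ext h.1 h.2)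
    simp
    rcases this with h | h <;> nlinarith [sq_nonneg (v 0), sq_nonneg (v 1), sq_pos_of_ne_zero h]
  have hrank : 1 < Module.rank ℝ Plane := by
    rw [← Module.finrank_eq_rank]; simp
  have hT : IsPreconnected ((fun v : Plane => (v, J v)) '' {0}ᶜ) :=
    (isPathConnected_compl_singleton_of_one_lt_rank hrank 0).isConnected.isPreconnected.image _
      (continuous_id.prodMk hJ).continuousOn
  have hone : (EuclideanSpace.single 0 1 : Plane) ≠ 0 := by
    intro h
    have := congrArg (fun v : Plane => v 0) h
    simp at this
  refine isPreconnected_of_forall (EuclideanSpace.single 0 1, J (EuclideanSpace.single 0 1)) ?_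
  rintro ⟨v, w⟩ hvw
  have hv : v ≠ 0 := by
    rintro rfl
    simp [det2] at hvw
  have hfib : IsPreconnected ((fun w : Plane => (v, w)) '' {w | 0 < det2 v w}) := by
    refine IsPreconnected.image (Convex.isPreconnected ?_) _ (by fun_prop)
    intro a ha b hb s t hs ht hst
    simp only [mem_ofPred_eq] at *
    have : det2 v (s • a + t • b) = s * det2 v a + t * det2 v b := by
      simp [det2]; ring
    rw [this]
    rcases hs.eq_or_lt with h | h
    · have : t = 1 := by linarith
      rw [← h, this]; simpa using hb
    · exact add_pos_of_pos_of_nonneg (mul_pos h ha) (mul_nonneg ht hb.le)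
  refine ⟨(fun v : Plane => (v, J v)) '' {0}ᶜ ∪ (fun w : Plane => (v, w)) '' {w | 0 < det2 v w},
    ?_, Or.inl ⟨_, hone, rfl⟩, Or.inr ⟨w, hvw, rfl⟩, hT.union (v, J v) ⟨v, hv, rfl⟩ ⟨_, hdet v hv, rfl⟩ hfib⟩
  rintro _ (⟨u, hu, rfl⟩ | ⟨u, hu, rfl⟩)
  · exact hdet u hu
  · exact hu

/-- The isotopic-to-the-identity map `f` is the identity near `F` and moves the point `α.1` with
the frame `α.2` to the point `β.1` with the frame `β.2`. -/
structure MovesFrame (F : Set Plane) (f : Plane → Plane) (α β : Plane × Plane × Plane) : Prop where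
  isotopic : IsotopicToId f
  fix : ∀ z ∈ F, ∀ᶠ y in 𝓝 z, f y = y
  point : f α.1 = β.1
  fst : fderiv ℝ f α.1 α.2.1 = β.2.1
  snd : fderiv ℝ f α.1 α.2.2 = β.2.2

theorem MovesFrame.comp {F : Set Plane} {f g : Plane → Plane} {α β γ : Plane × Plane × Plane}
    (hf : MovesFrame F f α β) (hg : MovesFrame F g β γ) : MovesFrame F (g ∘ f) α γ := by
  have hd : fderiv ℝ (g ∘ f) α.1 = (fderiv ℝ g β.1).comp (fderiv ℝ f α.1) := by
    rw [fderiv_comp _ (hg.isotopic.contDiff.differentiable (by simp) _)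
      (hf.isotopic.contDiff.differentiable (by simp) _), hf.point]
  refine ⟨hg.isotopic.comp hf.isotopic, fun z hz => ?_, ?_, ?_, ?_⟩
  · filter_upwards [hf.fix z hz, hg.fix z hz] with y h1 h2
    simp [h1, h2]
  · simp [hf.point, hg.point]
  · rw [hd]; simp [hf.fst, hg.fst]
  · rw [hd]; simp [hf.snd, hg.snd]

/-- Two framed points close to `a` differ by an affine map close to the identity. Cutting off its
displacement away from `F` leaves a displacement with small Lipschitz constant. -/
theorem eventually_movesFrame {F : Set Plane} (hF : IsClosed F) {a : Plane × Plane × Plane}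
    (ha : a.1 ∉ F) (hdet : 0 < det2 a.2.1 a.2.2) :
    ∀ᶠ z : (Plane × Plane × Plane) × (Plane × Plane × Plane) in 𝓝 (a, a),
      ∃ f, MovesFrame F f z.1 z.2 := by
  obtain ⟨r, r0, hr⟩ : ∃ r > 0, Metric.closedBall a.1 r ⊆ Fᶜ :=
    Metric.nhds_basis_closedBall.mem_iff.1 (hF.isOpen_compl.mem_nhds ha)
  let χ : ContDiffBump a.1 := ⟨r / 2, r, by positivity, by linarith⟩
  have hχs : ContDiff ℝ ∞ χ := χ.contDiff
  have hco : ∀ i : Fin 2, ContDiff ℝ ∞ (fun y : Plane => y i) := fun i => by fun_prop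
  obtain ⟨C₀, hC₀⟩ := hχs.lipschitzWith_of_hasCompactSupport χ.hasCompactSupport (by simp)
  obtain ⟨C₁, hC₁⟩ := (hχs.mul (hco 0)).lipschitzWith_of_hasCompactSupport
    (χ.hasCompactSupport.mul_right) (by simp)
  obtain ⟨C₂, hC₂⟩ := (hχs.mul (hco 1)).lipschitzWith_of_hasCompactSupport
    (χ.hasCompactSupport.mul_right) (by simp)
  let d : (Plane × Plane × Plane) × (Plane × Plane × Plane) → ℝ := fun z => det2 z.1.2.1 z.1.2.2
  -- `a₁` and `a₂` are the columns, found by Cramer's rule, of the linear map taking the vectors of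
  -- the source frame to the differences of the frames. `a₀` adjusts the constant term so that the
  -- base point moves correctly.
  let a₁ : (Plane × Plane × Plane) × (Plane × Plane × Plane) → Plane := fun z =>
    (z.1.2.2 1 / d z) • (z.2.2.1 - z.1.2.1) + (-z.1.2.1 1 / d z) • (z.2.2.2 - z.1.2.2)
  let a₂ : (Plane × Plane × Plane) × (Plane × Plane × Plane) → Plane := fun z =>
    (-z.1.2.2 0 / d z) • (z.2.2.1 - z.1.2.1) + (z.1.2.1 0 / d z) • (z.2.2.2 - z.1.2.2)
  let a₀ : (Plane × Plane × Plane) × (Plane × Plane × Plane) → Plane := fun z =>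
    (z.2.1 - z.1.1) - z.1.1 0 • a₁ z - z.1.1 1 • a₂ z
  have hd : Continuous d := by unfold d det2; fun_prop
  have hd0 : d (a, a) ≠ 0 := hdet.ne'
  have ha₁ : ContinuousAt a₁ (a, a) := by
    refine ContinuousAt.add (ContinuousAt.smul (ContinuousAt.div ?_ hd.continuousAt hd0) ?_)
      (ContinuousAt.smul (ContinuousAt.div ?_ hd.continuousAt hd0) ?_) <;> fun_prop
  have ha₂ : ContinuousAt a₂ (a, a) := by
    refine ContinuousAt.add (ContinuousAt.smul (ContinuousAt.div ?_ hd.continuousAt hd0) ?_)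
      (ContinuousAt.smul (ContinuousAt.div ?_ hd.continuousAt hd0) ?_) <;> fun_prop
  have ha₀ : ContinuousAt a₀ (a, a) := by
    refine ContinuousAt.sub (ContinuousAt.sub ?_ (ContinuousAt.fun_smul ?_ ha₁))
      (ContinuousAt.fun_smul ?_ ha₂) <;> fun_prop
  let κ := fun z => C₀ * ‖a₀ z‖₊ + C₁ * ‖a₁ z‖₊ + C₂ * ‖a₂ z‖₊
  have hκ : ContinuousAt κ (a, a) := by
    have h0 := ha₀.nnnorm
    have h1 := ha₁.nnnorm
    have h2 := ha₂.nnnorm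
    exact ((continuousAt_const.mul h0).add (continuousAt_const.mul h1)).add
      (continuousAt_const.mul h2)
  have hκ0 : κ (a, a) < 1 := by simp [κ, a₀, a₁, a₂]
  have hball : ∀ᶠ z : (Plane × Plane × Plane) × (Plane × Plane × Plane) in 𝓝 (a, a),
      z.1.1 ∈ Metric.ball a.1 (r / 2) := by
    have : ContinuousAt (fun z : (Plane × Plane × Plane) × (Plane × Plane × Plane) => z.1.1) (a, a) := by
      fun_prop
    exact this.eventually (Metric.isOpen_ball.mem_nhds (Metric.mem_ball_self (by positivity)))
  filter_upwards [hκ.eventually (gt_mem_nhds hκ0), hd.continuousAt.eventually_ne hd0, hball]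
    with z hz1 hz2 hz3
  let u : Plane → Plane := fun y => χ y • a₀ z + (χ y * y 0) • a₁ z + (χ y * y 1) • a₂ z
  have hu : ContDiff ℝ ∞ u :=
    ((hχs.smul contDiff_const).add ((hχs.mul (hco 0)).smul contDiff_const)).add
      ((hχs.mul (hco 1)).smul contDiff_const)
  have hsm : ∀ {g : Plane → ℝ} {C : ℝ≥0} (b : Plane), LipschitzWith C g →
      LipschitzWith (C * ‖b‖₊) (fun y => g y • b) := by
    intro g C b hg
    refine LipschitzWith.of_dist_le_mul fun x y => ?_
    rw [dist_eq_norm, ← sub_smul, norm_smul]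
    have := hg.dist_le_mul x y
    rw [dist_eq_norm] at this
    calc ‖g x - g y‖ * ‖b‖ ≤ (C * dist x y) * ‖b‖ := by gcongr
      _ = _ := by push_cast; ring
  have hL : LipschitzWith (κ z) u := ((hsm (a₀ z) hC₀).add (hsm (a₁ z) hC₁)).add (hsm (a₂ z) hC₂)
  let f : Plane → Plane := fun y => y + u y
  let g : Plane → Plane := fun y => y + (a₀ z + y 0 • a₁ z + y 1 • a₂ z)
  have hfg : ∀ᶠ y in 𝓝 z.1.1, f y = g y := by
    filter_upwards [Metric.isOpen_ball.mem_nhds hz3] with y hy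
    have : χ y = 1 := χ.one_of_mem_closedBall (Metric.ball_subset_closedBall hy)
    simp [f, g, u, this]
  have hpt : ∀ y : Plane, det2 z.1.2.1 z.1.2.2 • (y 0 • a₁ z + y 1 • a₂ z) =
      det2 y z.1.2.2 • (z.2.2.1 - z.1.2.1) + det2 z.1.2.1 y • (z.2.2.2 - z.1.2.2) := by
    intro y
    change d z • _ = _
    simp only [a₁, a₂, smul_add, smul_smul]
    have e1 : d z * (y 0 * (z.1.2.2 1 / d z)) = y 0 * z.1.2.2 1 := by field_simp
    have e2 : d z * (y 0 * (-z.1.2.1 1 / d z)) = - (y 0 * z.1.2.1 1) := by field_simp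
    have e3 : d z * (y 1 * (-z.1.2.2 0 / d z)) = - (y 1 * z.1.2.2 0) := by field_simp
    have e4 : d z * (y 1 * (z.1.2.1 0 / d z)) = y 1 * z.1.2.1 0 := by field_simp
    rw [e1, e2, e3, e4]
    simp only [det2]
    module
  have hpt1 : z.1.2.1 0 • a₁ z + z.1.2.1 1 • a₂ z = z.2.2.1 - z.1.2.1 := by
    have := hpt z.1.2.1
    rw [det2_self, zero_smul, add_zero] at this
    exact smul_right_injective _ hz2 this
  have hpt2 : z.1.2.2 0 • a₁ z + z.1.2.2 1 • a₂ z = z.2.2.2 - z.1.2.2 := by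
    have := hpt z.1.2.2
    rw [det2_self, zero_smul, zero_add] at this
    exact smul_right_injective _ hz2 this
  have hgd : ∀ v, fderiv ℝ g z.1.1 v = v + (v 0 • a₁ z + v 1 • a₂ z) := by
    intro v
    let pr : Fin 2 → (Plane →L[ℝ] ℝ) := fun i => EuclideanSpace.proj i
    have h1 : HasFDerivAt g (ContinuousLinearMap.id ℝ Plane +
        (((pr 0).smulRight (a₁ z)) + (pr 1).smulRight (a₂ z))) z.1.1 := by
      refine (hasFDerivAt_id _).add ?_
      have e0 := ((pr 0).smulRight (a₁ z)).hasFDerivAt (x := z.1.1)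
      have e1 := ((pr 1).smulRight (a₂ z)).hasFDerivAt (x := z.1.1)
      exact (e0.const_add (a₀ z)).add e1
    rw [h1.fderiv]
    rfl
  have hfd : fderiv ℝ f z.1.1 = fderiv ℝ g z.1.1 := Filter.EventuallyEq.fderiv_eq hfg
  refine ⟨f, isotopicToId_id_add hu hL hz1, fun y hy => ?_, ?_, ?_, ?_⟩
  · have : ∀ᶠ x in 𝓝 y, x ∈ (Metric.closedBall a.1 r)ᶜ :=
      Metric.isClosed_closedBall.isOpen_compl.mem_nhds fun h => hr h hy
    filter_upwards [this] with x hx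
    have : χ x = 0 := χ.zero_of_le_dist (by
      rw [mem_compl_iff, Metric.mem_closedBall, not_le] at hx
      exact hx.le)
    simp [f, u, this]
  · rw [hfg.self_of_nhds]
    simp only [g, a₀]
    abel
  · rw [hfd, hgd, hpt1]; abel
  · rw [hfd, hgd, hpt2]; abel

/-- Movability is transitive and holds between nearby framed points, and the space of positive
frames at points outside a finite set is connected. -/
theorem exists_movesFrame {F : Set Plane} (hF : F.Finite) {α β : Plane × Plane × Plane}
    (hα : α.1 ∉ F) (hβ : β.1 ∉ F) (hα' : 0 < det2 α.2.1 α.2.2) (hβ' : 0 < det2 β.2.1 β.2.2) :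
    ∃ f, MovesFrame F f α β := by
  have hrank : 1 < Module.rank ℝ Plane := by
    rw [← Module.finrank_eq_rank]; simp
  have hS : IsPreconnected (Fᶜ ×ˢ {x : Plane × Plane | 0 < det2 x.1 x.2}) :=
    (hF.countable.isPathConnected_compl_of_one_lt_rank hrank).isConnected.isPreconnected.prod
      isPreconnected_positive_frames
  refine hS.induction₂' (fun α β => ∃ f, MovesFrame F f α β) ?_ ?_ ⟨hα, hα'⟩ ⟨hβ, hβ'⟩
  · rintro a ⟨h1, h2⟩
    have h := eventually_movesFrame hF.isClosed h1 h2
    have e1 : Tendsto (fun y : Plane × Plane × Plane => (a, y)) (𝓝 a) (𝓝 (a, a)) :=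
      (by fun_prop : Continuous fun y : Plane × Plane × Plane => (a, y)).tendsto a
    have e2 : Tendsto (fun y : Plane × Plane × Plane => (y, a)) (𝓝 a) (𝓝 (a, a)) :=
      (by fun_prop : Continuous fun y : Plane × Plane × Plane => (y, a)).tendsto a
    exact ((e1.eventually h).and (e2.eventually h)).filter_mono nhdsWithin_le_nhds
  · rintro a b c - - - ⟨f, hf⟩ ⟨g, hg⟩
    exact ⟨_, hf.comp hg⟩

/-- Finitely many frames at distinct points can be moved by one isotopy to any positive frames at
other distinct points. -/
theorem exists_movesFrames {ι : Type*} [Finite ι] {α β : ι → Plane × Plane × Plane}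
    (hα : Function.Injective fun i => (α i).1) (hβ : Function.Injective fun i => (β i).1)
    (hαβ : ∀ i j, (α i).1 ≠ (β j).1) (hα' : ∀ i, 0 < det2 (α i).2.1 (α i).2.2)
    (hβ' : ∀ i, 0 < det2 (β i).2.1 (β i).2.2) :
    ∃ f, ∀ i, MovesFrame ∅ f (α i) (β i) := by
  classical
  have := Fintype.ofFinite ι
  have key : ∀ s : Finset ι, ∃ f, IsotopicToId f ∧ (∀ i ∈ s, MovesFrame ∅ f (α i) (β i)) ∧
      ∀ i, i ∉ s → ∀ᶠ y in 𝓝 (α i).1, f y = y := by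
    intro s
    induction s using Finset.induction_on with
    | empty =>
      refine ⟨fun x => x + 0, isotopicToId_add_const 0, by simp, fun i _ => by simp⟩
    | insert k s hk ih =>
      obtain ⟨f, hf, hs, hfix⟩ := ih
      -- The next move must disturb neither the frames already at their targets nor those still
      -- waiting at their sources.
      let F : Set Plane := (fun i => (α i).1) '' {i | i ≠ k} ∪ (fun i => (β i).1) '' {i | i ≠ k}
      have hF : F.Finite := ((toFinite _).image _).union ((toFinite _).image _)
      obtain ⟨g, hg⟩ := exists_movesFrame (F := F) hF (α := α k) (β := β k)
        (by
          rintro (⟨i, hi, h⟩ | ⟨i, hi, h⟩)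
          · exact hi (hα h)
          · exact hαβ k i h.symm)
        (by
          rintro (⟨i, hi, h⟩ | ⟨i, hi, h⟩)
          · exact hαβ i k h
          · exact hi (hβ h)) (hα' k) (hβ' k)
      have weaken : ∀ {f G a b}, MovesFrame G f a b → MovesFrame ∅ f a b := fun h =>
        ⟨h.isotopic, by simp, h.point, h.fst, h.snd⟩
      have stay : ∀ {f : Plane → Plane} {a : Plane × Plane × Plane}, IsotopicToId f →
          (∀ᶠ y in 𝓝 a.1, f y = y) → MovesFrame ∅ f a a := by
        intro f a hf h
        have : fderiv ℝ f a.1 = ContinuousLinearMap.id ℝ Plane := by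
          have h' : f =ᶠ[𝓝 a.1] id := h
          rw [h'.fderiv_eq, fderiv_id]
        exact ⟨hf, by simp, h.self_of_nhds, by simp [this], by simp [this]⟩
      refine ⟨g ∘ f, hg.isotopic.comp hf, ?_, ?_⟩
      · intro i hi
        rcases Finset.mem_insert.1 hi with rfl | hi
        · exact (stay hf (hfix i hk)).comp (weaken hg)
        · have hik : i ≠ k := fun h => hk (h ▸ hi)
          exact (hs i hi).comp (stay hg.isotopic (hg.fix _ (Or.inr ⟨i, hik, rfl⟩)))
      · intro i hi
        rw [Finset.mem_insert, not_or] at hi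
        filter_upwards [hfix i hi.2, hg.fix _ (Or.inl ⟨i, hi.1, rfl⟩)] with y h1 h2
        simp [h1, h2]
  obtain ⟨f, -, hf, -⟩ := key Finset.univ
  exact ⟨f, fun i => hf i (Finset.mem_univ i)⟩

/-- A map that vanishes to second order at `q` agrees near `q` with maps with small support and
small Lipschitz constants. -/
theorem exists_small_germ {h : Plane → Plane} (hs : ContDiff ℝ ∞ h) {q : Plane} (h0 : h q = 0)
    (h0' : fderiv ℝ h q = 0) {ρ : ℝ} (hρ : 0 < ρ) {η : ℝ≥0} (hη : 0 < η) :
    ∃ u : Plane → Plane, ContDiff ℝ ∞ u ∧ LipschitzWith η u ∧ (∀ᶠ y in 𝓝 q, u y = h y) ∧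
      ∀ y, y ∉ Metric.closedBall q ρ → u y = 0 := by
  let χ : ContDiffBump (0 : Plane) := ⟨1, 2, one_pos, one_lt_two⟩
  have hχs : ContDiff ℝ ∞ χ := χ.contDiff
  obtain ⟨C, hC⟩ := hχs.lipschitzWith_of_hasCompactSupport χ.hasCompactSupport (by simp)
  -- If ‖Dh‖ ≤ η' and hence ‖h‖ ≤ η' · 2ε on the ball of radius 2ε, the product rule bounds the
  -- cut-off map's derivative by η' + (C/ε)(2ε η') = η'(1 + 2C), whatever ε is.
  set η' : ℝ := η / (1 + 2 * C) with hη'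
  have hden : (0 : ℝ) < 1 + 2 * C := by positivity
  have hη'0 : 0 < η' := div_pos hη hden
  have hcont : Continuous (fderiv ℝ h) := hs.continuous_fderiv (by simp)
  have hev : ∀ᶠ y in 𝓝 q, ‖fderiv ℝ h y‖ < η' := by
    have := hcont.norm.continuousAt (x := q)
    refine this.eventually (gt_mem_nhds ?_)
    simpa [h0'] using hη'0
  obtain ⟨δ, δ0, hδ⟩ := Metric.eventually_nhds_iff_ball.1 hev
  have hd : Differentiable ℝ h := hs.differentiable (by simp)
  have hbound : ∀ y ∈ Metric.ball q δ, ‖h y‖ ≤ η' * ‖y - q‖ := by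
    intro y hy
    have := (convex_ball q δ).norm_image_sub_le_of_norm_fderiv_le (𝕜 := ℝ) (f := h) (C := η')
      (fun x _ => hd x) (fun x hx => (hδ x hx).le) (Metric.mem_ball_self δ0) hy
    rwa [h0, sub_zero] at this
  obtain ⟨ε, ε0, hε1, hε2⟩ : ∃ ε > 0, 2 * ε < δ ∧ 2 * ε ≤ ρ :=
    ⟨min δ ρ / 3, by positivity, by
      have := min_le_left δ ρ; have : 0 < min δ ρ := by positivity
      linarith, by
      have := min_le_right δ ρ; have : 0 < min δ ρ := by positivity
      linarith⟩
  let u : Plane → Plane := fun y => χ (ε⁻¹ • (y - q)) • h y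
  have hsc : ContDiff ℝ ∞ (fun y : Plane => ε⁻¹ • (y - q)) := by fun_prop
  have hus : ContDiff ℝ ∞ u := (hχs.comp hsc).smul hs
  have hout : ∀ y, 2 * ε ≤ ‖y - q‖ → u y = 0 := by
    intro y hy
    have : χ (ε⁻¹ • (y - q)) = 0 := by
      apply χ.zero_of_le_dist
      rw [dist_zero_right, norm_smul, Real.norm_of_nonneg (by positivity)]
      change 2 ≤ _
      rw [le_inv_mul_iff₀ ε0]; linarith
    simp [u, this]
  refine ⟨u, hus, ?_, ?_, ?_⟩
  · refine lipschitzWith_of_nnnorm_fderiv_le (𝕜 := ℝ) (hus.differentiable (by simp)) fun y => ?_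
    change ‖fderiv ℝ u y‖ ≤ η
    by_cases hy : ‖y - q‖ ≤ 2 * ε
    · have hyδ : y ∈ Metric.ball q δ := by
        rw [Metric.mem_ball, dist_eq_norm]; linarith
      have e1 : HasFDerivAt (fun y : Plane => ε⁻¹ • (y - q))
          (ε⁻¹ • ContinuousLinearMap.id ℝ Plane) y :=
        ((hasFDerivAt_id y).sub_const q).const_smul ε⁻¹
      have e2 := ((hχs.differentiable (by simp)) (ε⁻¹ • (y - q))).hasFDerivAt.comp y e1
      have e3 := e2.fun_smul (hd y).hasFDerivAt
      have e4 : fderiv ℝ u y = _ := e3.fderiv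
      rw [e4]
      have n1 : ‖fderiv ℝ χ (ε⁻¹ • (y - q))‖ ≤ C := norm_fderiv_le_of_lipschitz ℝ hC
      have n2 : ‖(fderiv ℝ χ (ε⁻¹ • (y - q))).comp (ε⁻¹ • ContinuousLinearMap.id ℝ Plane)‖ ≤
          C * ε⁻¹ := by
        refine (ContinuousLinearMap.opNorm_comp_le _ _).trans ?_
        have : ‖ε⁻¹ • ContinuousLinearMap.id ℝ Plane‖ ≤ ε⁻¹ := by
          rw [norm_smul, Real.norm_of_nonneg (by positivity)]
          exact mul_le_of_le_one_right (by positivity) ContinuousLinearMap.norm_id_le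
        gcongr
      have n3 : ‖χ (ε⁻¹ • (y - q))‖ ≤ 1 := by
        rw [Real.norm_of_nonneg χ.nonneg]; exact χ.le_one
      have n4 : ‖h y‖ ≤ η' * (2 * ε) := (hbound y hyδ).trans (by gcongr)
      refine (norm_add_le _ _).trans ?_
      rw [norm_smul, ContinuousLinearMap.norm_smulRight_apply]
      calc _ ≤ 1 * η' + (C * ε⁻¹) * (η' * (2 * ε)) := by
            have := (hδ y hyδ).le
            dsimp only [Function.comp]
            gcongr
        _ = η' * (1 + 2 * C) := by field_simp
        _ = η := by rw [hη']; field_simp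
    · have : u =ᶠ[𝓝 y] fun _ => 0 := by
        have hopen : IsOpen {y : Plane | 2 * ε < ‖y - q‖} :=
          isOpen_lt continuous_const (by fun_prop)
        filter_upwards [hopen.mem_nhds (not_le.1 hy)] with z hz
        exact hout z (le_of_lt hz)
      rw [this.fderiv_eq]
      simp
  · filter_upwards [Metric.ball_mem_nhds q ε0] with y hy
    have : χ (ε⁻¹ • (y - q)) = 1 := by
      apply χ.one_of_mem_closedBall
      rw [mem_closedBall_zero_iff, norm_smul, Real.norm_of_nonneg (by positivity)]
      change _ ≤ (1 : ℝ)
      rw [Metric.mem_ball, dist_eq_norm] at hy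
      rw [inv_mul_le_iff₀ ε0]; linarith
    simp [u, this]
  · intro y hy
    apply hout
    rw [Metric.mem_closedBall, dist_eq_norm, not_le] at hy
    linarith

/-- Finitely many germs of maps that fix a point to first order are realized by one isotopy. -/
theorem exists_isotopicToId_germs {ι : Type*} [Finite ι] {q : ι → Plane}
    (hq : Function.Injective q) {G : ι → Plane → Plane} (hG : ∀ i, ContDiff ℝ ∞ (G i))
    (hG0 : ∀ i, G i (q i) = q i)
    (hG1 : ∀ i, fderiv ℝ (G i) (q i) = ContinuousLinearMap.id ℝ Plane) :
    ∃ f, IsotopicToId f ∧ ∀ i, ∀ᶠ y in 𝓝 (q i), f y = G i y := by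
  classical
  have := Fintype.ofFinite ι
  obtain ⟨ρ, ρ0, hρ⟩ : ∃ ρ > 0, ∀ i j, i ≠ j → ρ < dist (q i) (q j) := by
    have h1 : ∀ p : ι × ι, ∀ᶠ ρ : ℝ in 𝓝[>] 0, p.1 ≠ p.2 → ρ < dist (q p.1) (q p.2) := by
      intro p
      by_cases hp : p.1 = p.2
      · simp [hp]
      · have : 0 < dist (q p.1) (q p.2) := dist_pos.2 fun h => hp (hq h)
        filter_upwards [nhdsWithin_le_nhds (gt_mem_nhds this)] with ρ hρ _
        exact hρ
    obtain ⟨ρ, h, h0⟩ := ((eventually_all.2 h1).and self_mem_nhdsWithin).exists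
    exact ⟨ρ, h0, fun i j hij => h (i, j) hij⟩
  -- With this constant the sum of all local corrections still has Lipschitz constant less than 1.
  set η : ℝ≥0 := 1 / (Fintype.card ι + 1) with hη
  have hη0 : 0 < η := by positivity
  have h2 : ∀ i, ∃ u : Plane → Plane, ContDiff ℝ ∞ u ∧ LipschitzWith η u ∧
      (∀ᶠ y in 𝓝 (q i), u y = G i y - y) ∧ ∀ y, y ∉ Metric.closedBall (q i) ρ → u y = 0 := by
    intro i
    refine exists_small_germ (h := fun y => G i y - y) ((hG i).sub contDiff_id) ?_ ?_ ρ0 hη0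
    · simp [hG0]
    · have e1 := ((hG i).differentiable (by simp) (q i)).hasFDerivAt.sub (hasFDerivAt_id (q i))
      refine e1.fderiv.trans ?_
      rw [hG1, sub_self]
  choose u hu hL hug huo using h2
  have hsum : ∀ s : Finset ι, LipschitzWith (s.card * η) (fun y => ∑ i ∈ s, u i y) := by
    intro s
    induction s using Finset.induction_on with
    | empty => simp
    | insert k s hk ih =>
      simp only [Finset.sum_insert hk, Finset.card_insert_of_notMem hk]
      refine ((hL k).add ih).weaken (le_of_eq ?_)
      push_cast; ring
  refine ⟨fun y => y + ∑ i, u i y, isotopicToId_id_add (ContDiff.sum fun i _ => hu i)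
    (hsum Finset.univ) ?_, fun i => ?_⟩
  · rw [Finset.card_univ, hη, mul_one_div, div_lt_one (by positivity)]
    exact lt_add_one _
  · have h3 : ∀ j, ∀ᶠ y in 𝓝 (q i), j ≠ i → u j y = 0 := by
      intro j
      by_cases hj : j = i
      · simp [hj]
      · have : (Metric.closedBall (q j) ρ)ᶜ ∈ 𝓝 (q i) := by
          refine Metric.isClosed_closedBall.isOpen_compl.mem_nhds ?_
          rw [mem_compl_iff, Metric.mem_closedBall, not_le]
          exact hρ i j (Ne.symm hj)
        filter_upwards [this] with y hy _
        exact huo j y hy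
    filter_upwards [hug i, eventually_all.2 h3] with y hy h4
    rw [Finset.sum_eq_single i (fun j _ hj => h4 j hj) (by simp), hy]
    abel

/-! ### Circle diffeomorphisms with prescribed values. -/

/-- A smooth monotone staircase, commuting with the unit translation, that rises by one on
`[0, l]` and is constant on `[l, 1]`. -/
noncomputable def staircase (l x : ℝ) : ℝ := ⌊x⌋ + Real.smoothTransition (Int.fract x / l)

theorem staircase_add_one (l x : ℝ) : staircase l (x + 1) = staircase l x + 1 := by
  unfold staircase
  rw [Int.floor_add_one, Int.fract_add_one]
  push_cast
  ring

/-- The plateau before the integer `m` absorbs the jump of `⌊x⌋` there: one formula holds on both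
sides, which gives smoothness at integers. -/
theorem staircase_eq_of_mem {l : ℝ} (hl : 0 < l) {m : ℤ} {x : ℝ} (h1 : m + l - 1 ≤ x)
    (h2 : x < m + 1) : staircase l x = m + Real.smoothTransition ((x - m) / l) := by
  unfold staircase
  rcases le_or_gt (m : ℝ) x with h | h
  · have hf : ⌊x⌋ = m := Int.floor_eq_iff.2 ⟨h, h2⟩
    rw [← Int.self_sub_floor, hf]
  · have hf : ⌊x⌋ = m - 1 := Int.floor_eq_iff.2 ⟨by push_cast; linarith, by push_cast; linarith⟩
    rw [← Int.self_sub_floor, hf, Real.smoothTransition.one_of_one_le,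
      Real.smoothTransition.zero_of_nonpos]
    · push_cast; ring
    · exact div_nonpos_of_nonpos_of_nonneg (by linarith) hl.le
    · rw [le_div_iff₀ hl]; push_cast; linarith

theorem contDiff_staircase {l : ℝ} (hl : 0 < l) (hl1 : l < 1) : ContDiff ℝ ∞ (staircase l) := by
  rw [contDiff_iff_contDiffAt]
  intro x
  have key : ∀ m : ℤ, m + l - 1 < x → x < m + 1 → ContDiffAt ℝ ∞ (staircase l) x := by
    intro m h1 h2
    have : staircase l =ᶠ[𝓝 x] fun x => m + Real.smoothTransition ((x - m) / l) := by
      filter_upwards [Ioo_mem_nhds h1 h2] with y hy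
      exact staircase_eq_of_mem hl hy.1.le hy.2
    refine ContDiffAt.congr_of_eventuallyEq ?_ this
    have h3 : ContDiff ℝ ∞ (fun x : ℝ => (x - m) / l) := by fun_prop
    exact (contDiff_const.add (Real.smoothTransition.contDiff.comp h3)).contDiffAt
  exact key ⌊x⌋ (by linarith [Int.floor_le x]) (Int.lt_floor_add_one x)

theorem monotone_staircase {l : ℝ} (hl : 0 < l) : Monotone (staircase l) := by
  intro x y hxy
  unfold staircase
  rcases (Int.floor_mono hxy).eq_or_lt with h | h
  · rw [h]
    gcongr
    apply Real.smoothTransition.monotone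
    gcongr
    rw [← Int.self_sub_floor, ← Int.self_sub_floor, h]
    linarith
  · have h1 : (⌊x⌋ : ℝ) + 1 ≤ ⌊y⌋ := by exact_mod_cast h
    have h2 := Real.smoothTransition.le_one (Int.fract x / l)
    have h3 := Real.smoothTransition.nonneg (Int.fract y / l)
    linarith

/-- An orientation-preserving diffeomorphism of the circle with prescribed values at finitely many
points, given by its lift to the line. -/
theorem exists_circle_lift {N : ℕ} (hN : 2 ≤ N) {s t : ℕ → ℝ} (hs : ∀ i < N, s i < s (i + 1))
    (ht : ∀ i < N, t i < t (i + 1)) (hsN : s N = s 0 + 1) (htN : t N = t 0 + 1) :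
    ∃ h : ℝ → ℝ, ContDiff ℝ ∞ h ∧ (∀ x, 0 < deriv h x) ∧ (∀ x, h (x + 1) = h x + 1) ∧
      ∀ i ≤ N, h (s i) = t i := by
  have hmono : ∀ i j, i ≤ j → j ≤ N → s i ≤ s j := by
    intro i j hij hj
    induction j, hij using Nat.le_induction with
    | base => rfl
    | succ j hij ih => exact (ih (by omega)).trans (hs j (by omega)).le
  -- At least two steps share the unit length, so each staircase has a plateau.
  have hlt : ∀ i < N, s (i + 1) - s i < 1 := by
    intro i hi
    rcases Nat.eq_zero_or_pos i with rfl | h0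
    · have h1 := hs 1 (by omega)
      have h2 := hmono (1 + 1) N (by omega) le_rfl
      simp only [zero_add]
      linarith
    · have h1 := hs 0 (by omega)
      have h2 := hmono (0 + 1) i (by omega) (by omega)
      have h3 := hmono (i + 1) N (by omega) le_rfl
      linarith
  obtain ⟨ε, ε0, hε⟩ : ∃ ε > 0, ∀ i < N, ε < t (i + 1) - t i := by
    have h1 : ∀ i ∈ Finset.range N, ∀ᶠ ε : ℝ in 𝓝[>] 0, ε < t (i + 1) - t i := by
      intro i hi
      exact nhdsWithin_le_nhds (gt_mem_nhds (sub_pos.2 (ht i (Finset.mem_range.1 hi))))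
    obtain ⟨ε, h, h0⟩ := (((Finset.range N).eventually_all.2 h1).and self_mem_nhdsWithin).exists
    exact ⟨ε, h0, fun i hi => h i (Finset.mem_range.2 hi)⟩
  let l : ℕ → ℝ := fun i => s (i + 1) - s i
  have hl0 : ∀ i < N, 0 < l i := fun i hi => sub_pos.2 (hs i hi)
  -- A linear function of small slope `ε` makes the derivative positive; the staircase over the
  -- `i`-th gap supplies the rest of the required rise.
  let a : ℕ → ℝ := fun i => (t (i + 1) - t i) - ε * l i
  have ha : ∀ i < N, 0 ≤ a i := by
    intro i hi
    have h1 := hε i hi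
    have h2 : ε * l i ≤ ε * 1 := mul_le_mul_of_nonneg_left (hlt i hi).le ε0.le
    simp only [a]
    linarith
  have hsum : ∀ j, ∑ i ∈ Finset.range j, a i = (t j - t 0) - ε * (s j - s 0) := by
    intro j
    simp only [a, l, Finset.sum_sub_distrib, ← Finset.mul_sum]
    rw [← Finset.sum_sub_distrib, ← Finset.sum_sub_distrib, Finset.sum_range_sub,
      Finset.sum_range_sub]
  let S : ℝ → ℝ := fun x => ∑ i ∈ Finset.range N, a i * staircase (l i) (x - s i)
  have hSs : ContDiff ℝ ∞ S := by
    refine ContDiff.sum fun i hi => contDiff_const.mul ?_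
    have hi' := Finset.mem_range.1 hi
    exact (contDiff_staircase (hl0 i hi') (hlt i hi')).comp (contDiff_id.sub contDiff_const)
  have hSm : Monotone S := by
    intro x y hxy
    refine Finset.sum_le_sum fun i hi => ?_
    have hi' := Finset.mem_range.1 hi
    exact mul_le_mul_of_nonneg_left (monotone_staircase (hl0 i hi') (by linarith)) (ha i hi')
  refine ⟨fun x => (ε * x + S x) + (t 0 - ε * s 0), ?_, ?_, ?_, ?_⟩
  · exact ((contDiff_const.mul contDiff_id).add hSs).add contDiff_const
  · intro x
    have h1 := (((hasDerivAt_id x).const_mul ε).add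
      ((hSs.differentiable (by simp)) x).hasDerivAt).add_const (t 0 - ε * s 0)
    have h2 : deriv (fun x => (ε * x + S x) + (t 0 - ε * s 0)) x = _ := h1.deriv
    rw [h2]
    have : 0 ≤ deriv S x := hSm.deriv_nonneg
    linarith
  · intro x
    have : S (x + 1) = S x + (1 - ε) := by
      have hN := hsum N
      rw [hsN, htN] at hN
      have : (1 - ε) = ∑ i ∈ Finset.range N, a i := by rw [hN]; ring
      rw [this, ← Finset.sum_add_distrib]
      refine Finset.sum_congr rfl fun i _ => ?_
      rw [add_sub_right_comm, staircase_add_one]; ring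
    simp only [this]
    ring
  · intro j hj
    -- At `s j` exactly the steps with i < j have been climbed; all staircases are on plateaus
    -- there, at height 1 or 0.
    have : S (s j) = ∑ i ∈ Finset.range j, a i := by
      change ∑ i ∈ Finset.range N, a i * staircase (l i) (s j - s i) = _
      rw [← Finset.sum_subset (Finset.range_subset_range.2 hj)
        (f := fun i => a i * staircase (l i) (s j - s i))]
      · refine Finset.sum_congr rfl fun i hi => ?_
        have hi' := Finset.mem_range.1 hi
        have h1 := hmono (i + 1) j (by omega) hj
        have h2 : s j ≤ s i + 1 := by
          have := hmono 0 i (by omega) (by omega)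
          have := hmono j N hj le_rfl
          linarith
        have h3 := hl0 i (by omega)
        have h4 := hlt i (by omega)
        rw [staircase_eq_of_mem (m := 1) h3 (by push_cast; simp only [l]; linarith)
          (by push_cast; linarith), Real.smoothTransition.zero_of_nonpos]
        · simp
        · exact div_nonpos_of_nonpos_of_nonneg (by push_cast; linarith) h3.le
      · intro i hi hij
        have hi' := Finset.mem_range.1 hi
        have hij' : j ≤ i := by simpa using hij
        have h1 := hmono j i hij' (by omega)
        have h2 : s (i + 1) ≤ s j + 1 := by
          have := hmono (i + 1) N (by omega) le_rfl
          have := hmono 0 j (by omega) hj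
          linarith
        have h3 := hl0 i hi'
        rw [staircase_eq_of_mem (m := 0) h3 (by push_cast; simp only [l]; linarith)
          (by push_cast; linarith), Real.smoothTransition.zero_of_nonpos]
        · simp
        · exact div_nonpos_of_nonpos_of_nonneg (by push_cast; linarith) h3.le
    simp only [this, hsum]
    ring

/-! ### Transport of diagrams along diffeomorphisms. -/

theorem VirtualDiagram.isGeneric (D : VirtualDiagram) : IsGeneric (fun t : ℝ => D.curve t) where
  smooth := D.smooth
  periodic t := by
    have : ((t + 1 : ℝ) : UnitAddCircle) = t := coe_circle_eq_iff.2 ⟨1, by simp⟩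
    simp only [this]
  immersed := D.immersed
  transverse := D.transverse
  no_triple r s t := D.no_triple r s t

/-- The virtual diagram with a given generic curve and a given set of real crossings. -/
noncomputable def VirtualDiagram.ofGeneric {c : ℝ → Plane} (hc : IsGeneric c) (X : Set Plane)
    (hX : ∀ x ∈ X, ∃ s t : ℝ, (s : UnitAddCircle) ≠ t ∧ c s = x ∧ c t = x) : VirtualDiagram where
  curve := hc.periodic.lift
  smooth := hc.smooth
  immersed := hc.immersed
  transverse := hc.transverse
  no_triple r s t := by
    induction r using QuotientAddGroup.induction_on
    induction s using QuotientAddGroup.induction_on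
    induction t using QuotientAddGroup.induction_on
    exact hc.no_triple _ _ _
  realCrossings := X
  real_isCrossing x hx := by
    obtain ⟨s, t, h⟩ := hX x hx
    exact ⟨s, t, h⟩

theorem IsGeneric.comp_lift {c : ℝ → Plane} (hc : IsGeneric c) {h : ℝ → ℝ} (hs : ContDiff ℝ ∞ h)
    (hd : ∀ t, 0 < deriv h t) (hp : ∀ t, h (t + 1) = h t + 1) : IsGeneric (fun t => c (h t)) := by
  have hm : StrictMono h := strictMono_of_deriv_pos hd
  have hder : ∀ t, deriv (fun t => c (h t)) t = deriv h t • deriv c (h t) := fun t =>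
    ((hc.smooth.differentiable (by simp) (h t)).hasDerivAt.scomp t
      (hs.differentiable (by simp) t).hasDerivAt).deriv
  refine ⟨hc.smooth.comp hs, fun t => ?_, fun t => ?_, fun s t hst he => ?_, fun r s t h1 h2 => ?_⟩
  · simp only [hp, hc.periodic (h t)]
  · rw [hder]
    exact smul_ne_zero (hd t).ne' (hc.immersed _)
  · rw [hder, hder, det2_smul_left, det2_smul_right]
    exact mul_ne_zero (hd s).ne' (mul_ne_zero (hd t).ne'
      (hc.transverse _ _ (fun h => hst ((lift_coe_eq_iff hm hp).1 h)) he))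
  · simpa only [lift_coe_eq_iff hm hp] using hc.no_triple _ _ _ h1 h2

theorem IsGeneric.map {c : ℝ → Plane} (hc : IsGeneric c) {f ψ : Plane → Plane}
    (hf : ContDiff ℝ ∞ f) (hψ : ContDiff ℝ ∞ ψ) (hl : Function.LeftInverse ψ f) :
    IsGeneric (fun t => f (c t)) := by
  have hder : ∀ t, deriv (fun t => f (c t)) t = fderiv ℝ f (c t) (deriv c t) := fun t =>
    ((hf.differentiable (by simp) (c t)).hasFDerivAt.comp_hasDerivAt t
      (hc.smooth.differentiable (by simp) t).hasDerivAt).deriv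
  have hcomp : ∀ x, (fderiv ℝ ψ (f x)).comp (fderiv ℝ f x) = ContinuousLinearMap.id ℝ Plane := by
    intro x
    rw [← fderiv_comp x (hψ.differentiable (by simp) _) (hf.differentiable (by simp) _),
      hl.comp_eq_id, fderiv_id]
  refine ⟨hf.comp hc.smooth, fun t => ?_, fun t h => ?_, fun s t hst he => ?_, fun r s t h1 h2 => ?_⟩
  · simp only [hc.periodic t]
  · rw [hder] at h
    apply hc.immersed t
    have := DFunLike.congr_fun (hcomp (c t)) (deriv c t)
    simpa [h] using this.symm
  · have he' := hl.injective he
    rw [hder, hder, he', det2_map]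
    exact mul_ne_zero (detMap_ne_zero_of_comp (hcomp _)) (hc.transverse s t hst he')
  · exact hc.no_triple r s t (hl.injective h1) (hl.injective h2)

theorem surjective_of_lift {h : ℝ → ℝ} (hc : Continuous h) (hp : ∀ t, h (t + 1) = h t + 1) :
    Function.Surjective h := by
  intro y
  have h1 : h ⌊y - h 0⌋ = h 0 + ⌊y - h 0⌋ := by
    have := lift_add_int hp 0 ⌊y - h 0⌋
    rwa [zero_add] at this
  have h2 := hp ⌊y - h 0⌋
  have hle : (⌊y - h 0⌋ : ℝ) ≤ ⌊y - h 0⌋ + 1 := by linarith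
  obtain ⟨x, -, hx⟩ := intermediate_value_Icc hle hc.continuousOn
    (show y ∈ Icc _ _ from ⟨by rw [h1]; linarith [Int.floor_le (y - h 0)],
      by rw [h2, h1]; linarith [Int.lt_floor_add_one (y - h 0)]⟩)
  exact ⟨x, hx⟩

theorem SameDiagram.exists_of_lift (D : MarkedDiagram n) {h : ℝ → ℝ} (hs : ContDiff ℝ ∞ h)
    (hd : ∀ t, 0 < deriv h t) (hp : ∀ t, h (t + 1) = h t + 1) {s₀ : ℝ}
    (h₀ : (h s₀ : UnitAddCircle) ∈ D.base) :
    ∃ D' : MarkedDiagram n, SameDiagram D D' ∧ (s₀ : UnitAddCircle) ∈ D'.base ∧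
      ∀ t x, D.HasJLabel (h t) x → D'.HasJLabel t x := by
  have hm : StrictMono h := strictMono_of_deriv_pos hd
  have hsurj := surjective_of_lift hs.continuous hp
  let V := VirtualDiagram.ofGeneric (D.isGeneric.comp_lift hs hd hp) D.realCrossings (by
    intro x hx
    obtain ⟨a, b, hab, ha, hb⟩ := D.real_isCrossing x hx
    obtain ⟨a, rfl⟩ := QuotientAddGroup.mk_surjective a
    obtain ⟨b, rfl⟩ := QuotientAddGroup.mk_surjective b
    obtain ⟨a, rfl⟩ := hsurj a
    obtain ⟨b, rfl⟩ := hsurj b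
    exact ⟨a, b, fun he => hab ((lift_coe_eq_iff hm hp).2 he), ha, hb⟩)
  have hV : ∀ t : ℝ, V.curve t = D.curve (h t : UnitAddCircle) := fun t => rfl
  have hs₀ : V.curve s₀ ∉ V.realCrossings := D.base_subset h₀
  let D' : MarkedDiagram n :=
    { toVirtualDiagram := V
      label := D.label
      base := connectedComponentIn {s | V.curve s ∉ V.realCrossings} s₀
      base_isSemiarc := ⟨s₀, hs₀, rfl⟩ }
  have hb₀ : (s₀ : UnitAddCircle) ∈ D'.base := mem_connectedComponentIn hs₀
  have hsame : SameDiagram D D' := by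
    refine ⟨h, hs, hd, hp, hV, rfl, fun _ _ _ => rfl, fun t => ?_⟩
    rw [D'.mem_base_iff hb₀, D.mem_base_iff h₀]
    refine exists_congr fun m => ?_
    rw [← lift_add_int hp]
    constructor
    · intro H y hy
      obtain ⟨x, rfl⟩ := hsurj y
      apply H x
      rw [mem_uIcc] at hy ⊢
      simpa only [hm.le_iff_le] using hy
    · intro H x hx
      apply H (h x)
      rw [mem_uIcc] at hx ⊢
      simpa only [hm.le_iff_le] using hx
  refine ⟨D', hsame, hb₀, fun t x hx => ?_⟩
  obtain ⟨y, hy⟩ := D'.exists_hasJLabel (t := t) hx.mem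
  have := SameDiagram.hasJLabel (D := D) (D' := D') hs hd hp hV rfl (fun _ _ _ => rfl) hy
  rwa [this.eq hx] at hy

/-- The image of a marked diagram under a diffeomorphism of the plane. -/
noncomputable def MarkedDiagram.push (D : MarkedDiagram n) {f ψ : Plane → Plane}
    (hf : ContDiff ℝ ∞ f) (hψ : ContDiff ℝ ∞ ψ) (hl : Function.LeftInverse ψ f) :
    MarkedDiagram n where
  toVirtualDiagram :=
    { curve := fun t => f (D.curve t)
      smooth := (D.isGeneric.map hf hψ hl).smooth
      immersed := (D.isGeneric.map hf hψ hl).immersed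
      transverse := (D.isGeneric.map hf hψ hl).transverse
      no_triple := fun r s t h1 h2 => D.no_triple r s t (hl.injective h1) (hl.injective h2)
      realCrossings := f '' D.realCrossings
      real_isCrossing := by
        rintro _ ⟨x, hx, rfl⟩
        obtain ⟨s, t, hst, hs, ht⟩ := D.real_isCrossing x hx
        exact ⟨s, t, hst, congrArg f hs, congrArg f ht⟩ }
  label := (Equiv.Set.image f D.realCrossings hl.injective).symm.trans D.label
  base := D.base
  base_isSemiarc := by
    obtain ⟨t, ht, hA⟩ := D.base_isSemiarc
    refine ⟨t, by simpa [hl.injective.mem_set_image] using ht, ?_⟩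
    rw [hA]
    simp [hl.injective.mem_set_image]

theorem MarkedDiagram.push_label (D : MarkedDiagram n) {f ψ : Plane → Plane}
    (hf : ContDiff ℝ ∞ f) (hψ : ContDiff ℝ ∞ ψ) (hl : Function.LeftInverse ψ f) {x : Plane}
    (hx : x ∈ D.realCrossings) (hx' : f x ∈ (D.push hf hψ hl).realCrossings) :
    (D.push hf hψ hl).label ⟨f x, hx'⟩ = D.label ⟨x, hx⟩ := by
  change D.label ((Equiv.Set.image f D.realCrossings hl.injective).symm ⟨f x, hx'⟩) = _
  congr 1
  rw [Equiv.symm_apply_eq]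
  rfl

theorem IsIsotopy.isotopyMove_push {φ : ℝ → Plane → Plane} (hφ : IsIsotopy φ) {ψ : Plane → Plane}
    (hψ : ContDiff ℝ ∞ ψ) (hl : Function.LeftInverse ψ (φ 1)) (D : MarkedDiagram n) :
    IsotopyMove D (D.push (hφ.contDiff 1) hψ hl) :=
  ⟨φ, hφ, fun _ => rfl, rfl, fun _ hx hx' => D.push_label _ _ _ hx hx', rfl⟩

/-- For pulling a diagram back along an isotopy: the move is read from the new diagram to the old
one, so `ψ` itself need not be exhibited as the end of an isotopy. -/
theorem IsIsotopy.isotopyMove_of_push {φ : ℝ → Plane → Plane} (hφ : IsIsotopy φ) {ψ : Plane → Plane}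
    (hψ : ContDiff ℝ ∞ ψ) (hr : Function.RightInverse ψ (φ 1)) (D : MarkedDiagram n) : IsotopyMove (D.push hψ (hφ.contDiff 1) hr) D := by
  refine ⟨φ, hφ, fun t => (hr _).symm, ?_, ?_, rfl⟩
  · change _ = φ 1 '' (ψ '' D.realCrossings)
    rw [← image_comp, hr.comp_eq_id, image_id]
  · rintro _ ⟨x, hx, rfl⟩ hx'
    have h1 := D.push_label hψ (hφ.contDiff 1) hr hx ⟨x, hx, rfl⟩
    rw [h1]
    congr 1
    exact Subtype.ext (hr x)

/-! ### Standard form, and reduction of every diagram to it. -/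

/-- The standard position of the `j`-th real crossing. -/
noncomputable def stdPos (j : Fin n) : Plane := EuclideanSpace.single 0 (j : ℝ)

/-- The standard direction of a branch. -/
noncomputable def stdDir : Side → Plane
  | Side.L => EuclideanSpace.single 1 1
  | Side.R => EuclideanSpace.single 0 1

/-- The standard parameters of the real crossings. -/
noncomputable def stdParam (n : ℕ) (i : ℕ) : ℝ := i / (2 * n)

/-- The standard base point. -/
noncomputable def stdBase (n : ℕ) : ℝ := -1 / (4 * n)

/-- The standard branch with a given label, as a function of the time to the crossing. -/
noncomputable def stdGerm (x : Fin n × Side) (t : ℝ) : Plane := stdPos x.1 + t • stdDir x.2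

theorem stdPos_injective : Function.Injective (stdPos : Fin n → Plane) := by
  intro i j h
  have := congrArg (fun v : Plane => v 0) h
  simp only [stdPos, PiLp.single_apply] at this
  apply Fin.ext
  simpa using this

theorem hasDerivAt_stdGerm (x : Fin n × Side) (τ t : ℝ) :
    HasDerivAt (fun s => stdGerm x (s - τ)) (stdDir x.2) t := by
  have := (((hasDerivAt_id t).sub_const τ).smul_const (stdDir x.2)).const_add (stdPos x.1)
  simpa [stdGerm] using this

/-- A diagram in standard form for the Gauss code `w`: its real crossings, the branches there and
their parameters are the standard ones. -/
structure IsStd (w : GaussCode n) (D : MarkedDiagram n) : Prop where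
  germ : ∀ i : Fin (2 * n), ∀ᶠ s in 𝓝 (stdParam n i),
    D.curve (s : ℝ) = stdGerm (w.1 i) (s - stdParam n i)
  real : D.realCrossings = range (stdPos : Fin n → Plane)
  label : ∀ j h, D.label ⟨stdPos j, h⟩ = j
  base : (stdBase n : UnitAddCircle) ∈ D.base

theorem GaussCode.bijective (w : GaussCode n) : Function.Bijective w.1 := by
  rw [Fintype.bijective_iff_surjective_and_card]
  exact ⟨w.2, by rw [card_jLabels, Fintype.card_fin]⟩

theorem stdParam_lt_one {i : ℕ} (hi : i < 2 * n) : stdParam n i < 1 := by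
  have : (0 : ℝ) < 2 * n := by exact_mod_cast (by omega : 0 < 2 * n)
  rw [stdParam, div_lt_one this]
  exact_mod_cast hi

theorem stdParam_nonneg (i : ℕ) : 0 ≤ stdParam n i := by unfold stdParam; positivity

theorem stdParam_coe_injective {i j : Fin (2 * n)}
    (h : (stdParam n i : UnitAddCircle) = stdParam n j) : i = j := by
  obtain ⟨k, hk⟩ := coe_circle_eq_iff.1 h
  have h1 := stdParam_lt_one i.2
  have h2 := stdParam_lt_one j.2
  have h3 := stdParam_nonneg (n := n) i
  have h4 := stdParam_nonneg (n := n) j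
  have h5 : (k : ℝ) < 1 := by linarith
  have h6 : (-1 : ℝ) < k := by linarith
  have h5' : k < (1 : ℤ) := by exact_mod_cast h5
  have h6' : (-1 : ℤ) < k := by exact_mod_cast h6
  have h7 : k = 0 := by omega
  rw [h7, Int.cast_zero, add_zero] at hk
  have h0 : (2 * n : ℝ) ≠ 0 := by exact_mod_cast (by have := i.2; omega : 2 * n ≠ 0)
  unfold stdParam at hk
  rw [div_left_inj' h0] at hk
  exact Fin.ext (by exact_mod_cast hk)

namespace IsStd

variable {w : GaussCode n} {D : MarkedDiagram n}

theorem curve_param (h : IsStd w D) (i : Fin (2 * n)) :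
    D.curve (stdParam n i : ℝ) = stdPos (w.1 i).1 := by
  have := (h.germ i).self_of_nhds
  simpa [stdGerm] using this

theorem velocity_param (h : IsStd w D) (i : Fin (2 * n)) :
    velocity D.curve (stdParam n i) = stdDir (w.1 i).2 := by
  have : (fun s : ℝ => D.curve s) =ᶠ[𝓝 (stdParam n i)] _ := h.germ i
  unfold velocity
  rw [this.deriv_eq]
  exact (hasDerivAt_stdGerm _ _ _).deriv

theorem hasJLabel (h : IsStd w D) (i : Fin (2 * n)) : D.HasJLabel (stdParam n i) (w.1 i) := by
  have hpos := h.curve_param i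
  have hmem : D.curve (stdParam n i : ℝ) ∈ D.realCrossings := by
    rw [hpos, h.real]; exact mem_range_self _
  have hother : ∀ e, e ≠ (w.1 i).2 → ∃ k : Fin (2 * n),
      (stdParam n k : UnitAddCircle) ≠ stdParam n i ∧
      D.curve (stdParam n k : ℝ) = D.curve (stdParam n i : ℝ) ∧
      velocity D.curve (stdParam n k) = stdDir e := by
    intro e he
    obtain ⟨k, hk⟩ := w.2 ((w.1 i).1, e)
    refine ⟨k, fun h' => he ?_, ?_, ?_⟩
    · rw [← stdParam_coe_injective h', hk]
    · rw [h.curve_param, hpos, hk]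
    · rw [h.velocity_param, hk]
  refine ⟨⟨hmem, ?_⟩, ?_⟩
  · rw [← h.label (w.1 i).1 (hpos ▸ hmem)]
    congr 1
    exact Subtype.ext hpos
  · have hv := h.velocity_param i
    rcases hxs : (w.1 i).2 with _ | _
    · obtain ⟨k, h1, h2, h3⟩ := hother Side.R (by rw [hxs]; simp)
      refine ⟨_, h1, h2, ?_⟩
      rw [hv, h3, hxs]
      simp [stdDir, det2]
    · obtain ⟨k, h1, h2, h3⟩ := hother Side.L (by rw [hxs]; simp)
      refine ⟨_, h1, h2, ?_⟩
      rw [hv, h3, hxs]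
      simp [stdDir, det2]

/-- Every letter already occurs at a standard parameter, and a letter determines its parameter on
the circle. -/
theorem mem_real_iff (h : IsStd w D) {t : ℝ} :
    D.curve t ∈ D.realCrossings ↔ ∃ i : Fin (2 * n), (t : UnitAddCircle) = stdParam n i := by
  constructor
  · intro ht
    obtain ⟨x, hx⟩ := D.exists_hasJLabel ht
    obtain ⟨i, rfl⟩ := w.2 x
    exact ⟨i, hx.coe_eq (h.hasJLabel i)⟩
  · rintro ⟨i, hi⟩
    rw [hi]
    exact (h.hasJLabel i).mem

theorem hasGaussCode (h : IsStd w D) : D.HasGaussCode w := by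
  refine ⟨stdBase n, h.base, fun i => stdParam n i, ?_, fun i => ?_, h.hasJLabel⟩
  · intro i j hij
    have : (0 : ℝ) < 2 * n := by exact_mod_cast (by have := i.2; omega : 0 < 2 * n)
    exact div_lt_div_of_pos_right (by exact_mod_cast hij) this
  · have hn : (0 : ℝ) < n := by exact_mod_cast (by have := i.2; omega : 0 < n)
    have h1 := stdParam_nonneg (n := n) i
    have h2 : ((i : ℕ) : ℝ) + 1 ≤ 2 * n := by exact_mod_cast i.2
    constructor
    · have : stdBase n < 0 := by
        unfold stdBase
        exact div_neg_of_neg_of_pos (by norm_num) (by positivity)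
      exact this.trans_le h1
    · unfold stdParam stdBase
      have : ((i : ℕ) : ℝ) / (2 * n) ≤ 1 - 1 / (2 * n) := by
        rw [div_le_iff₀ (by positivity)]
        field_simp
        linarith
      have h3 : (1 : ℝ) / (2 * n) - 1 / (4 * n) = 1 / (4 * n) := by field_simp; norm_num
      have h4 : (0 : ℝ) < 1 / (4 * n) := by positivity
      rw [neg_div]
      linarith

end IsStd

theorem strict_of_same {D D' : MarkedDiagram n} (h : SameDiagram D D') : (strictSetoid n).r D D' :=
  Relation.EqvGen.rel _ _ (Or.inl h)

theorem strict_of_isotopy {D D' : MarkedDiagram n} (h : IsotopyMove D D') :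
    (strictSetoid n).r D D' :=
  Relation.EqvGen.rel _ _ (Or.inr (Or.inl h))

theorem strict_of_detour {D D' : MarkedDiagram n} (h : DetourMove D D') : (strictSetoid n).r D D' :=
  Relation.EqvGen.rel _ _ (Or.inr (Or.inr h))

/-- Every diagram can be reparametrized so that its real crossings have the standard parameters. -/
theorem MarkedDiagram.HasGaussCode.exists_stdParam (hn : 0 < n) {D : MarkedDiagram n}
    {w : GaussCode n} (hw : D.HasGaussCode w) :
    ∃ D' : MarkedDiagram n, (strictSetoid n).r D D' ∧ (stdBase n : UnitAddCircle) ∈ D'.base ∧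
      ∀ i : Fin (2 * n), D'.HasJLabel (stdParam n i) (w.1 i) := by
  obtain ⟨t₀, h₀, t, htm, ht, hw⟩ := hw
  -- The nodes are the base point, the 2n crossing times moved up by one index, and the base point
  -- one period later, whence N = 2n + 1.
  let s : ℕ → ℝ := fun i => if i = 0 then stdBase n else if i ≤ 2 * n then stdParam n (i - 1)
    else stdBase n + 1
  let t' : ℕ → ℝ := fun i => if i = 0 then t₀ else if h : i - 1 < 2 * n then t ⟨i - 1, h⟩
    else t₀ + 1
  have hn' : (0 : ℝ) < n := by exact_mod_cast hn
  have h2n : (0 : ℝ) < 2 * n := by positivity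
  have hbase : stdBase n = -(1 / 2) / (2 * n) := by unfold stdBase; field_simp; norm_num
  have hbase1 : stdBase n + 1 = (2 * n - 1 / 2) / (2 * n) := by rw [hbase]; field_simp; ring
  obtain ⟨h, hs, hd, hp, hst⟩ := exists_circle_lift (N := 2 * n + 1) (s := s) (t := t') (by omega)
    (by
      intro i hi
      simp only [s]
      rcases Nat.eq_zero_or_pos i with rfl | h0
      · have : 1 ≤ 2 * n := by omega
        simp only [if_true, zero_add, one_ne_zero, if_false, if_pos this, Nat.sub_self]
        rw [hbase, stdParam]
        gcongr
        norm_num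
      · rw [if_neg (by omega), if_pos (by omega), if_neg (by omega)]
        split_ifs with h1
        · unfold stdParam
          gcongr
          omega
        · rw [hbase1, stdParam]
          have : i - 1 + 1 = 2 * n := by omega
          have : (((i - 1 : ℕ) : ℝ)) + 1 = 2 * n := by exact_mod_cast this
          gcongr
          linarith)
    (by
      intro i hi
      simp only [t']
      rcases Nat.eq_zero_or_pos i with rfl | h0
      · have : 1 - 1 < 2 * n := by omega
        simp only [if_true, zero_add, one_ne_zero, if_false, dif_pos this]
        exact (ht _).1
      · rw [if_neg (by omega), dif_pos (by omega), if_neg (by omega)]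
        split_ifs with h1
        · apply htm
          change i - 1 < i + 1 - 1
          omega
        · exact (ht _).2)
    (by simp [s]) (by simp [t'])
  have hs0 : h (stdBase n) = t₀ := by
    have := hst 0 (by omega)
    simpa [s, t'] using this
  have hsi : ∀ i : Fin (2 * n), h (stdParam n i) = t i := by
    intro i
    have := hst (i + 1) (by omega)
    simp only [s, t'] at this
    rw [if_neg (by omega), if_pos (by omega), if_neg (by omega), dif_pos (by simp)] at this
    simpa using this
  obtain ⟨D', h1, h2, h3⟩ := SameDiagram.exists_of_lift D hs hd hp (s₀ := stdBase n)
    (by rwa [hs0])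
  refine ⟨D', strict_of_same h1, h2, fun i => h3 _ _ ?_⟩
  rw [hsi]
  exact hw i

/-- The index of a letter of a Gauss code. -/
noncomputable def GaussCode.index (w : GaussCode n) (x : Fin n × Side) : Fin (2 * n) :=
  (Equiv.ofBijective _ w.bijective).symm x

theorem GaussCode.apply_index (w : GaussCode n) (x : Fin n × Side) : w.1 (w.index x) = x :=
  (Equiv.ofBijective _ w.bijective).apply_symm_apply x

/-- A diagram whose real crossings, their parameters and velocities are the standard ones. -/
structure IsStdToFirstOrder (w : GaussCode n) (D : MarkedDiagram n) : Prop where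
  curve_param : ∀ i : Fin (2 * n), D.curve (stdParam n i : ℝ) = stdPos (w.1 i).1
  velocity_param : ∀ i : Fin (2 * n), velocity D.curve (stdParam n i) = stdDir (w.1 i).2
  real : D.realCrossings = range (stdPos : Fin n → Plane)
  label : ∀ j h, D.label ⟨stdPos j, h⟩ = j
  base : (stdBase n : UnitAddCircle) ∈ D.base

theorem exists_isStdToFirstOrder {w : GaussCode n} {D : MarkedDiagram n}
    (hb : (stdBase n : UnitAddCircle) ∈ D.base)
    (hJ : ∀ i : Fin (2 * n), D.HasJLabel (stdParam n i) (w.1 i)) :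
    ∃ D', (strictSetoid n).r D D' ∧ IsStdToFirstOrder w D' := by
  let x : Fin n → Plane := fun j => D.label.symm j
  have hxinj : Function.Injective x := fun i j h => D.label.symm.injective (Subtype.ext h)
  have hxmem : ∀ j, x j ∈ D.realCrossings := fun j => (D.label.symm j).2
  have hcurve : ∀ i : Fin (2 * n), D.curve (stdParam n i : ℝ) = x (w.1 i).1 := by
    intro i
    obtain ⟨⟨h, hl⟩, -⟩ := hJ i
    change _ = ((D.label.symm (w.1 i).1 : D.realCrossings) : Plane)
    rw [← hl, Equiv.symm_apply_apply]
  let τ : Fin n × Side → ℝ := fun y => stdParam n (w.index y)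
  have hτ : ∀ j e, D.curve (τ (j, e) : ℝ) = x j := by
    intro j e
    simp only [τ]
    rw [hcurve, w.apply_index]
  -- At each crossing, the right branch followed by the left one is a positive frame, so it can be
  -- carried to the standard basis.
  have hdet : ∀ j, 0 < det2 (velocity D.curve (τ (j, Side.R))) (velocity D.curve (τ (j, Side.L))) := by
    intro j
    have h1 := hJ (w.index (j, Side.R))
    rw [w.apply_index] at h1
    obtain ⟨-, s, hs1, hs2, hs3⟩ := h1
    change (s : UnitAddCircle) ≠ (τ (j, Side.R) : ℝ) at hs1
    change D.curve s = D.curve (τ (j, Side.R) : ℝ) at hs2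
    have hRL : (τ (j, Side.R) : UnitAddCircle) ≠ (τ (j, Side.L) : ℝ) := by
      intro h
      have := congrArg w.1 (stdParam_coe_injective h)
      rw [w.apply_index, w.apply_index] at this
      simp at this
    rcases D.no_triple s _ _ hs2 ((hτ j Side.R).trans (hτ j Side.L).symm) with h | h | h
    · exact (hs1 h).elim
    · exact (hRL h).elim
    · rwa [velocity_eq_of_coe_eq _ h] at hs3
  -- A preliminary translation separates the sources from the targets, as `exists_movesFrames`
  -- requires.
  obtain ⟨a, ha⟩ : ∃ a : Plane, ∀ i j, x i + a ≠ stdPos j := by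
    have hfin : (range fun p : Fin n × Fin n => stdPos p.2 - x p.1).Finite := finite_range _
    obtain ⟨a, ha⟩ := hfin.infinite_compl.nonempty
    refine ⟨a, fun i j h => ha ⟨(i, j), ?_⟩⟩
    simp only [← h]
    abel
  have hfd : ∀ y, fderiv ℝ (fun y : Plane => y + a) y = ContinuousLinearMap.id ℝ Plane := fun y =>
    ((hasFDerivAt_id y).add_const a).fderiv
  obtain ⟨g, hg⟩ := exists_movesFrames
    (α := fun j => (x j + a, velocity D.curve (τ (j, Side.R)), velocity D.curve (τ (j, Side.L))))
    (β := fun j => (stdPos j, stdDir Side.R, stdDir Side.L))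
    (fun i j h => hxinj (add_right_cancel h)) stdPos_injective ha hdet
    (fun j => by simp [stdDir, det2])
  rcases Nat.eq_zero_or_pos n with h0 | hn
  · subst h0
    exact ⟨D, (strictSetoid 0).refl D, fun i => i.elim0, fun i => i.elim0,
      by
        rw [range_eq_empty, eq_empty_iff_forall_notMem]
        exact fun y hy => (D.label ⟨y, hy⟩).elim0,
      fun j => j.elim0, hb⟩
  have hm : ∀ j, MovesFrame ∅ (g ∘ fun y => y + a)
      (x j, velocity D.curve (τ (j, Side.R)), velocity D.curve (τ (j, Side.L)))
      (stdPos j, stdDir Side.R, stdDir Side.L) := fun j =>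
    MovesFrame.comp ⟨isotopicToId_add_const a, by simp, rfl, by rw [hfd]; rfl, by rw [hfd]; rfl⟩
      (hg j)
  obtain ⟨φ, hφ, hφ1⟩ := (hm ⟨0, hn⟩).isotopic
  rw [← hφ1] at hm
  obtain ⟨ψ, hψ, hl, -⟩ := hφ.diffeo 1
  have hv : ∀ t : ℝ, velocity (fun s => φ 1 (D.curve s)) t =
      fderiv ℝ (φ 1) (D.curve t) (velocity D.curve t) := fun t =>
    (((hφ.contDiff 1).differentiable (by simp) (D.curve t)).hasFDerivAt.comp_hasDerivAt t
      (D.hasDerivAt t)).deriv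
  refine ⟨D.push (hφ.contDiff 1) hψ hl, strict_of_isotopy (hφ.isotopyMove_push hψ hl D),
    fun i => ?_, fun i => ?_, ?_, fun j h => ?_, hb⟩
  · change φ 1 (D.curve _) = _
    rw [hcurve]
    exact (hm _).point
  · change velocity (fun s => φ 1 (D.curve s)) _ = _
    rw [hv, hcurve]
    have hi : (stdParam n i : ℝ) = τ (w.1 i) := by
      simp only [τ]
      congr 2
      apply w.bijective.1
      rw [w.apply_index]
    rw [hi]
    rcases hw : w.1 i with ⟨j, e⟩
    cases e
    · exact (hm j).snd
    · exact (hm j).fst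
  · change φ 1 '' D.realCrossings = _
    ext y
    constructor
    · rintro ⟨z, hz, rfl⟩
      refine ⟨D.label ⟨z, hz⟩, ?_⟩
      refine (hm (D.label ⟨z, hz⟩)).point.symm.trans ?_
      simp [x]
    · rintro ⟨j, rfl⟩
      exact ⟨x j, hxmem j, (hm j).point⟩
  · have h1 := (hm j).point
    have h2 := D.push_label (hφ.contDiff 1) hψ hl (hxmem j) ⟨x j, hxmem j, rfl⟩
    have h3 : D.label ⟨x j, hxmem j⟩ = j := D.label.apply_symm_apply j
    rw [h3] at h2
    refine Eq.trans ?_ h2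
    congr 1
    exact Subtype.ext h1.symm

/-- The map `G j` carries the horizontal and vertical lines through crossing `j` to the right and
left branches. The velocities being standard, `G j` is tangent to the identity, so one isotopy
realizes all these germs; pulling `D` back along it straightens the branches. -/
theorem IsStdToFirstOrder.exists_isStd {w : GaussCode n} {D : MarkedDiagram n}
    (h : IsStdToFirstOrder w D) : ∃ D', (strictSetoid n).r D D' ∧ IsStd w D' := by
  let c : ℝ → Plane := fun t => D.curve t
  have hc : ContDiff ℝ ∞ c := D.smooth
  let τ : Fin n × Side → ℝ := fun y => stdParam n (w.index y)
  have hτ : ∀ y, c (τ y) = stdPos y.1 := by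
    intro y
    have := h.curve_param (w.index y)
    rwa [w.apply_index] at this
  have hτ' : ∀ y, HasDerivAt c (stdDir y.2) (τ y) := by
    intro y
    have := h.velocity_param (w.index y)
    rw [w.apply_index] at this
    rw [← this]
    exact D.hasDerivAt _
  let G : Fin n → Plane → Plane := fun j y => c (τ (j, Side.R) + (y 0 - stdPos j 0)) +
    c (τ (j, Side.L) + (y 1 - stdPos j 1)) - stdPos j
  have hco : ∀ i : Fin 2, ContDiff ℝ ∞ (fun y : Plane => y i) := fun i => by fun_prop
  have hG : ∀ j, ContDiff ℝ ∞ (G j) := fun j =>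
    ((hc.comp (contDiff_const.add ((hco 0).sub contDiff_const))).add
      (hc.comp (contDiff_const.add ((hco 1).sub contDiff_const)))).sub contDiff_const
  have hG0 : ∀ j, G j (stdPos j) = stdPos j := by
    intro j
    simp only [G, sub_self, add_zero, hτ]
    abel
  have hG1 : ∀ j, fderiv ℝ (G j) (stdPos j) = ContinuousLinearMap.id ℝ Plane := by
    intro j
    let pr : Fin 2 → (Plane →L[ℝ] ℝ) := fun i => EuclideanSpace.proj i
    have e : ∀ (i : Fin 2) (s : Side), HasFDerivAt
        (fun y : Plane => c (τ (j, s) + (y i - stdPos j i)))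
        ((pr i).smulRight (stdDir s)) (stdPos j) := by
      intro i s
      have e1 : HasFDerivAt (fun y : Plane => τ (j, s) + (y i - stdPos j i)) (pr i) (stdPos j) :=
        ((pr i).hasFDerivAt.sub_const _).const_add _
      have e2 : HasDerivAt c (stdDir s) (τ (j, s) + (stdPos j i - stdPos j i)) := by
        rw [sub_self, add_zero]; exact hτ' (j, s)
      have e3 := HasFDerivAt.comp (g := c) (stdPos j) e2.hasFDerivAt e1
      refine e3.congr_fderiv ?_
      ext1 y
      simp
    have e3 := ((e 0 Side.R).add (e 1 Side.L)).sub_const (stdPos j)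
    refine (HasFDerivAt.fderiv e3).trans ?_
    ext1 y
    apply plane_ext <;> simp [pr, stdDir]
  obtain ⟨f, ⟨φ, hφ, rfl⟩, hf⟩ := exists_isotopicToId_germs stdPos_injective hG hG0 hG1
  obtain ⟨ψ, hψ, hl, hr⟩ := hφ.diffeo 1
  have hψpos : ∀ j : Fin n, ψ (stdPos j) = stdPos j := by
    intro j
    have := (hf j).self_of_nhds
    rw [hG0] at this
    conv_lhs => rw [← this]
    exact hl _
  refine ⟨D.push hψ (hφ.contDiff 1) hr,
    (strictSetoid n).symm (strict_of_isotopy (hφ.isotopyMove_of_push hψ hr D)),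
    fun i => ?_, ?_, fun j hj => ?_, h.base⟩
  · have hi : (stdParam n i : ℝ) = τ (w.1 i) := by
      simp only [τ]
      congr 2
      apply w.bijective.1
      rw [w.apply_index]
    change ∀ᶠ s : ℝ in 𝓝 _, ψ (c s) = _
    rw [hi]
    have hcont : Tendsto (fun s => stdGerm (w.1 i) (s - τ (w.1 i))) (𝓝 (τ (w.1 i)))
        (𝓝 (stdPos (w.1 i).1)) := by
      have := (hasDerivAt_stdGerm (w.1 i) (τ (w.1 i)) (τ (w.1 i))).continuousAt.tendsto
      simpa [stdGerm] using this
    filter_upwards [hcont.eventually (hf (w.1 i).1)] with s hs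
    have : G (w.1 i).1 (stdGerm (w.1 i) (s - τ (w.1 i))) = c s := by
      rcases hw : w.1 i with ⟨j, e⟩
      cases e
      · simp only [G, stdGerm, stdDir, PiLp.add_apply, PiLp.smul_apply]
        simp [hτ]
      · simp only [G, stdGerm, stdDir, PiLp.add_apply, PiLp.smul_apply]
        simp [hτ]
    rw [← this, ← hs]
    exact hl _
  · change ψ '' D.realCrossings = _
    rw [h.real, ← range_comp]
    congr 1
    exact funext hψpos
  · have hmem : stdPos j ∈ D.realCrossings := h.real ▸ mem_range_self j
    have h2 := D.push_label hψ (hφ.contDiff 1) hr hmem ⟨_, hmem, rfl⟩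
    rw [h.label] at h2
    refine Eq.trans ?_ h2
    congr 1
    exact Subtype.ext (hψpos j).symm

theorem MarkedDiagram.HasGaussCode.exists_isStd (hn : 0 < n) {D : MarkedDiagram n}
    {w : GaussCode n} (hw : D.HasGaussCode w) :
    ∃ D', (strictSetoid n).r D D' ∧ IsStd w D' := by
  obtain ⟨D₁, h1, hb, hJ⟩ := hw.exists_stdParam hn
  obtain ⟨D₂, h2, hD₂⟩ := exists_isStdToFirstOrder hb hJ
  obtain ⟨D₃, h3, hD₃⟩ := hD₂.exists_isStd
  exact ⟨D₃, (strictSetoid n).trans h1 ((strictSetoid n).trans h2 h3), hD₃⟩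

/-! ### Exchanging arcs by detour moves. -/

/-- The parameters that correspond to standard parameters of real crossings. -/
def gridParams (n : ℕ) : Set ℝ := {t | ∃ i : Fin (2 * n), (t : UnitAddCircle) = stdParam n i}

theorem mem_gridParams_iff (hn : 0 < n) {t : ℝ} :
    t ∈ gridParams n ↔ ∃ k : ℤ, t = k / (2 * n) := by
  have h0 : (2 * n : ℝ) ≠ 0 := by positivity
  constructor
  · rintro ⟨i, hi⟩
    obtain ⟨m, hm⟩ := coe_circle_eq_iff.1 hi
    refine ⟨i + m * (2 * n), ?_⟩
    rw [hm, stdParam]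
    push_cast
    field_simp
  · rintro ⟨k, rfl⟩
    have hpos : (0 : ℤ) < 2 * n := by exact_mod_cast (by omega : 0 < 2 * n)
    have h1 := Int.emod_nonneg k hpos.ne'
    have h2 := Int.emod_lt_of_pos k hpos
    refine ⟨⟨(k % (2 * n)).toNat, by omega⟩, coe_circle_eq_iff.2 ⟨k / (2 * n), ?_⟩⟩
    have h3 : (((k % (2 * n)).toNat : ℕ) : ℝ) = ((k % (2 * n) : ℤ) : ℝ) := by
      exact_mod_cast congrArg (Int.cast (R := ℝ)) (Int.toNat_of_nonneg h1)
    have h4 : ((2 * n : ℤ) : ℝ) * ((k / (2 * n) : ℤ) : ℝ) + ((k % (2 * n) : ℤ) : ℝ) = k := by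
      exact_mod_cast Int.mul_ediv_add_emod k (2 * n)
    simp only [stdParam]
    rw [h3, ← h4]
    push_cast
    field_simp
    ring

theorem eventuallyEq_of_coe_eq {α : Type*} {f g : ℝ → α} (hf : Function.Periodic f 1)
    (hg : Function.Periodic g 1) {s t : ℝ} (h : (t : UnitAddCircle) = s) (hs : f =ᶠ[𝓝 s] g) :
    f =ᶠ[𝓝 t] g := by
  obtain ⟨m, rfl⟩ := coe_circle_eq_iff.1 h
  have h1 : Tendsto (fun x : ℝ => x - m) (𝓝 (s + m)) (𝓝 s) := by
    have : Continuous (fun x : ℝ => x - m) := by fun_prop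
    simpa using this.tendsto (s + m)
  filter_upwards [h1.eventually hs] with x hx
  have e1 := hf.sub_int_mul_eq (x := x) m
  have e2 := hg.sub_int_mul_eq (x := x) m
  rw [mul_one] at e1 e2
  rw [← e1, ← e2, hx]

/-- The function that agrees with `f` on the first `k` standard arcs and with `g` on the others. -/
noncomputable def mix (n k : ℕ) {α : Type*} (f g : ℝ → α) (t : ℝ) : α :=
  if Int.fract t < stdParam n k then f t else g t

section mix

variable {α : Type*} {f g : ℝ → α} {k : ℕ}

theorem mix_zero : mix n 0 f g = g := by
  ext1 t
  rw [mix, if_neg]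
  simp [stdParam, Int.fract_nonneg]

theorem stdParam_two_mul (hn : 0 < n) : stdParam n (2 * n) = 1 := by
  unfold stdParam
  push_cast
  have : (2 * n : ℝ) ≠ 0 := by positivity
  exact div_self this

theorem mix_two_mul (hn : 0 < n) : mix n (2 * n) f g = f := by
  ext1 t
  rw [mix, if_pos]
  rw [stdParam_two_mul hn]
  exact Int.fract_lt_one t

theorem periodic_mix (hf : Function.Periodic f 1) (hg : Function.Periodic g 1) :
    Function.Periodic (mix n k f g) 1 := by
  intro t
  unfold mix
  rw [Int.fract_add_one, hf t, hg t]

theorem zero_mem_gridParams_of_fract (hn : 0 < n) {t : ℝ} (h : Int.fract t = 0) :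
    t ∈ gridParams n := by
  refine ⟨⟨0, by omega⟩, coe_circle_eq_iff.2 ⟨⌊t⌋, ?_⟩⟩
  have := Int.floor_add_fract t
  simp only [stdParam, Nat.cast_zero, zero_div, zero_add]
  linarith

theorem mem_gridParams_of_fract (hn : 0 < n) {t : ℝ} (hk : k ≤ 2 * n)
    (h : Int.fract t = stdParam n k) :
    t ∈ gridParams n := by
  have hk' : k < 2 * n := by
    rcases hk.lt_or_eq with h' | rfl
    · exact h'
    · rw [stdParam_two_mul hn] at h
      exact absurd h (Int.fract_lt_one t).ne
  refine ⟨⟨k, hk'⟩, coe_circle_eq_iff.2 ⟨⌊t⌋, ?_⟩⟩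
  have := Int.floor_add_fract t
  simp only [← h]
  linarith

/-- Switches happen only at grid parameters, including the integers where `Int.fract` jumps, and
there `f` and `g` have the same germ. Thus local properties pass to the mixture. -/
theorem mix_locally (hn : 0 < n) (hk : k ≤ 2 * n) (hfg : ∀ t ∈ gridParams n, f =ᶠ[𝓝 t] g) (t : ℝ) :
    (Int.fract t < stdParam n k ∧ mix n k f g =ᶠ[𝓝 t] f) ∨
      (stdParam n k ≤ Int.fract t ∧ mix n k f g =ᶠ[𝓝 t] g) := by
  by_cases ht : t ∈ gridParams n
  · have h := hfg t ht
    have h1 : mix n k f g =ᶠ[𝓝 t] f := by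
      filter_upwards [h] with s hs
      unfold mix
      split_ifs
      exacts [rfl, hs.symm]
    rcases lt_or_ge (Int.fract t) (stdParam n k) with h' | h'
    · exact Or.inl ⟨h', h1⟩
    · exact Or.inr ⟨h', h1.trans h⟩
  · have h0 : 0 < Int.fract t :=
      lt_of_le_of_ne (Int.fract_nonneg t) fun h => ht (zero_mem_gridParams_of_fract hn h.symm)
    have hfl : (⌊t⌋ : ℝ) < t := by have := Int.floor_add_fract t; linarith
    have hfract : ∀ᶠ s : ℝ in 𝓝 t, Int.fract s = s - ⌊t⌋ := by
      filter_upwards [Ioo_mem_nhds hfl (Int.lt_floor_add_one t)] with s hs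
      rw [← Int.self_sub_floor, Int.floor_eq_iff.2 ⟨hs.1.le, hs.2⟩]
    have hcont : Tendsto (fun s : ℝ => s - ⌊t⌋) (𝓝 t) (𝓝 (Int.fract t)) := by
      have : Continuous (fun s : ℝ => s - ⌊t⌋) := by fun_prop
      exact this.tendsto t
    rcases lt_trichotomy (Int.fract t) (stdParam n k) with h | h | h
    · refine Or.inl ⟨h, ?_⟩
      filter_upwards [hfract, hcont.eventually (gt_mem_nhds h)] with s h1 h2
      rw [mix, h1, if_pos h2]
    · exact (ht (mem_gridParams_of_fract hn hk h)).elim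
    · refine Or.inr ⟨h.le, ?_⟩
      filter_upwards [hfract, hcont.eventually (lt_mem_nhds h)] with s h1 h2
      rw [mix, h1, if_neg h2.not_gt]

theorem mix_eventuallyEq_of_mem_gridParams {h : ℝ → α} {t : ℝ} (hf : f =ᶠ[𝓝 t] h)
    (hg : g =ᶠ[𝓝 t] h) : mix n k f g =ᶠ[𝓝 t] h := by
  filter_upwards [hf, hg] with s h1 h2
  unfold mix
  split_ifs
  exacts [h1, h2]

theorem mix_succ_eq (hn : 0 < n) (hk : k < 2 * n) (hfg : ∀ t ∈ gridParams n, f t = g t) {t : ℝ}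
    (ht : Int.fract t ∉ Ioo (stdParam n k) (stdParam n (k + 1))) :
    mix n (k + 1) f g t = mix n k f g t := by
  have hle : stdParam n k ≤ stdParam n (k + 1) := by
    unfold stdParam
    gcongr
    omega
  unfold mix
  split_ifs with h1 h2 h2
  · rfl
  · have : Int.fract t = stdParam n k := by
      by_contra hne
      exact ht ⟨lt_of_le_of_ne (not_lt.1 h2) (Ne.symm hne), h1⟩
    exact hfg t (mem_gridParams_of_fract hn hk.le this)
  · exact (h1 (h2.trans_le hle)).elim
  · rfl

theorem contDiff_mix {E : Type*} [NormedAddCommGroup E] [NormedSpace ℝ E] {f g : ℝ → E}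
    (hn : 0 < n) (hk : k ≤ 2 * n) (hfg : ∀ t ∈ gridParams n, f =ᶠ[𝓝 t] g)
    (hf : ContDiff ℝ ∞ f) (hg : ContDiff ℝ ∞ g) : ContDiff ℝ ∞ (mix n k f g) := by
  rw [contDiff_iff_contDiffAt]
  intro t
  rcases mix_locally hn hk hfg t with ⟨-, h⟩ | ⟨-, h⟩
  · exact hf.contDiffAt.congr_of_eventuallyEq h
  · exact hg.contDiffAt.congr_of_eventuallyEq h

end mix

theorem IsStd.germ_of_mem_gridParams {w : GaussCode n} {D D' : MarkedDiagram n} (h : IsStd w D)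
    (h' : IsStd w D') {t : ℝ} (ht : t ∈ gridParams n) :
    (fun s : ℝ => D.curve s) =ᶠ[𝓝 t] fun s : ℝ => D'.curve s := by
  obtain ⟨i, hi⟩ := ht
  refine eventuallyEq_of_coe_eq D.isGeneric.periodic D'.isGeneric.periodic hi ?_
  filter_upwards [h.germ i, h'.germ i] with s h1 h2
  rw [h1, h2]

theorem not_mem_gridParams_of_mem_Ioo (hn : 0 < n) {k : ℕ} {t : ℝ}
    (ht : t ∈ Ioo (stdParam n k) (stdParam n (k + 1))) : t ∉ gridParams n := by
  rw [mem_gridParams_iff hn]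
  rintro ⟨m, rfl⟩
  have h0 : (0 : ℝ) < 2 * n := by positivity
  have h1 := (div_lt_div_iff_of_pos_right h0).1 ht.1
  have h2 := (div_lt_div_iff_of_pos_right h0).1 ht.2
  have h1' : (k : ℤ) < m := by exact_mod_cast h1
  have h2' : m < (k + 1 : ℤ) := by exact_mod_cast h2
  omega

theorem stdParam_mem_gridParams (hn : 0 < n) (k : ℕ) : stdParam n k ∈ gridParams n :=
  (mem_gridParams_iff hn).2 ⟨k, by simp [stdParam]⟩

/-- Both diagrams have the grid as their set of real parameters, hence the same semiarcs, and they
agree near both ends of the arc that changes. -/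
theorem IsStd.detourMove {w : GaussCode n} (hn : 0 < n) {D D' : MarkedDiagram n} (h : IsStd w D)
    (h' : IsStd w D') {k : ℕ}
    (heq : ∀ t : ℝ, Int.fract t ∉ Ioo (stdParam n k) (stdParam n (k + 1)) →
      D'.curve t = D.curve t) : DetourMove D D' := by
  have hpre : ∀ E : MarkedDiagram n, IsStd w E → ∀ t : ℝ,
      E.curve t ∉ E.realCrossings ↔ t ∉ gridParams n := fun E hE t =>
    not_congr hE.mem_real_iff
  have hset : {s | D'.curve s ∉ D'.realCrossings} = {s | D.curve s ∉ D.realCrossings} := by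
    ext s
    induction s using QuotientAddGroup.induction_on with
    | H t => exact (hpre D' h' t).trans (hpre D h t).symm
  have hlt : stdParam n k < stdParam n (k + 1) := by
    unfold stdParam
    gcongr
    omega
  obtain ⟨z, hz⟩ := exists_between hlt
  have hzD : D.curve (z : ℝ) ∉ D.realCrossings :=
    (hpre D h z).2 (not_mem_gridParams_of_mem_Ioo hn hz)
  have e1 := h.germ_of_mem_gridParams h' (stdParam_mem_gridParams hn k)
  have e2 := h.germ_of_mem_gridParams h' (stdParam_mem_gridParams hn (k + 1))
  obtain ⟨ε₁, ε₁0, hε₁⟩ := Metric.eventually_nhds_iff.1 e1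
  obtain ⟨ε₂, ε₂0, hε₂⟩ := Metric.eventually_nhds_iff.1 e2
  have hreal : D'.realCrossings = D.realCrossings := by rw [h.real, h'.real]
  refine ⟨connectedComponentIn {s | D.curve s ∉ D.realCrossings} z, ⟨z, hzD, rfl⟩,
    ⟨z, (hpre D' h' z).2 (not_mem_gridParams_of_mem_Ioo hn hz), by rw [hset]⟩,
    -- `K` is the arc trimmed at both ends by half the radius on which the curves agree.
    ⟨((↑) : ℝ → UnitAddCircle) '' Icc (stdParam n k + ε₁ / 2) (stdParam n (k + 1) - ε₂ / 2),
      isCompact_Icc.image (AddCircle.continuous_mk' 1), ?_, ?_⟩, hreal, ?_, ?_⟩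
  · rintro _ ⟨x, hx, rfl⟩
    have hx' : x ∈ Ioo (stdParam n k) (stdParam n (k + 1)) :=
      ⟨by linarith [hx.1], by linarith [hx.2]⟩
    change (x : UnitAddCircle) ∈ _
    rw [mem_connectedComponentIn_circle_iff hzD]
    refine ⟨0, fun y hy => (hpre D h y).2 (not_mem_gridParams_of_mem_Ioo hn (k := k) ?_)⟩
    rw [Int.cast_zero, add_zero] at hy
    exact ordConnected_Ioo.uIcc_subset hz hx' hy
  · intro s hs
    induction s using QuotientAddGroup.induction_on with
    | H t =>
      have hft : ((Int.fract t : ℝ) : UnitAddCircle) = t := coe_circle_eq_iff.2 ⟨-⌊t⌋, by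
        rw [← Int.self_sub_floor]; push_cast; ring⟩
      change D'.curve (t : UnitAddCircle) = D.curve (t : UnitAddCircle)
      by_cases hI : Int.fract t ∈ Ioo (stdParam n k) (stdParam n (k + 1))
      · have hnot : Int.fract t ∉ Icc (stdParam n k + ε₁ / 2) (stdParam n (k + 1) - ε₂ / 2) :=
          fun hmem => hs ⟨_, hmem, hft⟩
        rw [← hft]
        rw [mem_Icc, not_and_or, not_le, not_le] at hnot
        rcases hnot with hlt' | hlt'
        · refine (hε₁ ?_).symm
          rw [Real.dist_eq, abs_lt]
          constructor <;> linarith [hI.1]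
        · refine (hε₂ ?_).symm
          rw [Real.dist_eq, abs_lt]
          constructor <;> linarith [hI.2]
      · exact heq t hI
  · intro x hx hx'
    rw [h.real] at hx
    obtain ⟨j, rfl⟩ := hx
    rw [h.label, h'.label]
  · rw [D'.base_eq h'.base, hset, ← D.base_eq h.base]

theorem stdBase_not_mem_gridParams (hn : 0 < n) : stdBase n ∉ gridParams n := by
  rw [mem_gridParams_iff hn]
  rintro ⟨k, hk⟩
  have hn' : (n : ℝ) ≠ 0 := by positivity
  unfold stdBase at hk
  field_simp at hk
  have : (-1 : ℤ) = k * 2 := by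
    have h : ((-1 : ℤ) : ℝ) = ((k * 2 : ℤ) : ℝ) := by push_cast; linarith
    exact_mod_cast h
  omega

/-- A generic curve with standard branches at the standard parameters gives a diagram in standard
form. -/
theorem IsGeneric.exists_isStd (hn : 0 < n) (w : GaussCode n) {c : ℝ → Plane} (hc : IsGeneric c)
    (hg : ∀ i : Fin (2 * n), ∀ᶠ s in 𝓝 (stdParam n i), c s = stdGerm (w.1 i) (s - stdParam n i)) :
    ∃ D : MarkedDiagram n, (∀ t : ℝ, D.curve t = c t) ∧ IsStd w D := by
  have hpos : ∀ x : Fin n × Side, c (stdParam n (w.index x)) = stdPos x.1 := by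
    intro x
    have := (hg (w.index x)).self_of_nhds
    rw [this, w.apply_index]
    simp [stdGerm]
  have hne : ∀ j, (stdParam n (w.index (j, Side.L)) : UnitAddCircle) ≠
      stdParam n (w.index (j, Side.R)) := by
    intro j h
    have := congrArg w.1 (stdParam_coe_injective h)
    rw [w.apply_index, w.apply_index] at this
    simp at this
  let V := VirtualDiagram.ofGeneric hc (range (stdPos : Fin n → Plane)) (by
    rintro _ ⟨j, rfl⟩
    exact ⟨_, _, hne j, hpos _, hpos _⟩)
  have hV : ∀ t : ℝ, V.curve t = c t := fun t => rfl
  -- Otherwise a third branch would pass through a standard crossing.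
  have hb : V.curve (stdBase n : ℝ) ∉ V.realCrossings := by
    rintro ⟨j, hj⟩
    rw [hV] at hj
    rcases hc.no_triple (stdBase n) _ _ (hj.symm.trans (hpos (j, Side.L)).symm)
      ((hpos _).trans (hpos (j, Side.R)).symm) with h | h | h
    · exact stdBase_not_mem_gridParams hn ⟨_, h⟩
    · exact hne j h
    · exact stdBase_not_mem_gridParams hn ⟨_, h⟩
  let D : MarkedDiagram n :=
    { toVirtualDiagram := V
      label := (Equiv.ofInjective stdPos stdPos_injective).symm
      base := connectedComponentIn {s | V.curve s ∉ V.realCrossings} (stdBase n : ℝ)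
      base_isSemiarc := ⟨_, hb, rfl⟩ }
  refine ⟨D, hV, hg, rfl, fun j h => ?_, mem_connectedComponentIn hb⟩
  exact (Equiv.ofInjective stdPos stdPos_injective).symm_apply_apply j

/-- A chain of generic curves in standard form in which consecutive curves differ on one standard
arc only consists of equivalent diagrams. -/
theorem IsStd.strict_of_chain (hn : 0 < n) {w : GaussCode n} {D D' : MarkedDiagram n}
    (h : IsStd w D) (h' : IsStd w D') {M : ℕ → ℝ → Plane} (hM : ∀ k ≤ 2 * n, IsGeneric (M k))
    (hgrid : ∀ k ≤ 2 * n, ∀ t ∈ gridParams n, M k =ᶠ[𝓝 t] fun s : ℝ => D.curve s)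
    (hsucc : ∀ k < 2 * n, ∀ t, Int.fract t ∉ Ioo (stdParam n k) (stdParam n (k + 1)) →
      M (k + 1) t = M k t)
    (h0 : ∀ t : ℝ, M 0 t = D.curve t) (hN : ∀ t : ℝ, M (2 * n) t = D'.curve t) :
    (strictSetoid n).r D D' := by
  have key : ∀ k ≤ 2 * n, ∃ E : MarkedDiagram n, (∀ t : ℝ, E.curve t = M k t) ∧ IsStd w E ∧
      (strictSetoid n).r D E := by
    intro k
    induction k with
    | zero => exact fun _ => ⟨D, fun t => (h0 t).symm, h, (strictSetoid n).refl D⟩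
    | succ k ih =>
      intro hk
      obtain ⟨E, hE, hEs, hDE⟩ := ih (by omega)
      obtain ⟨E', hE', hEs'⟩ := (hM (k + 1) hk).exists_isStd hn w (by
        intro i
        filter_upwards [hgrid (k + 1) hk _ ⟨i, rfl⟩, h.germ i] with s h1 h2
        rw [h1, h2])
      refine ⟨E', hE', hEs', (strictSetoid n).trans hDE (strict_of_detour
        (hEs.detourMove hn hEs' (k := k) fun t ht => ?_))⟩
      rw [hE, hE', hsucc k (by omega) t ht]
  obtain ⟨E, hE, hEs, hDE⟩ := key (2 * n) le_rfl
  -- The last diagram of the chain has the same curve as `D'`; a detour that changes nothing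
  -- identifies the two, so any arc may be named.
  refine (strictSetoid n).trans hDE (strict_of_detour
    (hEs.detourMove hn h' (k := 0) fun t _ => ?_))
  rw [hE, hN]

/-- Genericity on `S` involves only values and velocities at points of `S`, hence only the germs
there. -/
theorem IsGenericOn.of_eventuallyEq {c c' : ℝ → Plane} {S : Set ℝ} (hc : IsGeneric c')
    (h : ∀ t ∈ S, c =ᶠ[𝓝 t] c') : IsGenericOn c S := by
  refine ⟨fun t ht => ?_, fun s hs t ht hst he => ?_, fun r hr s hs t ht h1 h2 => ?_⟩
  · rw [(h t ht).deriv_eq]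
    exact hc.immersed t
  · rw [(h t ht).deriv_eq, (h s hs).deriv_eq]
    rw [(h s hs).self_of_nhds, (h t ht).self_of_nhds] at he
    exact hc.transverse s t hst he
  · rw [(h r hr).self_of_nhds, (h s hs).self_of_nhds] at h1
    rw [(h s hs).self_of_nhds, (h t ht).self_of_nhds] at h2
    exact hc.no_triple r s t h1 h2

/-- A cutoff function that vanishes near the standard parameters and only close to them. -/
theorem exists_cutoff (hn : 0 < n) {U : Set ℝ} (hU : IsOpen U) (hper : ∀ t, t + 1 ∈ U ↔ t ∈ U)
    (hgrid : gridParams n ⊆ U) :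
    ∃ b : ℝ → ℝ, ContDiff ℝ ∞ b ∧ Function.Periodic b 1 ∧ (∀ t, b t = 0 → deriv b t = 0) ∧
      (∀ t, b t = 0 → t ∈ U) ∧ ∀ t ∈ gridParams n, b =ᶠ[𝓝 t] fun _ => 0 := by
  let e : ℝ → ℝ := fun t => 1 - Real.cos (4 * Real.pi * n * t)
  have hes : ContDiff ℝ ∞ e := contDiff_const.sub
    (Real.contDiff_cos.comp (contDiff_const.mul contDiff_id))
  have he0 : ∀ t, 0 ≤ e t := fun t => sub_nonneg.2 (Real.cos_le_one _)
  have hegrid : ∀ t, e t = 0 ↔ t ∈ gridParams n := by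
    intro t
    rw [mem_gridParams_iff hn, sub_eq_zero, eq_comm, Real.cos_eq_one_iff]
    refine exists_congr fun k => ?_
    have hn' : (n : ℝ) ≠ 0 := by positivity
    have hpi := Real.pi_pos.ne'
    rw [eq_div_iff (by positivity)]
    constructor
    · intro h
      have : (2 * Real.pi) * (t * (2 * n)) = (2 * Real.pi) * k := by linarith
      exact mul_left_cancel₀ (by positivity) this
    · intro h
      rw [← h]; ring
  have heper : Function.Periodic e 1 := by
    intro t
    simp only [e]
    congr 1
    have := Real.cos_add_nat_mul_two_pi (4 * Real.pi * n * t) (2 * n)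
    rw [← this]
    congr 1
    push_cast
    ring
  -- `e` vanishes exactly on the grid, so by compactness it is bounded below on the part of a period
  -- outside `U`.
  obtain ⟨κ, κ0, hκ⟩ : ∃ κ > 0, ∀ t ∈ Icc (0 : ℝ) 1, e t ≤ κ → t ∈ U := by
    have hK : IsCompact (Icc (0 : ℝ) 1 ∩ Uᶜ) := isCompact_Icc.inter_right hU.isClosed_compl
    rcases (Icc (0 : ℝ) 1 ∩ Uᶜ).eq_empty_or_nonempty with hemp | hne
    · refine ⟨1, one_pos, fun t ht _ => ?_⟩
      by_contra h
      exact (hemp ▸ (⟨ht, h⟩ : t ∈ Icc (0 : ℝ) 1 ∩ Uᶜ) : t ∈ (∅ : Set ℝ))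
    · obtain ⟨x, hx, hmin⟩ := hK.exists_isMinOn hne hes.continuous.continuousOn
      have hx0 : 0 < e x := lt_of_le_of_ne (he0 x) fun h => hx.2 (hgrid ((hegrid x).1 h.symm))
      refine ⟨e x / 2, by positivity, fun t ht hle => ?_⟩
      by_contra h
      have := isMinOn_iff.1 hmin t ⟨ht, h⟩
      linarith
  let b : ℝ → ℝ := fun t => Real.smoothTransition (e t - κ)
  have hbs : ContDiff ℝ ∞ b := Real.smoothTransition.contDiff.comp (hes.sub contDiff_const)
  have hb0 : ∀ t, b t = 0 ↔ e t ≤ κ := by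
    intro t
    refine ⟨fun h => ?_, fun h => Real.smoothTransition.zero_of_nonpos (by linarith)⟩
    by_contra! hlt
    exact (Real.smoothTransition.pos_of_pos (sub_pos.2 hlt)).ne' h
  refine ⟨b, hbs, ?_, fun t ht => ?_, fun t ht => ?_, fun t ht => ?_⟩
  · intro t
    simp only [b, heper t]
  · have : IsLocalMin b t := by
      refine Filter.Eventually.of_forall fun s => ?_
      rw [ht]
      exact Real.smoothTransition.nonneg _
    exact this.deriv_eq_zero
  · have hU' : ∀ m : ℕ, ∀ t : ℝ, t + m ∈ U ↔ t ∈ U := by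
      intro m
      induction m with
      | zero => simp
      | succ m ih => intro t; push_cast; rw [← add_assoc, hper, ih]
    have h1 : Int.fract t ∈ U := by
      refine hκ _ ⟨Int.fract_nonneg t, (Int.fract_lt_one t).le⟩ ?_
      have := heper.sub_int_mul_eq (x := t) ⌊t⌋
      rw [mul_one, Int.self_sub_floor] at this
      rw [this]
      exact (hb0 t).1 ht
    rw [← Int.self_sub_floor] at h1
    obtain ⟨m, hm | hm⟩ := ⌊t⌋.eq_nat_or_neg
    · rw [hm] at h1
      have := (hU' m (t - m)).2 (by exact_mod_cast h1)
      rwa [sub_add_cancel] at this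
    · rw [hm] at h1
      push_cast at h1
      rw [sub_neg_eq_add] at h1
      exact (hU' m t).1 h1
  · have : e t < κ := by rw [(hegrid t).2 ht]; exact κ0
    filter_upwards [hes.continuous.continuousAt.eventually (gt_mem_nhds this)] with s hs
    exact (hb0 s).2 hs.le

theorem deriv_mix_zero (hn : 0 < n) {k : ℕ} (hk : k ≤ 2 * n) {f g : ℝ → ℝ}
    (hfg : ∀ t ∈ gridParams n, f =ᶠ[𝓝 t] g) (hf : ∀ t, f t = 0 → deriv f t = 0)
    (hg : ∀ t, g t = 0 → deriv g t = 0) (t : ℝ) (ht : mix n k f g t = 0) :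
    deriv (mix n k f g) t = 0 := by
  rcases mix_locally hn hk hfg t with ⟨-, h⟩ | ⟨-, h⟩
  · rw [h.deriv_eq]
    exact hf t (h.self_of_nhds ▸ ht)
  · rw [h.deriv_eq]
    exact hg t (h.self_of_nhds ▸ ht)

/-- Two diagrams in standard form for the same Gauss code are strictly equivalent. -/
theorem IsStd.strict {w : GaussCode n} (hn : 0 < n) {D D' : MarkedDiagram n} (h : IsStd w D)
    (h' : IsStd w D') : (strictSetoid n).r D D' := by
  let c : ℝ → Plane := fun t => D.curve t
  let c' : ℝ → Plane := fun t => D'.curve t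
  have hc : IsGeneric c := D.isGeneric
  have hc' : IsGeneric c' := D'.isGeneric
  have hcc : ∀ t ∈ gridParams n, c =ᶠ[𝓝 t] c' := fun t ht => h.germ_of_mem_gridParams h' ht
  have hone : ∀ t : ℝ, ((t + 1 : ℝ) : UnitAddCircle) = t := fun t =>
    coe_circle_eq_iff.2 ⟨1, by simp⟩
  -- The perturbation may be switched off only where `c` and `c'` agree locally; elsewhere the arcs
  -- of `c` must move to be generic relative to those of `c'`.
  obtain ⟨b, hbs, hbper, hb0, hbU, hbgrid⟩ := exists_cutoff hn (U := {t | c =ᶠ[𝓝 t] c'})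
    (isOpen_iff_mem_nhds.2 fun t ht => ht.eventuallyEq_nhds)
    (fun t => ⟨eventuallyEq_of_coe_eq hc.periodic hc'.periodic (hone t).symm,
      eventuallyEq_of_coe_eq hc.periodic hc'.periodic (hone t)⟩) hcc
  have hzs : ContDiff ℝ ∞ (fun _ : ℝ => (0 : ℝ)) := contDiff_const
  have hzp : Function.Periodic (fun _ : ℝ => (0 : ℝ)) 1 := fun _ => rfl
  have hz0 : ∀ t : ℝ, (fun _ : ℝ => (0 : ℝ)) t = 0 → deriv (fun _ : ℝ => (0 : ℝ)) t = 0 := by simp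
  have hbz : ∀ t ∈ gridParams n, (fun _ : ℝ => (0 : ℝ)) =ᶠ[𝓝 t] b := fun t ht => (hbgrid t ht).symm
  have a1 : ∀ k ∈ Finset.range (2 * n + 1), ∀ᵐ p,
      IsGeneric (fun t => c t + mix n k b (fun _ => 0) t • trigCurve t p) := by
    intro k hk
    have hk' : k ≤ 2 * n := by have := Finset.mem_range.1 hk; omega
    exact ae_isGeneric hc.smooth hc.periodic (contDiff_mix hn hk' hbgrid hbs hzs)
      (periodic_mix hbper hzp) (deriv_mix_zero hn hk' hbgrid hb0 hz0)
      (IsGenericOn.of_eventuallyEq hc fun t _ => EventuallyEq.rfl)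
  -- In the second chain the first `k` arcs come from `c'` and the others from the perturbed `c`.
  -- Where the perturbation vanishes the curve coincides locally with `c'`, so it is generic there.
  have a2 : ∀ k ∈ Finset.range (2 * n + 1), ∀ᵐ p,
      IsGeneric (fun t => mix n k c' c t + mix n k (fun _ => 0) b t • trigCurve t p) := by
    intro k hk
    have hk' : k ≤ 2 * n := by have := Finset.mem_range.1 hk; omega
    have hcc' : ∀ t ∈ gridParams n, c' =ᶠ[𝓝 t] c := fun t ht => (hcc t ht).symm
    refine ae_isGeneric (contDiff_mix hn hk' hcc' hc'.smooth hc.smooth)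
      (periodic_mix hc'.periodic hc.periodic) (contDiff_mix hn hk' hbz hzs hbs)
      (periodic_mix hzp hbper) (deriv_mix_zero hn hk' hbz hz0 hb0)
      (IsGenericOn.of_eventuallyEq hc' fun t ht => ?_)
    rcases mix_locally hn hk' hcc' t with ⟨-, h1⟩ | ⟨h2, h1⟩
    · exact h1
    · refine h1.trans (hbU t ?_)
      have ht' : mix n k (fun _ => 0) b t = 0 := ht
      simpa only [mix, if_neg (not_lt.2 h2)] using ht'
  -- Finitely many almost sure conditions: a single `p` serves both chains, which therefore meet in
  -- the common curve c + b · trigCurve p.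
  obtain ⟨p, hp1, hp2⟩ := ((((Finset.range (2 * n + 1)).eventually_all).2 a1).and
    (((Finset.range (2 * n + 1)).eventually_all).2 a2)).exists
  have g1 : ∀ k, ∀ t ∈ gridParams n,
      (fun t => c t + mix n k b (fun _ => 0) t • trigCurve t p) =ᶠ[𝓝 t] c := by
    intro k t ht
    filter_upwards [mix_eventuallyEq_of_mem_gridParams (k := k) (n := n) (hbgrid t ht)
      EventuallyEq.rfl] with s hs
    rw [hs, zero_smul, add_zero]
  have g2 : ∀ k, ∀ t ∈ gridParams n,
      (fun t => mix n k c' c t + mix n k (fun _ => 0) b t • trigCurve t p) =ᶠ[𝓝 t] c := by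
    intro k t ht
    filter_upwards [mix_eventuallyEq_of_mem_gridParams (k := k) (n := n) EventuallyEq.rfl
      (hbgrid t ht), mix_eventuallyEq_of_mem_gridParams (k := k) (n := n) (hcc t ht).symm
      EventuallyEq.rfl] with s hs hs'
    rw [hs, hs', zero_smul, add_zero]
  have hb00 : ∀ t ∈ gridParams n, b t = 0 := fun t ht => (hbgrid t ht).self_of_nhds
  obtain ⟨E, hE, hEs⟩ := (hp1 (2 * n) (by simp)).exists_isStd hn w (by
    intro i
    filter_upwards [g1 (2 * n) _ ⟨i, rfl⟩, h.germ i] with s h1 h2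
    rw [h1]
    exact h2)
  have hEc : ∀ t : ℝ, E.curve t = c t + b t • trigCurve t p := by
    intro t
    rw [hE, mix_two_mul hn]
  refine (strictSetoid n).trans (h.strict_of_chain hn hEs
    (M := fun k t => c t + mix n k b (fun _ => 0) t • trigCurve t p)
    (fun k hk => hp1 k (Finset.mem_range.2 (by omega))) (fun k _ => g1 k) ?_ ?_ ?_)
    (hEs.strict_of_chain hn h'
    (M := fun k t => mix n k c' c t + mix n k (fun _ => 0) b t • trigCurve t p)
    (fun k hk => hp2 k (Finset.mem_range.2 (by omega))) ?_ ?_ ?_ ?_)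
  · intro k hk t ht
    simp only [mix_succ_eq (f := b) hn hk hb00 ht]
  · intro t
    simp [mix_zero, c]
  · intro t
    exact (hE t).symm
  · intro k _ t ht
    exact (g2 k t ht).trans (h.germ_of_mem_gridParams hEs ht)
  · intro k hk t ht
    simp only [mix_succ_eq (g := b) hn hk (fun t ht => (hb00 t ht).symm) ht,
      mix_succ_eq (f := c') (g := c) hn hk (fun t ht => (hcc t ht).symm.self_of_nhds) ht]
  · intro t
    simp only [mix_zero, hEc]
  · intro t
    simp [mix_two_mul hn, c']

/-! ### Realization of every Gauss code. -/

/-- The index of a standard parameter with a given integral multiple of the step. -/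
noncomputable def stdIndex (hn : 0 < n) (m : ℤ) : Fin (2 * n) :=
  ⟨(m % (2 * n)).toNat, by
    have hpos : (0 : ℤ) < 2 * n := by exact_mod_cast (by omega : 0 < 2 * n)
    have := Int.emod_nonneg m hpos.ne'
    have := Int.emod_lt_of_pos m hpos
    omega⟩

theorem coe_stdParam_stdIndex (hn : 0 < n) (m : ℤ) :
    (stdParam n (stdIndex hn m) : UnitAddCircle) = ((m / (2 * n) : ℝ) : UnitAddCircle) := by
  have h0 : (2 * n : ℝ) ≠ 0 := by positivity
  have hpos : (0 : ℤ) < 2 * n := by exact_mod_cast (by omega : 0 < 2 * n)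
  have h1 := Int.emod_nonneg m hpos.ne'
  symm
  refine coe_circle_eq_iff.2 ⟨m / (2 * n), ?_⟩
  have h3 : (((m % (2 * n)).toNat : ℕ) : ℝ) = ((m % (2 * n) : ℤ) : ℝ) := by
    exact_mod_cast congrArg (Int.cast (R := ℝ)) (Int.toNat_of_nonneg h1)
  have h4 : ((2 * n : ℤ) : ℝ) * ((m / (2 * n) : ℤ) : ℝ) + ((m % (2 * n) : ℤ) : ℝ) = m := by
    exact_mod_cast Int.mul_ediv_add_emod m (2 * n)
  simp only [stdParam, stdIndex]
  rw [h3, ← h4]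
  push_cast
  field_simp
  ring

/-- A smooth closed curve with standard branches at the standard parameters. -/
theorem exists_curve_with_stdGerms (hn : 0 < n) (w : GaussCode n) :
    ∃ (c : ℝ → Plane) (U : Set ℝ), ContDiff ℝ ∞ c ∧ Function.Periodic c 1 ∧ IsOpen U ∧
      (∀ t, t + 1 ∈ U ↔ t ∈ U) ∧ gridParams n ⊆ U ∧
      ∀ t ∈ U, ∃ m : ℤ, |2 * n * t - m| < 1 / 2 ∧
        c =ᶠ[𝓝 t] fun s => stdGerm (w.1 (stdIndex hn m)) (s - m / (2 * n)) := by
  have hn1 : (1 : ℝ) ≤ n := by exact_mod_cast hn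
  have h2n : (0 : ℝ) < 2 * n := by positivity
  -- `r t / (2n)` is the grid parameter nearest to `t`, and `g` follows the standard branch there.
  -- `e` is 1 on the grid and -1 midway, where `g` jumps.
  let r : ℝ → ℤ := fun t => ⌊2 * n * t + 1 / 2⌋
  let e : ℝ → ℝ := fun t => Real.cos (2 * Real.pi * (2 * n * t))
  let g : ℝ → Plane := fun t => stdGerm (w.1 (stdIndex hn (r t))) (t - r t / (2 * n))
  let η : ℝ → ℝ := fun t => Real.smoothTransition (2 * e t)
  have hes : ContDiff ℝ ∞ e :=
    Real.contDiff_cos.comp (contDiff_const.mul (contDiff_const.mul contDiff_id))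
  have hηs : ContDiff ℝ ∞ η := Real.smoothTransition.contDiff.comp (contDiff_const.mul hes)
  have heper : Function.Periodic e 1 := by
    intro t
    simp only [e]
    have := Real.cos_add_nat_mul_two_pi (2 * Real.pi * (2 * n * t)) (2 * n)
    rw [← this]
    congr 1
    push_cast
    ring
  have hrper : ∀ t, r (t + 1) = r t + 2 * n := by
    intro t
    simp only [r]
    rw [← Int.floor_add_intCast]
    congr 1
    push_cast
    ring
  have hgper : Function.Periodic g 1 := by
    intro t
    have h1 : stdIndex hn (r t + 2 * n) = stdIndex hn (r t) := by
      apply Fin.ext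
      simp [stdIndex]
    simp only [g, hrper, h1]
    congr 1
    push_cast
    field_simp
    ring
  have hbd : ∀ t, |2 * n * t - r t| ≤ 1 / 2 := by
    intro t
    have h1 := Int.floor_le (2 * n * t + 1 / 2)
    have h2 := Int.lt_floor_add_one (2 * n * t + 1 / 2)
    rw [abs_le]
    constructor <;> simp only [r] <;> linarith
  have hecos : ∀ t, e t = Real.cos (2 * Real.pi * |2 * n * t - r t|) := by
    intro t
    have h1 : 2 * Real.pi * |2 * n * t - r t| = |2 * Real.pi * (2 * n * t - r t)| := by
      rw [abs_mul, abs_of_pos (by positivity : 0 < 2 * Real.pi)]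
    rw [h1, Real.cos_abs]
    have := Real.cos_sub_int_mul_two_pi (2 * Real.pi * (2 * n * t)) (r t)
    simp only [e]
    rw [← this]
    congr 1
    ring
  have hclose : ∀ t, 0 < e t → |2 * n * t - r t| < 1 / 4 := by
    intro t ht
    by_contra! hle
    rw [hecos] at ht
    refine absurd ht (not_lt.2 (Real.cos_nonpos_of_pi_div_two_le_of_le ?_ ?_))
    · nlinarith [Real.pi_pos]
    · nlinarith [Real.pi_pos, hbd t]
  have hgerm : ∀ t, |2 * n * t - r t| < 1 / 2 →
      g =ᶠ[𝓝 t] fun s => stdGerm (w.1 (stdIndex hn (r t))) (s - r t / (2 * n)) := by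
    intro t ht
    have hopen : IsOpen {s : ℝ | |2 * n * s - r t| < 1 / 2} :=
      isOpen_lt (by fun_prop) continuous_const
    filter_upwards [hopen.mem_nhds ht] with s hs
    have : r s = r t := by
      have hs' : |2 * n * s - r t| < 1 / 2 := hs
      rw [abs_lt] at hs'
      exact Int.floor_eq_iff.2 ⟨by linarith, by linarith⟩
    simp only [g, this]
  have hgermd : ∀ (x : Fin n × Side) (τ : ℝ), ContDiff ℝ ∞ (fun s : ℝ => stdGerm x (s - τ)) := by
    intro x τ
    exact contDiff_const.add ((contDiff_id.sub contDiff_const).smul contDiff_const)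
  -- `η` is 1 where e ≥ 1/2 and 0 where e ≤ 0, which hides the jumps of `g`. Between crossings the
  -- curve rests at the origin; only the later perturbation makes it an immersion.
  refine ⟨fun t => η t • g t, {t | 1 / 2 < e t}, ?_, fun t => ?_, ?_, fun t => ?_, ?_, ?_⟩
  · rw [contDiff_iff_contDiffAt]
    intro t
    by_cases ht : |2 * n * t - r t| < 1 / 2
    · refine ContDiffAt.congr_of_eventuallyEq
        (hηs.smul (hgermd (w.1 (stdIndex hn (r t))) (r t / (2 * n)))).contDiffAt ?_
      filter_upwards [hgerm t ht] with s hs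
      rw [hs]
      rfl
    · have h1 : |2 * n * t - r t| = 1 / 2 := le_antisymm (hbd t) (not_lt.1 ht)
      have h2 : e t < 0 := by
        rw [hecos, h1, show 2 * Real.pi * (1 / 2) = Real.pi by ring, Real.cos_pi]
        norm_num
      refine ContDiffAt.congr_of_eventuallyEq (contDiffAt_const (c := (0 : Plane))) ?_
      filter_upwards [hes.continuous.continuousAt.eventually (gt_mem_nhds h2)] with s hs
      have : η s = 0 := Real.smoothTransition.zero_of_nonpos (by linarith)
      simp only [this, zero_smul]
  · simp only [η, heper t, hgper t]
  · exact isOpen_lt continuous_const hes.continuous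
  · simp only [mem_ofPred_eq, heper t]
  · intro t ht
    obtain ⟨k, rfl⟩ := (mem_gridParams_iff hn).1 ht
    have : e (k / (2 * n)) = 1 := by
      rw [← Real.cos_int_mul_two_pi k]
      simp only [e]
      congr 1
      field_simp
    simp only [mem_ofPred_eq, this]
    norm_num
  · intro t ht
    have ht' : 1 / 2 < e t := ht
    have h1 := hclose t (by linarith)
    refine ⟨r t, by linarith, ?_⟩
    · filter_upwards [hgerm t (by linarith),
        hes.continuous.continuousAt.eventually (lt_mem_nhds ht')] with s hs hs'
      have : η s = 1 := Real.smoothTransition.one_of_one_le (by linarith)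
      rw [this, one_smul, hs]

/-- Up to time 1/4 a standard branch stays within distance 1/4 of its crossing, while different
crossings are at distance at least 1. Branches with equal sides run in the same direction, so
position determines time. -/
theorem stdGerm_eq_stdGerm {x y : Fin n × Side} {a b : ℝ} (ha : |a| < 1 / 4) (hb : |b| < 1 / 4)
    (h : stdGerm x a = stdGerm y b) : x.1 = y.1 ∧ (x.2 = y.2 → a = b) := by
  obtain ⟨i, u⟩ := x
  obtain ⟨j, v⟩ := y
  have h0 := congrArg (fun z : Plane => z 0) h
  have h1 := congrArg (fun z : Plane => z 1) h
  rw [abs_lt] at ha hb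
  have hij : ∀ δ : ℝ, |δ| < 1 / 2 → (i : ℝ) = j + δ → i = j := by
    intro δ hδ he
    rw [abs_lt] at hδ
    have h2 : ((i : ℕ) : ℝ) < (j : ℕ) + 1 := by linarith [hδ.2]
    have h3 : ((j : ℕ) : ℝ) < (i : ℕ) + 1 := by linarith [hδ.1]
    have h2' : (i : ℕ) < j + 1 := by exact_mod_cast h2
    have h3' : (j : ℕ) < i + 1 := by exact_mod_cast h3
    exact Fin.ext (by omega)
  cases u <;> cases v <;> simp [stdGerm, stdPos, stdDir] at h0 h1 ⊢
  · exact ⟨hij 0 (by norm_num) (by simp [h0]), h1⟩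
  · exact hij b (by rw [abs_lt]; constructor <;> linarith) h0
  · exact hij (-a) (by rw [abs_lt]; constructor <;> linarith) (by linarith)
  · have := hij (b - a) (by rw [abs_lt]; constructor <;> linarith) (by linarith)
    subst this
    exact ⟨rfl, by linarith⟩

/-- Every Gauss code is the code of a diagram in standard form. -/
theorem exists_isStd (hn : 0 < n) (w : GaussCode n) : ∃ D : MarkedDiagram n, IsStd w D := by
  obtain ⟨c, U, hcs, hcper, hU, hUper, hUgrid, hUc⟩ := exists_curve_with_stdGerms hn w
  obtain ⟨b, hbs, hbper, hb0, hbU, hbgrid⟩ := exists_cutoff hn hU hUper hUgrid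
  have hn1 : (1 : ℝ) ≤ n := by exact_mod_cast hn
  have h2n : (0 : ℝ) < 2 * n := by positivity
  have hval : ∀ {t : ℝ} {m : ℤ}, (c =ᶠ[𝓝 t] fun s => stdGerm (w.1 (stdIndex hn m))
      (s - m / (2 * n))) → c t = stdGerm (w.1 (stdIndex hn m)) (t - m / (2 * n)) :=
    fun h => h.self_of_nhds
  have hder : ∀ {t : ℝ} {m : ℤ}, (c =ᶠ[𝓝 t] fun s => stdGerm (w.1 (stdIndex hn m))
      (s - m / (2 * n))) → deriv c t = stdDir (w.1 (stdIndex hn m)).2 := by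
    intro t m h
    rw [h.deriv_eq]
    exact (hasDerivAt_stdGerm _ _ _).deriv
  have hclass : ∀ t ∈ U, ∃ x : Fin n × Side, deriv c t = stdDir x.2 ∧
      ∃ m : ℤ, w.1 (stdIndex hn m) = x ∧ |t - m / (2 * n)| < 1 / 4 ∧
        c t = stdGerm x (t - m / (2 * n)) := by
    -- The bound 1/4 comes from |2nt - m| < 1/2 divided by 2n ≥ 2.
    intro t ht
    obtain ⟨m, h1, h2⟩ := hUc t ht
    refine ⟨_, hder h2, m, rfl, ?_, hval h2⟩
    have h3 : t - m / (2 * n) = (2 * n * t - m) / (2 * n) := by field_simp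
    rw [h3, abs_div, abs_of_pos h2n, div_lt_iff₀ h2n]
    linarith
  have : Nonempty (Fin n × Side) := ⟨(⟨0, hn⟩, Side.L)⟩
  choose! x hx hm using hclass
  have hfst : ∀ s ∈ U, ∀ t ∈ U, c s = c t → (x s).1 = (x t).1 := by
    intro s hs t ht he
    obtain ⟨m, h1, h2, h3⟩ := hm s hs
    obtain ⟨m', h1', h2', h3'⟩ := hm t ht
    exact (stdGerm_eq_stdGerm h2 h2' (h3 ▸ h3' ▸ he)).1
  have hsnd : ∀ s ∈ U, ∀ t ∈ U, c s = c t → (x s).2 = (x t).2 → (s : UnitAddCircle) = t := by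
    intro s hs t ht he hside
    have hfst' := hfst s hs t ht he
    obtain ⟨m, h1, h2, h3⟩ := hm s hs
    obtain ⟨m', h1', h2', h3'⟩ := hm t ht
    have hab := (stdGerm_eq_stdGerm h2 h2' (h3 ▸ h3' ▸ he)).2 hside
    have hidx : stdIndex hn m = stdIndex hn m' := by
      apply w.bijective.1
      rw [h1, h1']
      exact Prod.ext hfst' hside
    have hmm := coe_stdParam_stdIndex hn m
    rw [hidx, coe_stdParam_stdIndex hn m', coe_circle_eq_iff] at hmm
    obtain ⟨k, hk⟩ := hmm
    exact coe_circle_eq_iff.2 ⟨-k, by push_cast; linarith⟩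
  -- Where `b` vanishes, `c` runs along standard segments. Different parameters at the same point
  -- have different sides, so the branches are perpendicular, and with only two sides no three of
  -- them can meet.
  have hgen : IsGenericOn c {t | b t = 0} := by
    refine ⟨fun t ht => ?_, fun s hs t ht hst he => ?_, fun r hr s hs t ht h1 h2 => ?_⟩
    · rw [hx t (hbU t ht)]
      intro h0
      have e0 := congrArg (fun z : Plane => z 0) h0
      have e1 := congrArg (fun z : Plane => z 1) h0
      rcases hxs : (x t).2 with _ | _ <;> simp [hxs, stdDir] at e0 e1
    · have hne : (x s).2 ≠ (x t).2 := fun h =>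
        hst (hsnd s (hbU s hs) t (hbU t ht) he h)
      rw [hx s (hbU s hs), hx t (hbU t ht)]
      rcases hxs : (x s).2 with _ | _ <;> rcases hxt : (x t).2 with _ | _ <;>
        rw [hxs, hxt] at hne <;> first | exact absurd rfl hne | simp [stdDir, det2]
    · by_contra! hne
      have n1 : (x r).2 ≠ (x s).2 := fun h => hne.1 (hsnd r (hbU r hr) s (hbU s hs) h1 h)
      have n2 : (x s).2 ≠ (x t).2 := fun h => hne.2.1 (hsnd s (hbU s hs) t (hbU t ht) h2 h)
      have n3 : (x r).2 ≠ (x t).2 := fun h =>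
        hne.2.2 (hsnd r (hbU r hr) t (hbU t ht) (h1.trans h2) h)
      rcases hxr : (x r).2 with _ | _ <;> rcases hxs : (x s).2 with _ | _ <;>
        rcases hxt : (x t).2 with _ | _ <;> simp [hxr, hxs, hxt] at n1 n2 n3
  obtain ⟨p, hp⟩ := (ae_isGeneric hcs hcper hbs hbper hb0 hgen).exists
  obtain ⟨D, -, hD⟩ := hp.exists_isStd hn w (by
    intro i
    have hi : stdParam n i ∈ gridParams n := ⟨i, rfl⟩
    have hcg : c =ᶠ[𝓝 (stdParam n i)] fun s => stdGerm (w.1 i) (s - stdParam n i) := by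
      obtain ⟨m, h1, h2⟩ := hUc _ (hUgrid hi)
      have hmi : (m : ℝ) = i := by
        have h3 : 2 * n * stdParam n i = (i : ℕ) := by unfold stdParam; field_simp
        rw [h3, abs_lt] at h1
        have h4 : (m : ℝ) < (i : ℕ) + 1 := by linarith [h1.1]
        have h5 : ((i : ℕ) : ℝ) < m + 1 := by linarith [h1.2]
        have h4' : m < (i : ℕ) + 1 := by exact_mod_cast h4
        have h5' : ((i : ℕ) : ℤ) < m + 1 := by exact_mod_cast h5
        have h6 : m = (i : ℕ) := by omega
        exact_mod_cast congrArg (Int.cast (R := ℝ)) h6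
      have : stdIndex hn m = i := by
        have : m = (i : ℕ) := by exact_mod_cast hmi
        apply Fin.ext
        simp only [stdIndex, this]
        rw [Int.emod_eq_of_lt (by omega) (by exact_mod_cast i.2)]
        simp
      rw [this, hmi] at h2
      exact h2
    filter_upwards [hcg, hbgrid _ hi] with s h1 h2
    rw [h2, zero_smul, add_zero, h1])
  exact ⟨D, hD⟩

end VirtualDoodle

theorem proposition2p1 (n : ℕ) (hn : 0 < n) :
    (∀ D : VirtualDoodle.MarkedDiagram n,
      ∃! w : VirtualDoodle.GaussCode n, D.HasGaussCode w) ∧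
    ∃ Φ : VirtualDoodle.StrictClass n → VirtualDoodle.GaussCode n,
      Function.Bijective Φ ∧
      ∀ D : VirtualDoodle.MarkedDiagram n,
        D.HasGaussCode (Φ (Quotient.mk (VirtualDoodle.strictSetoid n) D)) := by
  refine ⟨fun D => ?_, ?_⟩
  · obtain ⟨w, hw⟩ := D.exists_hasGaussCode
    exact ⟨w, hw, fun w' hw' => D.hasGaussCode_unique hw' hw⟩
  · choose code hcode using fun D : VirtualDoodle.MarkedDiagram n => D.exists_hasGaussCode
    refine ⟨Quotient.lift code fun D D' h => ?_, ⟨?_, fun w => ?_⟩, hcode⟩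
    · exact D'.hasGaussCode_unique
        ((VirtualDoodle.hasGaussCode_iff_of_equiv h _).1 (hcode D)) (hcode D')
    · intro a b
      induction a using Quotient.inductionOn with | h D => ?_
      induction b using Quotient.inductionOn with | h D' => ?_
      intro h
      have h' : code D = code D' := h
      obtain ⟨E, hDE, hE⟩ := (hcode D).exists_isStd hn
      obtain ⟨E', hDE', hE'⟩ := (hcode D').exists_isStd hn
      rw [← h'] at hE'
      exact Quotient.sound ((VirtualDoodle.strictSetoid n).trans hDE
        ((VirtualDoodle.strictSetoid n).trans (hE.strict hn hE')
          ((VirtualDoodle.strictSetoid n).symm hDE')))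
    · obtain ⟨D, hD⟩ := VirtualDoodle.exists_isStd hn w
      exact ⟨Quotient.mk _ D, D.hasGaussCode_unique (hcode D) hD.hasGaussCode⟩
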